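/- **Setting.** Fix $d>0$ and let $L\subset\mathbb R^2$ be the hexagonal (triangular) lattice of spacing $d$ containing the origin $O$; two lattice points are adjacent if their distance is $d$. Let $p_1,\dots,p_6$ be the neighbours of $O$ in clockwise order, with $p_3$ directly to the right of $O$ (so $p_6$ is to its left and $p_1,p_2$ are above). Number lattice rows by height, $O$ being in row $0$; let $H_1$ (resp. $H_2$) be the set of lattice points in rows $\ge 2$ (resp. $\le -2$). *Ribbons.* For $P\subset L$ and a lattice point $x$, the hop count $h(x)$ is the length of a shortest lattice path from $x$ to $O$ with all its points in $P\cup\{O,p_1,\dots,p_6\}$, and $-1$ if there is none. The ribbons of $P$ are the connected components of the sets of points of $P$ with equal hop count; that hop count is the gradient of the ribbon, and its number of points is its length. A ribbon of gradient $k$ is directed: there is an arc $x\to x'$ when $x,x'\in P$ have hop count $k$ and $x'$ is obtained from $x$ by a clockwise rotation by $\pi/3$ about a common neighbour of hop count $k-1$. In a ribbon, $x$ is in front of $y$ if there is a directed path from $y$ to $x$; the first vertex is the one with no other vertex in front of it. A ribbon $Q$ is a parent of $R$ if its gradient is one less than that of $R$ and every vertex of $R$ is adjacent to a vertex of $Q$;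 for $R$ of gradient $2$ the parent is $(p_2,p_1)$. Ancestor and descendant ribbons are defined by chains of parents. *Shape.* Let $S\subset H_1$ be a finite set of lattice points representing a topological disk ($S$ and $L\setminus S$ are both connected in the adjacency graph), with a proper ribbonization: $S$ contains none of $O,p_1,\dots,p_6$; every point of $S$ has positive hop count; every ribbon of $S$ has length at least $2$; there is exactly one ribbon of gradient $2$, and it has length $3$; if $x,y\in S$ and $\|x-y\|=2d$ then the midpoint of $x,y$ is in $S$; if $x,y\in S$ and $\|x-y\|=\sqrt3\,d$ then at least one of the two common neighbours of $x,y$ is in $S$. Put $N=|S|$. *Additive stage.* Seed robots stay at $O,p_1,p_2,p_4,p_5$. At least $N$ further (idle) robots initially occupy a finite set $I\subset H_2$ such that each ribbon of $H_2$ is either filled or empty and all ancestors (among the ribbons of $H_2$) of a filled ribbon are filled. In epoch $n=1,\dots,N$ the robot at $s[n]$ moves to $t[n]$. Here $s[n]$ is the rearmost not yet listed point of $I$ on the outermost ribbon of $H_2$ (in the tree order) that has such a point, and $t[n]$ is the frontmost not yet listed point of $S$ on the smallest ribbon having such a point, with respect to some strict total order of the ribbons of $S$ in which ancestors precede descendants.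 Consider the configuration of robots after epoch $N$. The culminating edge-following path is the set of points of the plane whose distance to the nearest robot equals $d$. The culminating affiliated path $\widehat{AP}$ is its segment from $p_6$ to $p_3$, oriented clockwise: a chain of arcs of central angle $\pi/3$, each running clockwise about a robot from one lattice point to an adjacent one and lying on the edge-following path, with no lattice point visited twice. A point of $\widehat{AP}$ is contributed by a robot if it is at distance $d$ from that robot's centre. For points $x,y$ of $\widehat{AP}$, $x$ is in front of $y$ if travelling along $\widehat{AP}$ in its direction (from $p_6$ to $p_3$) leads from $y$ to $x$ (possibly $x=y$). A merging point of a ribbon $R$ of $S$ with first vertex $x$ is a lattice point $m\notin S$ adjacent to $x$ such that some vertex $y$ of the parent ribbon of $R$ is adjacent to both $x$ and $m$. **Statement.** 1. Every ribbon $R$ of $S$ has exactly one merging point $m(R)$. 2. The affiliated path $\widehat{AP}$ exists, and for every ribbon $R$ of $S$ the point $m(R)$ lies on $\widehat{AP}$ and is in front of every point of $\widehat{AP}$ contributed by a robot belonging to $R$. 3. If $R_j$ is a descendant ribbon of $R_i$, then $m(R_i)$ is in front of $m(R_j)$ along $\widehat{AP}$. -/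

import Mathlib

open scoped Real

namespace RibbonFormation

/-! ### The hexagonal lattice -/

/-- A lattice point, in the integer coordinates of the basis `1`, `exp (iπ/3)`. -/
abbrev Lat := ℤ × ℤ

/-- The position in the plane of a lattice point, for lattice spacing `d`. -/
noncomputable def pos (d : ℝ) (x : Lat) : ℂ :=
  (d : ℂ) * ((x.1 : ℂ) + (x.2 : ℂ) * Complex.exp (((π / 3 : ℝ) : ℂ) * Complex.I))

/-- The squared length of a lattice vector, in units of `d ^ 2` (see `dist_pos`). -/
def sqLen (v : Lat) : ℤ := v.1 ^ 2 + v.1 * v.2 + v.2 ^ 2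

theorem exp_pi_div_three :
    Complex.exp (((π / 3 : ℝ) : ℂ) * Complex.I)
      = ⟨1 / 2, √3 / 2⟩ := by
  rw [Complex.exp_mul_I, ← Complex.ofReal_cos, ← Complex.ofReal_sin, Real.cos_pi_div_three,
    Real.sin_pi_div_three]
  apply Complex.ext <;> simp

theorem dist_pos {d : ℝ} (hd : 0 < d) (x y : Lat) :
    dist (pos d x) (pos d y) = d * √(sqLen (x - y) : ℝ) := by
  have h3 : √3 * √3 = (3 : ℝ) := Real.mul_self_sqrt (by norm_num)
  have key : pos d x - pos d y
      = (d : ℂ) * (⟨(x.1 - y.1) + (x.2 - y.2) / 2, (x.2 - y.2) * (√3 / 2)⟩ : ℂ) := by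
    unfold pos
    rw [exp_pi_div_three]
    apply Complex.ext <;> simp <;> ring
  rw [Complex.dist_eq, key, norm_mul, Complex.norm_real, Real.norm_of_nonneg hd.le,
    Complex.norm_def]
  congr 2
  simp only [Complex.normSq_mk, sqLen, Prod.fst_sub, Prod.snd_sub]
  push_cast
  linear_combination ((x.2 : ℝ) - y.2) ^ 2 / 4 * h3

/-- The graph `Γ`: two lattice points are adjacent iff their distance is `d`. -/
def hexGraph : SimpleGraph Lat where
  Adj x y := sqLen (x - y) = 1
  symm := ⟨fun x y h => by
    simp only [sqLen, Prod.fst_sub, Prod.snd_sub] at h ⊢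
    linear_combination h⟩
  loopless := ⟨fun x h => by simp [sqLen] at h⟩

theorem hexGraph_adj_iff {d : ℝ} (hd : 0 < d) (x y : Lat) :
    hexGraph.Adj x y ↔ dist (pos d x) (pos d y) = d := by
  rw [dist_pos hd]
  constructor
  · intro h
    have h' : sqLen (x - y) = 1 := h
    simp [h']
  · intro h
    have h1 : √(sqLen (x - y) : ℝ) = 1 := by
      have : d * √(sqLen (x - y) : ℝ) = d * 1 := by rw [h, mul_one]
      exact mul_left_cancel₀ hd.ne' this
    have h2 : (sqLen (x - y) : ℝ) = 1 := Real.sqrt_eq_one.mp h1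
    exact_mod_cast h2

/-- Clockwise rotation of a lattice vector by `π / 3` (see `pos_cw`). -/
def cw (v : Lat) : Lat := (v.1 + v.2, -v.1)

theorem pos_cw (d : ℝ) (v : Lat) :
    pos d (cw v) = pos d v * Complex.exp (-(((π / 3 : ℝ) : ℂ) * Complex.I)) := by
  have h3 : √3 * √3 = (3 : ℝ) := Real.mul_self_sqrt (by norm_num)
  have he : Complex.exp (-(((π / 3 : ℝ) : ℂ) * Complex.I)) = ⟨1 / 2, -(√3 / 2)⟩ := by
    rw [Complex.exp_neg, exp_pi_div_three, eq_comm]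
    apply eq_inv_of_mul_eq_one_left
    apply Complex.ext
    · simp only [Complex.mul_re, Complex.one_re]
      linear_combination h3 / 4
    · simp only [Complex.mul_im, Complex.one_im]
      ring
  rw [he]
  unfold pos
  rw [exp_pi_div_three]
  apply Complex.ext
  · simp [cw]
    linear_combination (-(d * v.2) / 4) * h3
  · simp [cw]
    ring

/-- The origin. -/
def O : Lat := (0, 0)

/-! The six neighbours of the origin, in clockwise order; `p3` is to the right of the origin. -/

def p1 : Lat := (-1, 1)
def p2 : Lat := (0, 1)
def p3 : Lat := (1, 0)
def p4 : Lat := (1, -1)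
def p5 : Lat := (0, -1)
def p6 : Lat := (-1, 0)

/-- The positions of the seed robots, which never move. -/
def seeds : Set Lat := {O, p1, p2, p4, p5}

/-- The lattice points of the formation half-plane. -/
def H1 : Set Lat := {x | 2 ≤ x.2}

/-- The lattice points of the idle half-plane. -/
def H2 : Set Lat := {x | x.2 ≤ -2}

/-! ### Hop counts and ribbons -/

/-- The graph `Γ` restricted to `P` together with the origin and its six neighbours. -/
def hopGraph (P : Set Lat) : SimpleGraph Lat where
  Adj x y := hexGraph.Adj x y ∧ x ∈ P ∪ {O, p1, p2, p3, p4, p5, p6} ∧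
    y ∈ P ∪ {O, p1, p2, p3, p4, p5, p6}
  symm := ⟨fun _ _ h => ⟨h.1.symm, h.2.2, h.2.1⟩⟩
  loopless := ⟨fun x h => hexGraph.loopless.irrefl x h.1⟩

open Classical in
/-- The hop count induced by `P`: length of a shortest path to the origin through `P` and
`p1, …, p6`, and `-1` if there is no such path. (So the six neighbours of `O` get hop count `1`.) -/
noncomputable def hop (P : Set Lat) (x : Lat) : ℤ :=
  if (hopGraph P).Reachable x O then ((hopGraph P).dist x O : ℤ) else -1

/-- Adjacency between points of `P` of equal hop count. -/
def levelGraph (P : Set Lat) : SimpleGraph Lat where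
  Adj x y := hexGraph.Adj x y ∧ x ∈ P ∧ y ∈ P ∧ hop P x = hop P y
  symm := ⟨fun _ _ h => ⟨h.1.symm, h.2.2.1, h.2.1, h.2.2.2.symm⟩⟩
  loopless := ⟨fun x h => hexGraph.loopless.irrefl x h.1⟩

/-- The vertex set of the ribbon `R(x)` of a point `x ∈ P`: the component of `x` among the points
of `P` of the same hop count. -/
def ribbonOf (P : Set Lat) (x : Lat) : Set Lat := {y | (levelGraph P).Reachable x y}

/-- `R` is (the vertex set of) a ribbon of `P`; its arcs are given by `Arc P`. -/
def IsRibbon (P R : Set Lat) : Prop := ∃ x ∈ P, R = ribbonOf P x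

/-- All points of `R` have hop count `k`, i.e. the gradient of the ribbon `R` is `k`. -/
def HasGradient (P R : Set Lat) (k : ℤ) : Prop := ∀ x ∈ R, hop P x = k

/-- The arcs of the directed ribbons: from `x` to a point `x'` with the same hop count `k`, where
`x'` is obtained from `x` by a clockwise rotation by `π / 3` around a common neighbour of hop
count `k - 1`. (If `x` has only one neighbour of hop count `k - 1`, then both the arc entering and
the arc leaving `x` turn around it; if there are two, then the entering arc turns around one and
the leaving arc around the other.) -/
def Arc (P : Set Lat) (x x' : Lat) : Prop :=
  x ∈ P ∧ x' ∈ P ∧ 0 < hop P x ∧ hop P x' = hop P x ∧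
    ∃ y, hexGraph.Adj y x ∧ hop P y = hop P x - 1 ∧ x' = y + cw (x - y)

/-- `x` is in front of `y` on their ribbon: there is a directed path from `y` to `x`
(possibly of length zero). -/
def RibbonInFront (P : Set Lat) (x y : Lat) : Prop := Relation.ReflTransGen (Arc P) y x

/-- `x` is the first vertex of the ribbon `R`: no other vertex is in front of it. -/
def IsFirstVertex (P R : Set Lat) (x : Lat) : Prop :=
  x ∈ R ∧ ∀ y ∈ R, RibbonInFront P y x → y = x

/-- `Q` lies one hop closer to the origin than `R`, and every vertex of `R` is adjacent to a
vertex of `Q`. -/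
def LiesUnder (P Q R : Set Lat) : Prop :=
  (∃ k : ℤ, HasGradient P Q k ∧ HasGradient P R (k + 1)) ∧
    ∀ x ∈ R, ∃ y ∈ Q, hexGraph.Adj x y

/-- `Q` is a parent ribbon of `R`, both being ribbons of `P`. -/
def IsParent (P Q R : Set Lat) : Prop := IsRibbon P Q ∧ IsRibbon P R ∧ LiesUnder P Q R

/-- The tree order on ribbons: `Q` is an ancestor ribbon of `R`, and `R` a descendant ribbon
of `Q`. -/
def IsAncestor (P Q R : Set Lat) : Prop := Relation.TransGen (IsParent P) Q R

/-! ### Proper ribbonizations -/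

/-- `S` is the discrete representation of a topological disk: both `S` and its complement in the
lattice are connected, so `S` has no holes. -/
def IsDisk (S : Set Lat) : Prop :=
  (hexGraph.induce S).Connected ∧ (hexGraph.induce Sᶜ).Connected

/-- The ribbonization of the shape `S` is proper. -/
structure ProperRibbonization (S : Set Lat) : Prop where
  subset_H1 : S ⊆ H1
  disjoint_hexagon : Disjoint S {O, p1, p2, p3, p4, p5, p6}
  hop_pos : ∀ x ∈ S, 0 < hop S x
  two_le_length : ∀ R, IsRibbon S R → 2 ≤ R.ncard
  root : ∃ R, (IsRibbon S R ∧ HasGradient S R 2 ∧ R.ncard = 3) ∧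
    ∀ R', IsRibbon S R' → HasGradient S R' 2 → R' = R
  /-- The midpoint of two points of `S` at distance `2d` is in `S`. -/
  smooth_two : ∀ x ∈ S, ∀ y ∈ S, sqLen (x - y) = 4 →
    ∀ z, hexGraph.Adj x z → hexGraph.Adj y z → z ∈ S
  /-- Two points of `S` at distance `√3 d` have a common neighbour in `S`. -/
  smooth_sqrt_three : ∀ x ∈ S, ∀ y ∈ S, sqLen (x - y) = 3 →
    ∃ z ∈ S, hexGraph.Adj x z ∧ hexGraph.Adj y z

/-! ### Merging points -/

/-- The root of the tree of ribbons of `S`: the seed points `p2`, `p1`, of hop count `1`. -/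
def rootRibbon : Set Lat := {p2, p1}

/-- `m` is a merging point of the ribbon `R` of `S`. The parent `Q` of `R` is a ribbon of `S`, or
the root `(p2, p1)` if `R` has gradient `2`. -/
def IsMergingPoint (S R : Set Lat) (m : Lat) : Prop :=
  m ∉ S ∧ ∃ x, IsFirstVertex S R x ∧ hexGraph.Adj m x ∧
    ∃ Q, (IsRibbon S Q ∨ Q = rootRibbon) ∧ LiesUnder S Q R ∧
      ∃ y ∈ Q, hexGraph.Adj y x ∧ hexGraph.Adj y m

/-! ### The additive stage -/

/-- Initial placement of the idle robots: each idle ribbon is empty or filled, and all idle ribbons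
below a filled one are filled. -/
structure IsIdlePlacement (I : Finset Lat) : Prop where
  subset_H2 : (I : Set Lat) ⊆ H2
  empty_or_filled : ∀ R, IsRibbon H2 R → Disjoint R I ∨ R ⊆ I
  layered : ∀ Q R, IsAncestor H2 Q R → R ⊆ I → Q ⊆ I

/-- The strict ribbon order: `x < y` iff `x` is in front of `y`. -/
def RibbonLT (P : Set Lat) (x y : Lat) : Prop := x ≠ y ∧ RibbonInFront P x y

/-- `s 1, …, s N` is an activation sequence: `s k` is the largest point (ribbon order) of the
largest idle ribbon (tree order) among the idle positions not yet listed. -/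
def IsActivationSequence (I : Finset Lat) (N : ℕ) (s : ℕ → Lat) : Prop :=
  ∀ k ∈ Set.Icc 1 N, s k ∈ I ∧ (∀ j ∈ Set.Ico 1 k, s j ≠ s k) ∧
    ∀ y ∈ I, (∀ j ∈ Set.Ico 1 k, s j ≠ y) →
      y = s k ∨ RibbonLT H2 y (s k) ∨ IsAncestor H2 (ribbonOf H2 y) (ribbonOf H2 (s k))

/-- A complete tree order: a strict total order on the ribbons of `S` extending the tree order. -/
structure IsCompleteTreeOrder (S : Set Lat) (lt : Set Lat → Set Lat → Prop) : Prop where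
  irrefl : ∀ R, IsRibbon S R → ¬ lt R R
  trans : ∀ Q R T, IsRibbon S Q → IsRibbon S R → IsRibbon S T → lt Q R → lt R T → lt Q T
  total : ∀ Q R, IsRibbon S Q → IsRibbon S R → lt Q R ∨ Q = R ∨ lt R Q
  extend : ∀ Q R, IsAncestor S Q R → lt Q R

/-- `t 1, …, t N` is an assembly sequence: `t k` is the smallest point (ribbon order) of the
smallest ribbon (complete tree order) among the points of `S` not yet listed. -/
def IsAssemblySequence (S : Set Lat) (lt : Set Lat → Set Lat → Prop) (N : ℕ)
    (t : ℕ → Lat) : Prop :=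
  ∀ k ∈ Set.Icc 1 N, t k ∈ S ∧ (∀ j ∈ Set.Ico 1 k, t j ≠ t k) ∧
    ∀ y ∈ S, (∀ j ∈ Set.Ico 1 k, t j ≠ y) →
      y = t k ∨ RibbonLT S (t k) y ∨ lt (ribbonOf S (t k)) (ribbonOf S y)

/-- The occupied lattice points after the first `n` active robots have moved from
`s 1, …, s n` to `t 1, …, t n`. -/
def occupied (I : Finset Lat) (s t : ℕ → Lat) (n : ℕ) : Set Lat :=
  seeds ∪ ((I : Set Lat) \ (s '' Set.Icc 1 n)) ∪ t '' Set.Icc 1 n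

/-! ### The edge-following path and the affiliated path -/

/-- The edge-following path: the points whose distance to the nearest robot is `d`. -/
def EFP (d : ℝ) (occ : Set Lat) : Set ℂ := {z | Metric.infDist z (pos d '' occ) = d}

/-- `z` is contributed by a robot belonging to the ribbon `R`. -/
def ContributedBy (d : ℝ) (occ R : Set Lat) (z : ℂ) : Prop :=
  ∃ c ∈ occ, c ∈ R ∧ dist z (pos d c) = d

/-- The point reached from the lattice point `q` by rotating clockwise by the angle `θ` around
the lattice point `c`. -/
noncomputable def rotPoint (d : ℝ) (c q : Lat) (θ : ℝ) : ℂ :=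
  pos d c + (pos d q - pos d c) * Complex.exp (-((θ : ℂ) * Complex.I))

/-- The affiliated path: the path segment of the edge-following path from `p6` to `p3`, oriented
clockwise. It is given by its successive arcs: the arc number `i` goes from the lattice point
`vertex i` to the lattice point `vertex (i + 1)`, clockwise through the angle `π / 3` around the
robot at `center i`, and all its points are at distance `d` from the nearest robot. No lattice
point is visited twice. -/
structure AffiliatedPath (d : ℝ) (occ : Set Lat) where
  len : ℕ
  vertex : ℕ → Lat
  center : ℕ → Lat
  vertex_zero : vertex 0 = p6
  vertex_len : vertex len = p3
  center_mem : ∀ i < len, center i ∈ occ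
  adj : ∀ i < len, hexGraph.Adj (vertex i) (center i)
  step : ∀ i < len, vertex (i + 1) = center i + cw (vertex i - center i)
  arc_subset : ∀ i < len, ∀ θ ∈ Set.Icc (0 : ℝ) (π / 3),
    rotPoint d (center i) (vertex i) θ ∈ EFP d occ
  simple : Set.InjOn vertex (Set.Iic len)

namespace AffiliatedPath

variable {d : ℝ} {occ : Set Lat}

/-- The parametrization of the affiliated path by `[0, len]`: arc number `i` corresponds to
`[i, i + 1]`. -/
noncomputable def point (A : AffiliatedPath d occ) (a : ℝ) : ℂ :=
  rotPoint d (A.center ⌊a⌋₊) (A.vertex ⌊a⌋₊) (Int.fract a * (π / 3))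

/-- `z` is a point of the affiliated path. -/
def Mem (A : AffiliatedPath d occ) (z : ℂ) : Prop :=
  ∃ a ∈ Set.Icc (0 : ℝ) A.len, A.point a = z

/-- `x` is in front of `y`: both are on the affiliated path, and travelling along the path in its
direction leads from `y` to `x` (possibly `x = y`). -/
def InFront (A : AffiliatedPath d occ) (x y : ℂ) : Prop :=
  ∃ a b : ℝ, 0 ≤ a ∧ a ≤ b ∧ b ≤ A.len ∧ A.point a = y ∧ A.point b = x

end AffiliatedPath

end RibbonFormation

namespace RibbonFormation

/-! ### Elementary lattice geometry -/

theorem adj_iff (x y : Lat) : hexGraph.Adj x y ↔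
    (y.1 = x.1 + 1 ∧ y.2 = x.2) ∨ (y.1 = x.1 ∧ y.2 = x.2 + 1) ∨
    (y.1 = x.1 - 1 ∧ y.2 = x.2 + 1) ∨ (y.1 = x.1 - 1 ∧ y.2 = x.2) ∨
    (y.1 = x.1 ∧ y.2 = x.2 - 1) ∨ (y.1 = x.1 + 1 ∧ y.2 = x.2 - 1) := by
  obtain ⟨a, b⟩ := x
  obtain ⟨c, e⟩ := y
  change sqLen ((a, b) - (c, e)) = 1 ↔ _
  simp only [sqLen, Prod.fst_sub, Prod.snd_sub]
  obtain ⟨p, rfl⟩ : ∃ p, c = a - p := ⟨a - c, by ring⟩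
  obtain ⟨q, rfl⟩ : ∃ q, e = b - q := ⟨b - e, by ring⟩
  simp only [sub_sub_cancel]
  constructor
  · intro h
    have hp1 : p ≤ 1 := by nlinarith [sq_nonneg (2 * q + p)]
    have hp2 : -1 ≤ p := by nlinarith [sq_nonneg (2 * q + p)]
    have hq1 : q ≤ 1 := by nlinarith [sq_nonneg (2 * p + q)]
    have hq2 : -1 ≤ q := by nlinarith [sq_nonneg (2 * p + q)]
    interval_cases p <;> interval_cases q <;> omega
  · intro h
    have : (p = -1 ∧ q = 0) ∨ (p = 0 ∧ q = -1) ∨ (p = 1 ∧ q = -1) ∨ (p = 1 ∧ q = 0) ∨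
        (p = 0 ∧ q = 1) ∨ (p = -1 ∧ q = 1) := by omega
    rcases this with ⟨rfl, rfl⟩ | ⟨rfl, rfl⟩ | ⟨rfl, rfl⟩ | ⟨rfl, rfl⟩ | ⟨rfl, rfl⟩ | ⟨rfl, rfl⟩ <;>
      norm_num

theorem lat_eq_iff (x y : Lat) : x = y ↔ x.1 = y.1 ∧ x.2 = y.2 := Prod.ext_iff

/-! ### Sets with connected complement -/

/-- Any two points outside `P` are joined by a lattice path outside `P`. -/
def CoConnected (P : Set Lat) : Prop :=
  ∀ b ∉ P, ∀ b' ∉ P, Relation.ReflTransGen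
    (fun x y => hexGraph.Adj x y ∧ x ∉ P ∧ y ∉ P) b b'

open Classical in
/-- Signed number of crossings of the edge from `p` to `q` with the vertical ray issuing
from `b`, slightly shifted to the right. -/
noncomputable def crossing (b p q : Lat) : ℤ :=
  (if p.1 = b.1 ∧ b.2 < p.2 ∧ q.1 = b.1 + 1 then 1 else 0)
    - (if q.1 = b.1 ∧ b.2 < q.2 ∧ p.1 = b.1 + 1 then 1 else 0)

open Classical in
theorem crossing_sub_right {b p q : Lat} (hpq : hexGraph.Adj p q) (h1 : p ≠ (b.1 + 1, b.2))
    (h2 : q ≠ (b.1 + 1, b.2)) :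
    crossing (b.1 + 1, b.2) p q - crossing b p q =
      (if p.1 = b.1 + 1 ∧ b.2 < p.2 then 1 else 0) -
        (if q.1 = b.1 + 1 ∧ b.2 < q.2 then 1 else 0) := by
  rw [adj_iff] at hpq
  simp only [ne_eq, lat_eq_iff] at h1 h2
  unfold crossing
  split_ifs <;> omega

open Classical in
theorem crossing_sub_up {b p q : Lat} (h1 : p ≠ (b.1, b.2 + 1)) (h2 : q ≠ (b.1, b.2 + 1)) :
    crossing (b.1, b.2 + 1) p q = crossing b p q := by
  simp only [ne_eq, lat_eq_iff] at h1 h2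
  unfold crossing
  split_ifs <;> omega

open Classical in
theorem crossing_sub_diag {b p q : Lat} (hpq : hexGraph.Adj p q) (hp : p ≠ b) (hq : q ≠ b)
    (h1 : p ≠ (b.1 + 1, b.2 - 1)) (h2 : q ≠ (b.1 + 1, b.2 - 1)) :
    crossing (b.1 + 1, b.2 - 1) p q - crossing b p q =
      (if p.1 = b.1 + 1 ∧ b.2 - 1 < p.2 then 1 else 0) -
        (if q.1 = b.1 + 1 ∧ b.2 - 1 < q.2 then 1 else 0) := by
  rw [adj_iff] at hpq
  simp only [ne_eq, lat_eq_iff] at hp hq h1 h2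
  unfold crossing
  split_ifs <;> omega

/-- The crossing cochain of `b` is exact on `P`. -/
def CrossingExact (P : Set Lat) (b : Lat) : Prop :=
  ∃ F : Lat → ℤ, ∀ p ∈ P, ∀ q ∈ P, hexGraph.Adj p q → F q - F p = crossing b p q

open Classical in
theorem crossingExact_congr {P : Set Lat} {b b' : Lat} (G : Lat → ℤ)
    (hG : ∀ p ∈ P, ∀ q ∈ P, hexGraph.Adj p q → crossing b' p q - crossing b p q = G p - G q) :
    CrossingExact P b ↔ CrossingExact P b' := by
  constructor
  · rintro ⟨F, hF⟩
    refine ⟨fun x => F x - G x, fun p hp q hq h => ?_⟩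
    have := hF p hp q hq h
    have := hG p hp q hq h
    dsimp only; omega
  · rintro ⟨F, hF⟩
    refine ⟨fun x => F x + G x, fun p hp q hq h => ?_⟩
    have := hF p hp q hq h
    have := hG p hp q hq h
    dsimp only; omega

open Classical in
theorem crossingExact_adj {P : Set Lat} {b b' : Lat} (h : hexGraph.Adj b b') (hb : b ∉ P)
    (hb' : b' ∉ P) : CrossingExact P b ↔ CrossingExact P b' := by
  have ne : ∀ {p c : Lat}, p ∈ P → c ∉ P → p ≠ c := fun hp hc e => hc (e ▸ hp)
  have right : ∀ {b : Lat}, (b.1 + 1, b.2) ∉ P →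
      (CrossingExact P b ↔ CrossingExact P (b.1 + 1, b.2)) := fun hb' =>
    crossingExact_congr _ fun p hp q hq h => crossing_sub_right h (ne hp hb') (ne hq hb')
  have up : ∀ {b : Lat}, (b.1, b.2 + 1) ∉ P →
      (CrossingExact P b ↔ CrossingExact P (b.1, b.2 + 1)) := fun hb' =>
    crossingExact_congr (fun _ => 0) fun p hp q hq h => by
      rw [crossing_sub_up (ne hp hb') (ne hq hb')]; ring
  have diag : ∀ {b : Lat}, b ∉ P → (b.1 + 1, b.2 - 1) ∉ P →
      (CrossingExact P b ↔ CrossingExact P (b.1 + 1, b.2 - 1)) := fun hb hb' =>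
    crossingExact_congr _ fun p hp q hq h =>
      crossing_sub_diag h (ne hp hb) (ne hq hb) (ne hp hb') (ne hq hb')
  obtain ⟨i, j⟩ := b
  obtain ⟨i', j'⟩ := b'
  rw [adj_iff] at h
  dsimp only at h
  rcases h with ⟨rfl, rfl⟩ | ⟨rfl, rfl⟩ | ⟨rfl, rfl⟩ | ⟨rfl, rfl⟩ | ⟨rfl, rfl⟩ | ⟨rfl, rfl⟩
  · exact right hb'
  · exact up hb'
  · have := diag (b := (i - 1, j + 1)) hb' (by simpa using hb)
    simpa using this.symm
  · have := right (b := (i - 1, j')) (by simpa using hb)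
    simpa using this.symm
  · have := up (b := (i', j - 1)) (by simpa using hb)
    simpa using this.symm
  · exact diag hb hb'

theorem CoConnected.crossingExact {P : Finset Lat} (hP : CoConnected (P : Set Lat)) {b : Lat}
    (hb : b ∉ P) : CrossingExact P b := by
  obtain ⟨N, hN⟩ : ∃ N : ℤ, ∀ p ∈ P, p.1 < N := by
    obtain ⟨N, hN⟩ := (P.image Prod.fst).bddAbove
    refine ⟨N + 1, fun p hp => ?_⟩
    have := hN (Finset.mem_coe.2 (Finset.mem_image_of_mem Prod.fst hp))
    omega
  have hfar : ((N, 0) : Lat) ∉ (P : Set Lat) := fun h => by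
    simpa using hN _ (Finset.mem_coe.1 h)
  have far : CrossingExact P (N, 0) := by
    refine ⟨fun _ => 0, fun p hp q hq _ => ?_⟩
    have h1 := hN p hp
    have h2 := hN q hq
    unfold crossing
    rw [if_neg (by dsimp only; omega), if_neg (by dsimp only; omega)]
  have key : ∀ c, Relation.ReflTransGen
      (fun x y => hexGraph.Adj x y ∧ x ∉ (P : Set Lat) ∧ y ∉ (P : Set Lat)) (N, 0) c →
      CrossingExact P c := by
    intro c hc
    induction hc with
    | refl => exact far
    | tail _ h ih => exact (crossingExact_adj h.1 h.2.1 h.2.2).1 ih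
  exact key b (hP _ hfar _ hb)

/-- If the topmost point `v` of `P` has lower neighbours to the left and to the right but not in
between, then these two are separated in `P` by `v`. -/
theorem exists_separating {P : Finset Lat} (hP : CoConnected (P : Set Lat)) {v : Lat}
    (hv : v ∈ P) (hmax : ∀ x ∈ P, x.1 + 2 * x.2 ≤ v.1 + 2 * v.2)
    (hb : (v.1, v.2 - 1) ∉ P) (ha : (v.1 - 1, v.2) ∈ P) (hc : (v.1 + 1, v.2 - 1) ∈ P) :
    ∃ F : Lat → ℤ, (∀ p ∈ P.erase v, ∀ q ∈ P.erase v, hexGraph.Adj p q → F q = F p) ∧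
      F (v.1 - 1, v.2) ≠ F (v.1 + 1, v.2 - 1) := by
  obtain ⟨F, hF⟩ := hP.crossingExact hb
  refine ⟨F, fun p hp q hq hpq => ?_, ?_⟩
  · rw [Finset.mem_erase] at hp hq
    have h := hF p hp.2 q hq.2 hpq
    have h1 := hmax p hp.2
    have h2 := hmax q hq.2
    have h3 := hp.1
    have h4 := hq.1
    simp only [ne_eq, lat_eq_iff] at h3 h4
    unfold crossing at h
    rw [if_neg (by dsimp only; omega), if_neg (by dsimp only; omega)] at h
    omega
  · have h1 := hF _ ha v hv (by rw [adj_iff]; dsimp only; omega)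
    have h2 := hF v hv _ hc (by rw [adj_iff]; dsimp only; omega)
    unfold crossing at h1 h2
    rw [if_neg (by dsimp only; omega), if_neg (by dsimp only; omega)] at h1
    rw [if_pos (by dsimp only; omega), if_neg (by dsimp only; omega)] at h2
    omega

/-! ### Level functions -/

/-- `h` measures the distance from `o` in the component `K` of `o` in `P`; the points one level
below a given point are pairwise adjacent, and adjacent points of equal level have a common
neighbour one level below. -/
structure LevelFn (P : Set Lat) (o : Lat) (K : Set Lat) (h : Lat → ℕ) : Prop where
  base : o ∈ K
  sub : K ⊆ P
  closed : ∀ x ∈ K, ∀ y ∈ P, hexGraph.Adj x y → y ∈ K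
  zero : h o = 0
  low : ∀ x ∈ K, x ≠ o → ∃ y ∈ K, hexGraph.Adj x y ∧ h y + 1 = h x
  lip : ∀ x ∈ K, ∀ y ∈ K, hexGraph.Adj x y → h y ≤ h x + 1
  clique : ∀ x ∈ K, ∀ y ∈ K, ∀ z ∈ K, hexGraph.Adj x y → hexGraph.Adj x z →
    h y + 1 = h x → h z + 1 = h x → y = z ∨ hexGraph.Adj y z
  tri : ∀ x ∈ K, ∀ y ∈ K, hexGraph.Adj x y → h x = h y →
    ∃ z ∈ K, hexGraph.Adj x z ∧ hexGraph.Adj y z ∧ h z + 1 = h x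

namespace LevelFn

variable {P K : Set Lat} {o : Lat} {h : Lat → ℕ}

theorem const (H : LevelFn P o K h) {F : Lat → ℤ}
    (hF : ∀ p ∈ P, ∀ q ∈ P, hexGraph.Adj p q → F q = F p) : ∀ x ∈ K, F x = F o := by
  intro x hx
  induction hn : h x using Nat.strong_induction_on generalizing x with
  | _ n ih =>
    by_cases hxo : x = o
    · rw [hxo]
    · obtain ⟨y, hy, hxy, hlt⟩ := H.low x hx hxo
      rw [← ih (h y) (by omega) y hy rfl]
      exact hF y (H.sub hy) x (H.sub hx) hxy.symm

theorem neg_adj {x y : Lat} : hexGraph.Adj (-x) (-y) ↔ hexGraph.Adj x y := by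
  rw [adj_iff, adj_iff]
  simp only [Prod.fst_neg, Prod.snd_neg]
  omega

theorem neg (H : LevelFn P o K h) :
    LevelFn {x | -x ∈ P} (-o) {x | -x ∈ K} (fun x => h (-x)) where
  base := by simpa using H.base
  sub := fun x hx => H.sub hx
  closed := fun x hx y hy hxy => H.closed _ hx _ hy (neg_adj.2 hxy)
  zero := by simpa using H.zero
  low := fun x hx hxo => by
    obtain ⟨y, hy, h1, h2⟩ := H.low _ hx (fun e => hxo (by rw [← e, neg_neg]))
    refine ⟨-y, by simpa using hy, ?_, by simpa using h2⟩
    rw [← neg_adj, neg_neg]; exact h1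
  lip := fun x hx y hy hxy => H.lip _ hx _ hy (neg_adj.2 hxy)
  clique := fun x hx y hy z hz hxy hxz h1 h2 => by
    have := H.clique _ hx _ hy _ hz (neg_adj.2 hxy) (neg_adj.2 hxz) h1 h2
    rwa [neg_inj, neg_adj] at this
  tri := fun x hx y hy hxy h1 => by
    obtain ⟨z, hz, h2, h3, h4⟩ := H.tri _ hx _ hy (neg_adj.2 hxy) h1
    refine ⟨-z, by simpa using hz, ?_, ?_, by simpa using h4⟩
    · rw [← neg_adj, neg_neg]; exact h2
    · rw [← neg_adj, neg_neg]; exact h3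

/-- A point without neighbours in the component may be added. -/
theorem add_isolated {v : Lat} (H : LevelFn (P \ {v}) o K h)
    (hv : ∀ x ∈ K, ¬ hexGraph.Adj x v) : LevelFn P o K h where
  base := H.base
  sub := fun x hx => (H.sub hx).1
  closed := fun x hx y hy hxy => by
    by_cases hyv : y = v
    · exact absurd (hyv ▸ hxy) (hv x hx)
    · exact H.closed x hx y ⟨hy, hyv⟩ hxy
  zero := H.zero
  low := H.low
  lip := H.lip
  clique := H.clique
  tri := H.tri

open Classical in
/-- Gluing two components at a cut vertex. -/
theorem glue {K₂ : Set Lat} {h₂ : Lat → ℕ} {v e f : Lat} (H : LevelFn (P \ {v}) o K h)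
    (H₂ : LevelFn (P \ {v}) f K₂ h₂) (hv : v ∈ P) (he : e ∈ K) (hev : hexGraph.Adj v e)
    (hfv : hexGraph.Adj v f) (hdisj : ∀ x ∈ K, x ∉ K₂)
    (hn : ∀ x ∈ P, hexGraph.Adj v x → x = e ∨ x = f) :
    ∃ K' h', LevelFn P o K' h' := by
  have hvK : v ∉ K := fun hx => (H.sub hx).2 rfl
  have hvK₂ : v ∉ K₂ := fun hx => (H₂.sub hx).2 rfl
  have hdisj' : ∀ x ∈ K₂, x ∉ K := fun x h2 h1 => hdisj x h1 h2
  have hfK : f ∉ K := hdisj' f H₂.base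
  have sep : ∀ x ∈ K, ∀ y ∈ K₂, ¬ hexGraph.Adj x y := fun x hx y hy hxy =>
    hdisj y (H.closed x hx y (H₂.sub hy) hxy) hy
  obtain ⟨h', h'1, h'v, h'2⟩ : ∃ h' : Lat → ℕ, (∀ x ∈ K, h' x = h x) ∧ h' v = h e + 1 ∧
      ∀ x ∈ K₂, h' x = h e + 2 + h₂ x := by
    refine ⟨fun x => if x ∈ K then h x else if x = v then h e + 1 else h e + 2 + h₂ x, ?_, ?_, ?_⟩
    · intro x hx; simp [hx]
    · simp [hvK]
    · intro x hx
      have : x ≠ v := fun e => hvK₂ (e ▸ hx)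
      simp [hdisj' x hx, this]
  have hf0 := H₂.zero
  have nbK : ∀ x ∈ K, hexGraph.Adj v x → x = e := fun x hx hvx =>
    (hn x (H.sub hx).1 hvx).resolve_right fun e => hfK (e ▸ hx)
  have nbK₂ : ∀ x ∈ K₂, hexGraph.Adj v x → x = f := fun x hx hvx =>
    (hn x (H₂.sub hx).1 hvx).resolve_left fun e' => hdisj' x hx (e' ▸ he)
  refine ⟨{x | x ∈ K ∨ x = v ∨ x ∈ K₂}, h', ?_, ?_, ?_, ?_, ?_, ?_, ?_, ?_⟩
  · exact Or.inl H.base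
  · rintro x (hx | rfl | hx)
    exacts [(H.sub hx).1, hv, (H₂.sub hx).1]
  · rintro x (hx | rfl | hx) y hy hxy
    · by_cases hyv : y = v
      · exact Or.inr (Or.inl hyv)
      · exact Or.inl (H.closed x hx y ⟨hy, hyv⟩ hxy)
    · rcases hn y hy hxy with rfl | rfl
      · exact Or.inl he
      · exact Or.inr (Or.inr H₂.base)
    · by_cases hyv : y = v
      · exact Or.inr (Or.inl hyv)
      · exact Or.inr (Or.inr (H₂.closed x hx y ⟨hy, hyv⟩ hxy))
  · rw [h'1 o H.base, H.zero]
  · rintro x (hx | rfl | hx) hxo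
    · obtain ⟨y, hy, h1, h2⟩ := H.low x hx hxo
      exact ⟨y, Or.inl hy, h1, by rw [h'1 x hx, h'1 y hy, h2]⟩
    · exact ⟨e, Or.inl he, hev, by rw [h'1 e he, h'v]⟩
    · by_cases hxf : x = f
      · subst hxf
        exact ⟨v, Or.inr (Or.inl rfl), hfv.symm, by rw [h'v, h'2 x hx]; omega⟩
      · obtain ⟨y, hy, h1, h2⟩ := H₂.low x hx hxf
        exact ⟨y, Or.inr (Or.inr hy), h1, by rw [h'2 x hx, h'2 y hy]; omega⟩
  · rintro x (hx | rfl | hx) y (hy | rfl | hy) hxy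
    · rw [h'1 x hx, h'1 y hy]; exact H.lip x hx y hy hxy
    · rw [h'1 x hx, h'v, nbK x hx hxy.symm]
    · exact absurd hxy (sep x hx y hy)
    · rw [h'1 y hy, h'v, nbK y hy hxy]; omega
    · exact absurd hxy (hexGraph.loopless.irrefl _)
    · rw [h'2 y hy, h'v, nbK₂ y hy hxy]; omega
    · exact absurd hxy.symm (sep y hy x hx)
    · rw [h'2 x hx, h'v]; omega
    · have := H₂.lip x hx y hy hxy
      rw [h'2 x hx, h'2 y hy]; omega
  · have lowK : ∀ x ∈ K, ∀ y, (y ∈ K ∨ y = v ∨ y ∈ K₂) → hexGraph.Adj x y →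
        h' y + 1 = h' x → y ∈ K ∧ h y + 1 = h x := by
      rintro x hx y (hy | rfl | hy) hxy h1
      · rw [h'1 x hx, h'1 y hy] at h1; exact ⟨hy, h1⟩
      · rw [h'v, h'1 x hx, nbK x hx hxy.symm] at h1; omega
      · exact absurd hxy (sep x hx y hy)
    have lowv : ∀ y, (y ∈ K ∨ y = v ∨ y ∈ K₂) → hexGraph.Adj v y → h' y + 1 = h' v → y = e := by
      rintro y (hy | rfl | hy) hxy h1
      · exact nbK y hy hxy
      · omega
      · rw [h'v, h'2 y hy] at h1; omega
    have lowK₂ : ∀ x ∈ K₂, ∀ y, (y ∈ K ∨ y = v ∨ y ∈ K₂) → hexGraph.Adj x y →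
        h' y + 1 = h' x → (y ∈ K₂ ∧ h₂ y + 1 = h₂ x) ∨ (y = v ∧ x = f) := by
      rintro x hx y (hy | rfl | hy) hxy h1
      · exact absurd hxy.symm (sep y hy x hx)
      · exact Or.inr ⟨rfl, nbK₂ x hx hxy.symm⟩
      · rw [h'2 x hx, h'2 y hy] at h1; exact Or.inl ⟨hy, by omega⟩
    rintro x (hx | rfl | hx) y hy z hz hxy hxz h1 h2
    · obtain ⟨hy', h1'⟩ := lowK x hx y hy hxy h1
      obtain ⟨hz', h2'⟩ := lowK x hx z hz hxz h2
      exact H.clique x hx y hy' z hz' hxy hxz h1' h2'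
    · exact Or.inl ((lowv y hy hxy h1).trans (lowv z hz hxz h2).symm)
    · rcases lowK₂ x hx y hy hxy h1 with ⟨hy', h1'⟩ | ⟨rfl, hxf⟩ <;>
        rcases lowK₂ x hx z hz hxz h2 with ⟨hz', h2'⟩ | ⟨rfl, hxf'⟩
      · exact H₂.clique x hx y hy' z hz' hxy hxz h1' h2'
      · rw [hxf', hf0] at h1'; omega
      · rw [hxf, hf0] at h2'; omega
      · exact Or.inl rfl
  · rintro x (hx | rfl | hx) y (hy | rfl | hy) hxy h1
    · rw [h'1 x hx, h'1 y hy] at h1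
      obtain ⟨z, hz, h2, h3, h4⟩ := H.tri x hx y hy hxy h1
      exact ⟨z, Or.inl hz, h2, h3, by rw [h'1 x hx, h'1 z hz, h4]⟩
    · rw [h'1 x hx, h'v, nbK x hx hxy.symm] at h1; omega
    · exact absurd hxy (sep x hx y hy)
    · rw [h'1 y hy, h'v, nbK y hy hxy] at h1; omega
    · exact absurd hxy (hexGraph.loopless.irrefl _)
    · rw [h'2 y hy, h'v] at h1; omega
    · exact absurd hxy.symm (sep y hy x hx)
    · rw [h'2 x hx, h'v] at h1; omega
    · rw [h'2 x hx, h'2 y hy] at h1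
      obtain ⟨z, hz, h2, h3, h4⟩ := H₂.tri x hx y hy hxy (by omega)
      exact ⟨z, Or.inr (Or.inr hz), h2, h3, by rw [h'2 x hx, h'2 z hz]; omega⟩

/-- Adding a point `v` whose neighbours in the component are consecutive and among the left,
lower left and lower right ones. -/
theorem attach {v n : Lat} (H : LevelFn (P \ {v}) o K h) (hv : v ∈ P)
    (hnb : ∀ x ∈ P, hexGraph.Adj v x →
      x = (v.1 - 1, v.2) ∨ x = (v.1, v.2 - 1) ∨ x = (v.1 + 1, v.2 - 1))
    (hK : ∀ x ∈ P, hexGraph.Adj v x → x ∈ K)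
    (hmid : (v.1 - 1, v.2) ∈ K → (v.1 + 1, v.2 - 1) ∈ K → (v.1, v.2 - 1) ∈ K)
    (hn : n ∈ K) (hvn : hexGraph.Adj v n) (hmin : ∀ x ∈ K, hexGraph.Adj v x → h n ≤ h x) :
    ∃ K' h', LevelFn P o K' h' := by
  classical
  have hvK : v ∉ K := fun hx => (H.sub hx).2 rfl
  have hneK : ∀ x ∈ K, x ≠ v := fun x hx e => hvK (e ▸ hx)
  obtain ⟨i, j⟩ := v
  dsimp only at hnb hmid
  set a : Lat := (i - 1, j) with ha
  set b : Lat := (i, j - 1) with hb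
  set c : Lat := (i + 1, j - 1) with hc
  have hnbK : ∀ x ∈ K, hexGraph.Adj (i, j) x → x = a ∨ x = b ∨ x = c := fun x hx =>
    hnb x (H.sub hx).1
  have vb : hexGraph.Adj (i, j) b := by rw [adj_iff]; simp [hb]
  have va : hexGraph.Adj (i, j) a := by rw [adj_iff]; simp [ha]
  have vc : hexGraph.Adj (i, j) c := by rw [adj_iff]; simp [hc]
  have ab : hexGraph.Adj a b := by rw [adj_iff]; simp [ha, hb]
  have bc : hexGraph.Adj b c := by rw [adj_iff]; simp [hc, hb]
  set r : Lat := (i - 1, j - 1) with hr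
  set w : Lat := (i, j - 2) with hw
  set q : Lat := (i + 1, j - 2) with hq
  have G1 : ∀ z ∈ K, hexGraph.Adj a z → hexGraph.Adj b z → z = r := by
    intro z hz h1 h2
    have h3 := hneK z hz
    rw [adj_iff] at h1 h2
    simp only [lat_eq_iff, ne_eq, ha, hb, hr] at *
    omega
  have G2 : ∀ z ∈ K, hexGraph.Adj c z → hexGraph.Adj b z → z = q := by
    intro z hz h1 h2
    have h3 := hneK z hz
    rw [adj_iff] at h1 h2
    simp only [lat_eq_iff, ne_eq, hc, hb, hq] at *
    omega
  have G3 : ∀ z, hexGraph.Adj b z → hexGraph.Adj r z → z = a ∨ z = w := by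
    intro z h1 h2
    rw [adj_iff] at h1 h2
    simp only [lat_eq_iff, ne_eq, ha, hb, hr, hw] at *
    omega
  have G4 : ∀ z, hexGraph.Adj b z → hexGraph.Adj q z → z = c ∨ z = w := by
    intro z h1 h2
    rw [adj_iff] at h1 h2
    simp only [lat_eq_iff, ne_eq, hc, hb, hq, hw] at *
    omega
  have far : ∀ {x y : Lat}, hexGraph.Adj b x → hexGraph.Adj b y → x ∈ K → y ∈ K → b ∈ K →
      h x + 1 = h b → h y + 1 = h b → ¬ (x = y ∨ hexGraph.Adj x y) → False :=
    fun h1 h2 hx hy hb h3 h4 h5 => h5 (H.clique _ hb _ hx _ hy h1 h2 h3 h4)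
  have bq : hexGraph.Adj b q := by rw [adj_iff]; simp [hb, hq]; omega
  have br : hexGraph.Adj b r := by rw [adj_iff]; simp [hb, hr]
  have bw : hexGraph.Adj b w := by rw [adj_iff]; simp [hb, hw]; omega
  have nac : ¬ (a = c ∨ hexGraph.Adj a c) := by
    rw [adj_iff, lat_eq_iff]; simp only [ha, hc]; omega
  have nrq : ¬ (r = q ∨ hexGraph.Adj r q) := by
    rw [adj_iff, lat_eq_iff]; simp only [hr, hq]; omega
  have nrc : ¬ (r = c ∨ hexGraph.Adj r c) := by
    rw [adj_iff, lat_eq_iff]; simp only [hr, hc]; omega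
  have naq : ¬ (a = q ∨ hexGraph.Adj a q) := by
    rw [adj_iff, lat_eq_iff]; simp only [ha, hq]; omega
  have nwc : ¬ (w = c ∨ hexGraph.Adj w c) := by
    rw [adj_iff, lat_eq_iff]; simp only [hw, hc]; omega
  have naw : ¬ (a = w ∨ hexGraph.Adj a w) := by
    rw [adj_iff, lat_eq_iff]; simp only [ha, hw]; omega
  have triA : a ∈ K → b ∈ K → h a = h b → r ∈ K ∧ h r + 1 = h b := by
    intro hA hB h1
    obtain ⟨z, hz, h2, h3, h4⟩ := H.tri a hA b hB ab h1
    rw [← G1 z hz h2 h3]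
    exact ⟨hz, by omega⟩
  have triC : c ∈ K → b ∈ K → h c = h b → q ∈ K ∧ h q + 1 = h b := by
    intro hC hB h1
    obtain ⟨z, hz, h2, h3, h4⟩ := H.tri c hC b hB bc.symm h1
    rw [← G2 z hz h2 h3]
    exact ⟨hz, by omega⟩
  have Y1 : a ∈ K → b ∈ K → c ∈ K → h a = h b → h c + 1 = h b → False := by
    intro hA hB hC h1 h2
    obtain ⟨h3, h4⟩ := triA hA hB h1
    exact far br bc h3 hC hB h4 h2 nrc
  have Y2 : a ∈ K → b ∈ K → c ∈ K → h c = h b → h a + 1 = h b → False := by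
    intro hA hB hC h1 h2
    obtain ⟨h3, h4⟩ := triC hC hB h1
    exact far ab.symm bq hA h3 hB h2 h4 naq
  have Y3 : a ∈ K → b ∈ K → c ∈ K → h a = h b → h c = h b → False := by
    intro hA hB hC h1 h2
    obtain ⟨h3, h4⟩ := triA hA hB h1
    obtain ⟨h5, h6⟩ := triC hC hB h2
    exact far br bq h3 h5 hB h4 h6 nrq
  have Y4 : b ∈ K → c ∈ K → r ∈ K → h a ≠ h c → h c + 1 = h b → h r = h b → False := by
    intro hB hC hR h0 h1 h2
    obtain ⟨z, hz, h3, h4, h5⟩ := H.tri b hB r hR br h2.symm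
    rcases G3 z h3 h4 with rfl | rfl
    · omega
    · exact far bw bc hz hC hB h5 h1 nwc
  have Y5 : b ∈ K → a ∈ K → q ∈ K → h a ≠ h c → h a + 1 = h b → h q = h b → False := by
    intro hB hA hQ h0 h1 h2
    obtain ⟨z, hz, h3, h4, h5⟩ := H.tri b hB q hQ bq h2.symm
    rcases G4 z h3 h4 with rfl | rfl
    · omega
    · exact far ab.symm bw hA hz hB h1 h5 naw
  have Y0 : a ∈ K → b ∈ K → c ∈ K → h a + 1 = h b → h c + 1 = h b → False :=
    fun hA hB hC h1 h2 => far ab.symm bc hA hC hB h1 h2 nac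
  obtain ⟨h', h'1, h'v⟩ : ∃ h' : Lat → ℕ, (∀ x ∈ K, h' x = h x) ∧ h' (i, j) = h n + 1 :=
    ⟨fun x => if x = (i, j) then h n + 1 else h x, fun x hx => if_neg (hneK x hx), if_pos rfl⟩
  have lipab : a ∈ K → b ∈ K → h a ≤ h b + 1 ∧ h b ≤ h a + 1 := fun hA hB =>
    ⟨H.lip b hB a hA ab.symm, H.lip a hA b hB ab⟩
  have lipbc : c ∈ K → b ∈ K → h c ≤ h b + 1 ∧ h b ≤ h c + 1 := fun hC hB =>
    ⟨H.lip b hB c hC bc, H.lip c hC b hB bc.symm⟩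
  have hminA : a ∈ K → h n ≤ h a := fun h => hmin a h va
  have hminB : b ∈ K → h n ≤ h b := fun h => hmin b h vb
  have hminC : c ∈ K → h n ≤ h c := fun h => hmin c h vc
  have nabc : n = a ∨ n = b ∨ n = c := hnbK n hn hvn
  -- a neighbour of `v` above `v` is an end of the chain, the other end being lowest
  have up2 : ∀ x ∈ K, hexGraph.Adj (i, j) x → h x ≤ h n + 2 ∧ (h n + 2 ≤ h x →
      b ∈ K ∧ h b = h n + 1 ∧ ((x = a ∧ n = c) ∨ (x = c ∧ n = a))) := by
    intro x hx hvx
    rcases hnbK x hx hvx with rfl | rfl | rfl <;> rcases nabc with rfl | rfl | rfl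
    · exact ⟨by omega, fun h => by omega⟩
    · have := lipab hx hn
      exact ⟨by omega, fun h => by omega⟩
    · have hB := hmid hx hn
      have h1 := lipab hx hB
      have h2 := lipbc hn hB
      exact ⟨by omega, fun h => ⟨hB, by omega, Or.inl ⟨rfl, rfl⟩⟩⟩
    · have := lipab hn hx
      exact ⟨by omega, fun h => by omega⟩
    · exact ⟨by omega, fun h => by omega⟩
    · have := lipbc hn hx
      exact ⟨by omega, fun h => by omega⟩
    · have hB := hmid hn hx
      have h1 := lipab hn hB
      have h2 := lipbc hx hB
      exact ⟨by omega, fun h => ⟨hB, by omega, Or.inr ⟨rfl, rfl⟩⟩⟩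
    · have := lipbc hx hn
      exact ⟨by omega, fun h => by omega⟩
    · exact ⟨by omega, fun h => by omega⟩
  -- cliques below an old point one of whose lower neighbours is `v`
  have clique' : ∀ x ∈ K, ∀ z ∈ K, hexGraph.Adj (i, j) x → hexGraph.Adj x z →
      h n + 1 + 1 = h x → h z + 1 = h x → hexGraph.Adj (i, j) z := by
    intro x hx z hz hvx hxz h1 h2
    obtain ⟨hB, h3, ⟨rfl, rfl⟩ | ⟨rfl, rfl⟩⟩ := (up2 x hx hvx).2 (by omega)
    · rcases H.clique _ hx b hB z hz ab hxz (by omega) h2 with rfl | h4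
      · exact vb
      · obtain rfl := G1 z hz hxz h4
        exact (Y4 hB hn hz (by omega) (by omega) (by omega)).elim
    · rcases H.clique _ hx b hB z hz bc.symm hxz (by omega) h2 with rfl | h4
      · exact vb
      · obtain rfl := G2 z hz hxz h4
        exact (Y5 hB hn hz (by omega) (by omega) (by omega)).elim
  -- cliques below `v`
  have cliquev : ∀ y ∈ K, ∀ z ∈ K, hexGraph.Adj (i, j) y → hexGraph.Adj (i, j) z →
      h y = h n → h z = h n → y = z ∨ hexGraph.Adj y z := by
    have key : a ∈ K → c ∈ K → h a = h n → h c = h n → False := by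
      intro hA hC h1 h2
      have hB := hmid hA hC
      have h3 := lipab hA hB
      have h4 := hminB hB
      rcases (by omega : h b = h n ∨ h b = h n + 1) with h5 | h5
      · exact Y3 hA hB hC (by omega) (by omega)
      · exact Y0 hA hB hC (by omega) (by omega)
    intro y hy z hz hvy hvz h1 h2
    rcases hnbK y hy hvy with rfl | rfl | rfl <;> rcases hnbK z hz hvz with rfl | rfl | rfl
    exacts [Or.inl rfl, Or.inr ab, (key hy hz h1 h2).elim, Or.inr ab.symm, Or.inl rfl, Or.inr bc,
      (key hz hy h2 h1).elim, Or.inr bc.symm, Or.inl rfl]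
  have triv : ∀ x ∈ K, hexGraph.Adj (i, j) x → h x = h n + 1 →
      ∃ z ∈ K, hexGraph.Adj (i, j) z ∧ hexGraph.Adj x z ∧ h z = h n := by
    intro x hx hvx h1
    rcases hnbK x hx hvx with rfl | rfl | rfl <;> rcases nabc with rfl | rfl | rfl
    · omega
    · exact ⟨b, hn, vb, ab, rfl⟩
    · have hB := hmid hx hn
      have h3 := lipbc hn hB
      have h4 := hminB hB
      rcases (by omega : h b = h c ∨ h b = h c + 1) with h5 | h5
      · exact ⟨b, hB, vb, ab, h5⟩
      · exact (Y1 hx hB hn (by omega) (by omega)).elim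
    · exact ⟨a, hn, va, ab.symm, rfl⟩
    · omega
    · exact ⟨c, hn, vc, bc, rfl⟩
    · have hB := hmid hn hx
      have h3 := lipab hn hB
      have h4 := hminB hB
      rcases (by omega : h b = h a ∨ h b = h a + 1) with h5 | h5
      · exact ⟨b, hB, vb, bc.symm, h5⟩
      · exact (Y2 hn hB hx (by omega) (by omega)).elim
    · exact ⟨b, hn, vb, bc.symm, rfl⟩
    · omega
  refine ⟨{x | x ∈ K ∨ x = (i, j)}, h', Or.inl H.base, ?_, ?_, ?_, ?_, ?_, ?_, ?_⟩
  · rintro x (hx | rfl)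
    exacts [(H.sub hx).1, hv]
  · rintro x (hx | rfl) y hy hxy
    · by_cases hyv : y = (i, j)
      · exact Or.inr hyv
      · exact Or.inl (H.closed x hx y ⟨hy, hyv⟩ hxy)
    · exact Or.inl (hK y hy hxy)
  · rw [h'1 o H.base, H.zero]
  · rintro x (hx | rfl) hxo
    · obtain ⟨y, hy, h1, h2⟩ := H.low x hx hxo
      exact ⟨y, Or.inl hy, h1, by rw [h'1 x hx, h'1 y hy, h2]⟩
    · exact ⟨n, Or.inl hn, hvn, by rw [h'1 n hn, h'v]⟩
  · rintro x (hx | rfl) y (hy | rfl) hxy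
    · rw [h'1 x hx, h'1 y hy]; exact H.lip x hx y hy hxy
    · rw [h'1 x hx, h'v]
      have := hmin x hx hxy.symm
      omega
    · rw [h'1 y hy, h'v]
      have := (up2 y hy hxy).1
      omega
    · exact absurd hxy (hexGraph.loopless.irrefl _)
  · rintro x (hx | rfl) y (hy | rfl) z (hz | rfl) hxy hxz h1 h2
    · rw [h'1 x hx, h'1 y hy] at h1
      rw [h'1 x hx, h'1 z hz] at h2
      exact H.clique x hx y hy z hz hxy hxz h1 h2
    · rw [h'1 x hx, h'1 y hy] at h1
      rw [h'1 x hx, h'v] at h2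
      exact Or.inr (clique' x hx y hy hxz.symm hxy h2 h1).symm
    · rw [h'1 x hx, h'v] at h1
      rw [h'1 x hx, h'1 z hz] at h2
      exact Or.inr (clique' x hx z hz hxy.symm hxz h1 h2)
    · exact Or.inl rfl
    · rw [h'v, h'1 y hy] at h1
      rw [h'v, h'1 z hz] at h2
      exact cliquev y hy z hz hxy hxz (by omega) (by omega)
    · omega
    · omega
    · exact Or.inl rfl
  · rintro x (hx | rfl) y (hy | rfl) hxy h1
    · rw [h'1 x hx, h'1 y hy] at h1
      obtain ⟨z, hz, h2, h3, h4⟩ := H.tri x hx y hy hxy h1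
      exact ⟨z, Or.inl hz, h2, h3, by rw [h'1 x hx, h'1 z hz, h4]⟩
    · rw [h'1 x hx, h'v] at h1
      obtain ⟨z, hz, h2, h3, h4⟩ := triv x hx hxy.symm h1
      exact ⟨z, Or.inl hz, h3, h2, by rw [h'1 x hx, h'1 z hz]; omega⟩
    · rw [h'1 y hy, h'v] at h1
      obtain ⟨z, hz, h2, h3, h4⟩ := triv y hy hxy h1.symm
      exact ⟨z, Or.inl hz, h2, h3, by rw [h'v, h'1 z hz]; omega⟩
    · exact absurd hxy (hexGraph.loopless.irrefl _)

end LevelFn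

/-! ### Existence of level functions -/

theorem CoConnected.erase {P : Finset Lat} (hP : CoConnected (P : Set Lat)) {v u : Lat}
    (hu : u ∉ P) (huv : hexGraph.Adj v u) : CoConnected ((P.erase v : Finset Lat) : Set Lat) := by
  have mono : ∀ x ∉ (P : Set Lat), x ∉ ((P.erase v : Finset Lat) : Set Lat) := fun x hx h =>
    hx (Finset.mem_of_mem_erase h)
  have hv : v ∉ ((P.erase v : Finset Lat) : Set Lat) := Finset.notMem_erase v P
  have lift : ∀ b ∉ (P : Set Lat), ∀ b' ∉ (P : Set Lat), Relation.ReflTransGen (fun x y =>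
      hexGraph.Adj x y ∧ x ∉ ((P.erase v : Finset Lat) : Set Lat) ∧
        y ∉ ((P.erase v : Finset Lat) : Set Lat)) b b' := fun b hb b' hb' =>
    Relation.ReflTransGen.mono (fun x y h => ⟨h.1, mono x h.2.1, mono y h.2.2⟩) b b' (hP b hb b' hb')
  have cases : ∀ b ∉ ((P.erase v : Finset Lat) : Set Lat), b = v ∨ b ∉ (P : Set Lat) := by
    intro b hb
    by_cases h : b = v
    · exact Or.inl h
    · exact Or.inr fun h' => hb (Finset.mem_erase.2 ⟨h, h'⟩)
  intro b hb b' hb'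
  rcases cases b hb with rfl | h <;> rcases cases b' hb' with rfl | h'
  · exact .refl
  · exact .head ⟨huv, hv, mono u hu⟩ (lift u hu b' h')
  · exact .tail (lift b h u hu) ⟨huv.symm, mono u hu, hv⟩
  · exact lift b h b' h'

theorem exists_levelFn_of_erase_top {P : Finset Lat} (hP : CoConnected (P : Set Lat)) {o v : Lat}
    (hv : v ∈ P) (ho : o ∈ P) (hvo : v ≠ o) (hmax : ∀ x ∈ P, x.1 + 2 * x.2 ≤ v.1 + 2 * v.2)
    (ih : ∀ o ∈ P.erase v, ∃ K h, LevelFn ((P.erase v : Finset Lat) : Set Lat) o K h) :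
    ∃ K h, LevelFn (P : Set Lat) o K h := by
  rw [Finset.coe_erase] at ih
  obtain ⟨K, h, H⟩ := ih o (Finset.mem_erase.2 ⟨hvo.symm, ho⟩)
  have hnb : ∀ x ∈ (P : Set Lat), hexGraph.Adj v x →
      x = (v.1 - 1, v.2) ∨ x = (v.1, v.2 - 1) ∨ x = (v.1 + 1, v.2 - 1) := by
    intro x hx hvx
    have := hmax x hx
    rw [adj_iff] at hvx
    simp only [lat_eq_iff]
    omega
  have va : hexGraph.Adj v (v.1 - 1, v.2) := by rw [adj_iff]; simp
  have vb : hexGraph.Adj v (v.1, v.2 - 1) := by rw [adj_iff]; simp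
  have vc : hexGraph.Adj v (v.1 + 1, v.2 - 1) := by rw [adj_iff]; simp
  have ab : hexGraph.Adj (v.1 - 1, v.2) (v.1, v.2 - 1) := by rw [adj_iff]; simp
  have bc : hexGraph.Adj (v.1, v.2 - 1) (v.1 + 1, v.2 - 1) := by rw [adj_iff]; simp
  by_cases hiso : ∀ x ∈ K, ¬ hexGraph.Adj x v
  · exact ⟨K, h, H.add_isolated hiso⟩
  push Not at hiso
  obtain ⟨e, he, hev⟩ := hiso
  have heP := (H.sub he).1
  by_cases hK : ∀ x ∈ (P : Set Lat), hexGraph.Adj v x → x ∈ K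
  · have hfin : {x | x ∈ K ∧ hexGraph.Adj v x}.Finite :=
      P.finite_toSet.subset fun x hx => (H.sub hx.1).1
    obtain ⟨n, hn, hmin⟩ := Set.exists_min_image _ h hfin ⟨e, he, hev.symm⟩
    refine H.attach hv hnb hK ?_ hn.1 hn.2 fun x hx hvx => hmin x ⟨hx, hvx⟩
    intro hA hC
    by_contra hB
    have hB' : (v.1, v.2 - 1) ∉ P := fun h => hB (hK _ h vb)
    obtain ⟨F, hF, hne⟩ := exists_separating hP hv hmax hB' (H.sub hA).1 (H.sub hC).1
    have hF' := H.const (F := F) fun p hp q hq => hF p (Finset.mem_erase.2 ⟨hp.2, hp.1⟩) q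
      (Finset.mem_erase.2 ⟨hq.2, hq.1⟩)
    exact hne ((hF' _ hA).trans (hF' _ hC).symm)
  · push Not at hK
    obtain ⟨f, hf, hvf, hfK⟩ := hK
    have hfv : f ≠ v := fun e => hexGraph.loopless.irrefl _ (e ▸ hvf)
    have hev' : e ≠ v := fun e' => hexGraph.loopless.irrefl _ (e' ▸ hev)
    have nadj : ∀ x ∈ K, ¬ hexGraph.Adj x f := fun x hx h => hfK (H.closed x hx f ⟨hf, hfv⟩ h)
    have nef : e ≠ f := fun h => hfK (h ▸ he)
    obtain ⟨K₂, h₂, H₂⟩ := ih f (Finset.mem_erase.2 ⟨hfv, hf⟩)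
    have hB : (v.1, v.2 - 1) ∉ P := by
      intro hB
      have hBv : (v.1, v.2 - 1) ≠ v := fun h => by simp [lat_eq_iff] at h
      by_cases hBK : (v.1, v.2 - 1) ∈ K
      · rcases hnb f hf hvf with rfl | rfl | rfl
        exacts [nadj _ hBK ab.symm, hfK hBK, nadj _ hBK bc]
      · rcases hnb e heP hev.symm with rfl | rfl | rfl
        exacts [hBK (H.closed _ he _ ⟨hB, hBv⟩ ab), hBK he, hBK (H.closed _ he _ ⟨hB, hBv⟩ bc.symm)]
    have hnb' : ∀ x ∈ (P : Set Lat), hexGraph.Adj v x →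
        x = (v.1 - 1, v.2) ∨ x = (v.1 + 1, v.2 - 1) := by
      intro x hx hvx
      rcases hnb x hx hvx with h | h | h
      exacts [Or.inl h, absurd (h ▸ hx) hB, Or.inr h]
    have hsep : ∀ F : Lat → ℤ, (∀ p ∈ P.erase v, ∀ q ∈ P.erase v, hexGraph.Adj p q → F q = F p) →
        F e ≠ F f → ∀ x ∈ K, x ∉ K₂ := by
      intro F hF hne x hx hx₂
      have h1 := H.const (F := F) (fun p hp q hq => hF p (Finset.mem_erase.2 ⟨hp.2, hp.1⟩) q
        (Finset.mem_erase.2 ⟨hq.2, hq.1⟩))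
      have h2 := H₂.const (F := F) (fun p hp q hq => hF p (Finset.mem_erase.2 ⟨hp.2, hp.1⟩) q
        (Finset.mem_erase.2 ⟨hq.2, hq.1⟩)) x hx₂
      exact hne ((h1 e he).trans ((h1 x hx).symm.trans h2))
    rcases hnb' e heP hev.symm with rfl | rfl <;> rcases hnb' f hf hvf with rfl | rfl
    · exact absurd rfl nef
    · obtain ⟨F, hF, hne⟩ := exists_separating hP hv hmax hB heP hf
      exact H.glue H₂ hv he va vc (hsep F hF hne) hnb'
    · obtain ⟨F, hF, hne⟩ := exists_separating hP hv hmax hB hf heP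
      exact H.glue H₂ hv he vc va (hsep F hF hne.symm) fun x hx h => (hnb' x hx h).symm
    · exact absurd rfl nef

/-- Distances in finite sets without holes are well behaved. -/
theorem CoConnected.exists_levelFn {P : Finset Lat} (hP : CoConnected (P : Set Lat)) {o : Lat}
    (ho : o ∈ P) : ∃ K h, LevelFn (P : Set Lat) o K h := by
  induction hn : P.card generalizing P o with
  | zero => simp [Finset.card_eq_zero.1 hn] at ho
  | succ n ih =>
    obtain ⟨v, hv, hmax⟩ := P.exists_max_image (fun x => x.1 + 2 * x.2) ⟨o, ho⟩
    by_cases hvo : v = o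
    · subst hvo
      obtain ⟨u, hu, hmin⟩ := P.exists_min_image (fun x => x.1 + 2 * x.2) ⟨v, ho⟩
      by_cases huv : u = v
      · subst huv
        have hall : ∀ x ∈ P, ∀ y ∈ P, ¬ hexGraph.Adj x y := by
          intro x hx y hy hxy
          have h1 := hmax x hx
          have h2 := hmax y hy
          have h3 := hmin x hx
          have h4 := hmin y hy
          rw [adj_iff] at hxy
          omega
        refine ⟨{u}, fun _ => 0, rfl, ?_, ?_, rfl, ?_, ?_, ?_, ?_⟩
        · rintro x rfl; exact ho
        · rintro x rfl y hy hxy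
          exact absurd hxy (hall x ho y hy)
        · rintro x rfl h; exact absurd rfl h
        · rintro x rfl y rfl hxy; simp
        · rintro x rfl y rfl z rfl hxy; exact absurd hxy (hexGraph.loopless.irrefl _)
        · rintro x rfl y rfl hxy; exact absurd hxy (hexGraph.loopless.irrefl _)
      · let Q : Finset Lat := P.image fun x => -x
        have memQ : ∀ x, x ∈ Q ↔ -x ∈ P := by
          intro x
          simp only [Q, Finset.mem_image]
          constructor
          · rintro ⟨y, hy, rfl⟩; simpa using hy
          · intro h; exact ⟨-x, h, neg_neg x⟩
        have hQ : CoConnected (Q : Set Lat) := by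
          intro b hb b' hb'
          rw [Finset.mem_coe, memQ] at hb hb'
          have := (hP _ hb _ hb').lift (fun x => -x)
            (p := fun x y => hexGraph.Adj x y ∧ x ∉ (Q : Set Lat) ∧ y ∉ (Q : Set Lat))
            (fun x y h => ⟨LevelFn.neg_adj.2 h.1, by simpa [memQ] using h.2.1,
              by simpa [memQ] using h.2.2⟩)
          simpa [Function.onFun] using this
        have huP : (u.1, u.2 - 1) ∉ P := fun h => by
          have := hmin _ h
          dsimp only at this
          omega
        have hPu : CoConnected ((P.erase u : Finset Lat) : Set Lat) :=
          hP.erase huP (by rw [adj_iff]; simp)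
        obtain ⟨K, h, H⟩ := exists_levelFn_of_erase_top hQ (o := -v) (v := -u)
          (by simpa [memQ] using hu) (by simpa [memQ] using hv) (by simpa using huv)
          (by
            intro x hx
            have := hmin _ ((memQ x).1 hx)
            simp only [Prod.fst_neg, Prod.snd_neg] at *
            omega)
          (by
            intro o' ho'
            rw [Finset.mem_erase, memQ] at ho'
            obtain ⟨K, h, H⟩ := ih hPu (o := -o')
              (Finset.mem_erase.2 ⟨fun e => ho'.1 (by rw [← e, neg_neg]), ho'.2⟩)
              (by rw [Finset.card_erase_of_mem hu, hn]; rfl)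
            have H' := H.neg
            rw [neg_neg] at H'
            have : ((Q.erase (-u) : Finset Lat) : Set Lat) =
                {x | -x ∈ ((P.erase u : Finset Lat) : Set Lat)} := by
              ext x
              simp [memQ, neg_eq_iff_eq_neg]
            rw [this]
            exact ⟨_, _, H'⟩)
        have H' := H.neg
        rw [neg_neg] at H'
        have : {x | -x ∈ (Q : Set Lat)} = (P : Set Lat) := by
          ext x
          simp [memQ]
        rw [this] at H'
        exact ⟨_, _, H'⟩
    · have hvP : (v.1, v.2 + 1) ∉ P := fun h => by
        have := hmax _ h
        dsimp only at this
        omega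
      have hPv : CoConnected ((P.erase v : Finset Lat) : Set Lat) :=
        hP.erase hvP (by rw [adj_iff]; simp)
      exact exists_levelFn_of_erase_top hP hv ho hvo hmax fun o' ho' =>
        ih hPv ho' (by rw [Finset.card_erase_of_mem hv, hn]; rfl)

/-! ### The hop count of a proper shape -/

/-- The points through which the hop count of `S` is measured. -/
abbrev hopDomain (S : Set Lat) : Set Lat := S ∪ {O, p1, p2, p3, p4, p5, p6}

theorem mem_hexagon_iff (x : Lat) : x ∈ ({O, p1, p2, p3, p4, p5, p6} : Set Lat) ↔
    (x.2 = 0 ∧ -1 ≤ x.1 ∧ x.1 ≤ 1) ∨ (x.2 = 1 ∧ -1 ≤ x.1 ∧ x.1 ≤ 0) ∨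
      (x.2 = -1 ∧ 0 ≤ x.1 ∧ x.1 ≤ 1) := by
  simp only [Set.mem_insert_iff, Set.mem_singleton_iff, O, p1, p2, p3, p4, p5, p6, lat_eq_iff]
  omega

theorem reflTransGen_line {r : Lat → Lat → Prop} (f : ℕ → Lat) (n : ℕ)
    (h : ∀ k < n, r (f k) (f (k + 1))) : Relation.ReflTransGen r (f 0) (f n) := by
  induction n with
  | zero => exact .refl
  | succ n ih => exact .tail (ih fun k hk => h k (by omega)) (h n (by omega))

theorem row_lt_of_hop_two {S : Set Lat} {x : Lat} (hx : 2 ≤ x.2) (h : hop S x = 2) :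
    x = (-2, 2) ∨ x = (-1, 2) ∨ x = (0, 2) := by
  unfold hop at h
  split_ifs at h with hr
  · obtain ⟨w, hw⟩ := hr.exists_walk_length_eq_dist
    have hw2 : w.length = 2 := by omega
    cases w with
    | nil => simp at hw2
    | cons h1 w =>
      cases w with
      | nil => simp at hw2
      | cons h2 w =>
        cases w with
        | nil =>
          have h3 := h1.1
          have h4 := h2.1
          rw [adj_iff] at h3 h4
          simp only [O, lat_eq_iff] at *
          omega
        | cons h3 w => simp at hw2

theorem reflTransGen_of_reachable_induce {T : Set Lat} {x y : T}
    (h : (hexGraph.induce T).Reachable x y) :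
    Relation.ReflTransGen (fun x y => hexGraph.Adj x y ∧ x ∈ T ∧ y ∈ T) (x : Lat) y := by
  obtain ⟨w⟩ := h
  induction w with
  | nil => exact .refl
  | cons h _ ih => exact .head ⟨h, Subtype.coe_prop _, Subtype.coe_prop _⟩ ih

theorem ProperRibbonization.second_row_mem {S : Set Lat} (hS : ProperRibbonization S) :
    ((-2, 2) : Lat) ∈ S ∧ ((-1, 2) : Lat) ∈ S ∧ ((0, 2) : Lat) ∈ S := by
  obtain ⟨R, ⟨⟨x, hx, rfl⟩, hg, hc⟩, -⟩ := hS.root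
  have hRS : ribbonOf S x ⊆ S := by
    intro y hy
    obtain ⟨w⟩ := hy
    cases w.reverse with
    | nil => exact hx
    | cons h _ => exact h.2.1
  have hR : ribbonOf S x ⊆ ({(-2, 2), (-1, 2), (0, 2)} : Set Lat) := fun y hy =>
    row_lt_of_hop_two (hS.subset_H1 (hRS hy)) (hg y hy)
  have h3 : ({(-2, 2), (-1, 2), (0, 2)} : Set Lat).ncard ≤ 3 := by
    refine (Set.ncard_insert_le _ _).trans ?_
    have := Set.ncard_insert_le ((-1, 2) : Lat) {(0, 2)}
    rw [Set.ncard_singleton] at this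
    omega
  have := Set.eq_of_subset_of_ncard_le hR (by omega)
  rw [this] at hRS
  exact ⟨hRS (by simp), hRS (by simp), hRS (by simp)⟩

theorem coConnected_hopDomain {S : Set Lat} (hS : ProperRibbonization S)
    (hcompl : (hexGraph.induce Sᶜ).Connected) : CoConnected (hopDomain S) := by
  obtain ⟨ha, hb, hc⟩ := hS.second_row_mem
  have hrow : ∀ x ∈ S, 2 ≤ x.2 := fun x hx => hS.subset_H1 hx
  have mem : ∀ x : Lat, x.2 ≤ 1 → x ∉ ({O, p1, p2, p3, p4, p5, p6} : Set Lat) →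
      x ∉ hopDomain S := by
    rintro x hx h (h' | h')
    · have := hrow x h'; omega
    · exact h h'
  set r : Lat → Lat → Prop :=
    fun x y => hexGraph.Adj x y ∧ x ∉ hopDomain S ∧ y ∉ hopDomain S with hr
  have rsymm : ∀ x y, r x y → r y x := fun x y h => ⟨h.1.symm, h.2.2, h.2.1⟩
  have gsymm : ∀ {x y}, Relation.ReflTransGen r x y → Relation.ReflTransGen r y x := by
    intro x y h
    induction h with
    | refl => exact .refl
    | tail _ h ih => exact .head (rsymm _ _ h) ih
  have low : ∀ x : Lat, x.2 ≤ -2 → x ∉ hopDomain S := fun x hx =>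
    mem x (by omega) (by rw [mem_hexagon_iff]; omega)
  -- the points below the hexagon are connected
  have s1 : ∀ x : Lat, x.2 ≤ -2 → Relation.ReflTransGen r x (0, -2) := by
    rintro ⟨i, j⟩ hj
    dsimp only at hj
    have v : Relation.ReflTransGen r (i, j) (i, -2) := by
      obtain ⟨n, hn⟩ : ∃ n : ℕ, (n : ℤ) = -2 - j := ⟨(-2 - j).toNat, by omega⟩
      have := reflTransGen_line (r := r) (fun k => (i, j + k)) n fun k hk =>
        ⟨by rw [adj_iff]; dsimp only; omega, low _ (by dsimp only; omega),
          low _ (by dsimp only; omega)⟩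
      have e : j + (n : ℤ) = -2 := by omega
      simpa [e] using this
    refine v.trans ?_
    rcases le_total i 0 with hi | hi
    · obtain ⟨n, hn⟩ : ∃ n : ℕ, (n : ℤ) = -i := ⟨(-i).toNat, by omega⟩
      have := reflTransGen_line (r := r) (fun k => (i + k, -2)) n fun k hk =>
        ⟨by rw [adj_iff]; dsimp only; omega, low _ (by dsimp only; omega),
          low _ (by dsimp only; omega)⟩
      have e : i + (n : ℤ) = 0 := by omega
      simpa [e] using this
    · obtain ⟨n, hn⟩ : ∃ n : ℕ, (n : ℤ) = i := ⟨(i).toNat, by omega⟩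
      have := reflTransGen_line (r := r) (fun k => (i - k, -2)) n fun k hk =>
        ⟨by rw [adj_iff]; dsimp only; omega, low _ (by dsimp only; omega),
          low _ (by dsimp only; omega)⟩
      have e : i - (n : ℤ) = 0 := by omega
      simpa [e] using this
  have s2 : ∀ x : Lat, x.2 ≤ 1 → x ∉ ({O, p1, p2, p3, p4, p5, p6} : Set Lat) →
      Relation.ReflTransGen r x (0, -2) := by
    intro x
    induction hn : (x.2 + 2).toNat generalizing x with
    | zero => exact fun _ _ => s1 x (by omega)
    | succ n ih =>
      intro hx hxh
      obtain ⟨y, h1, h2, h3⟩ : ∃ y : Lat, hexGraph.Adj x y ∧ y.2 = x.2 - 1 ∧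
          y ∉ ({O, p1, p2, p3, p4, p5, p6} : Set Lat) := by
        rw [mem_hexagon_iff] at hxh
        by_cases hi : 1 ≤ x.1
        · refine ⟨(x.1 + 1, x.2 - 1), ?_, rfl, ?_⟩
          · rw [adj_iff]; simp
          · rw [mem_hexagon_iff]; dsimp only; omega
        · refine ⟨(x.1, x.2 - 1), ?_, rfl, ?_⟩
          · rw [adj_iff]; simp
          · rw [mem_hexagon_iff]; dsimp only; omega
      exact .head ⟨h1, mem x hx hxh, mem y (by omega) h3⟩ (ih y (by omega) (by omega) h3)
  have s3 : ∀ x ∉ hopDomain S, Relation.ReflTransGen r x (0, -2) := by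
    intro x hx
    have hxS : x ∈ Sᶜ := fun h => hx (Or.inl h)
    have hOS : O ∈ Sᶜ := fun h => by have := hrow _ h; simp [O] at this
    have key := reflTransGen_of_reachable_induce (hcompl.preconnected ⟨x, hxS⟩ ⟨O, hOS⟩)
    dsimp only at key
    induction key using Relation.ReflTransGen.head_induction_on with
    | refl => exact absurd (Or.inr (by simp)) hx
    | @head x z h _ ih =>
      by_cases hx1 : x.2 ≤ 1
      · exact s2 x hx1 fun h' => hx (Or.inr h')
      have hz : z ∉ hopDomain S := by
        rintro (h' | h')
        · exact h.2.2 h'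
        · rw [mem_hexagon_iff] at h'
          have h1 := h.1
          rw [adj_iff] at h1
          have : x = (-2, 2) ∨ x = (-1, 2) ∨ x = (0, 2) := by
            simp only [lat_eq_iff]
            omega
          rcases this with rfl | rfl | rfl
          exacts [h.2.1 ha, h.2.1 hb, h.2.1 hc]
      exact .head ⟨h.1, hx, hz⟩ (ih hz h.2.2)
  exact fun b hb b' hb' => (s3 b hb).trans (gsymm (s3 b' hb'))

/-- The consequences of a proper ribbonization that are used for the merging points. -/
structure WellLevelled (S : Set Lat) : Prop where
  row : ∀ x ∈ S, 2 ≤ x.2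
  left_mem : ((-2, 2) : Lat) ∈ S
  mid_mem : ((-1, 2) : Lat) ∈ S
  right_mem : ((0, 2) : Lat) ∈ S
  two_le : ∀ x ∈ S, 2 ≤ hop S x
  hop_two : ∀ x ∈ S, hop S x = 2 → x = (-2, 2) ∨ x = (-1, 2) ∨ x = (0, 2)
  hop_one : ∀ x, hop S x = 1 → x = p1 ∨ x = p2 ∨ x = p3 ∨ x = p4 ∨ x = p5 ∨ x = p6
  hop_p1 : hop S p1 = 1
  hop_p2 : hop S p2 = 1
  mem_of_hop : ∀ x, 2 ≤ hop S x → x ∈ S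
  low : ∀ x ∈ S, ∃ y, hexGraph.Adj x y ∧ hop S y + 1 = hop S x
  lip : ∀ x ∈ S, ∀ y ∈ hopDomain S, hexGraph.Adj x y →
    hop S y ≤ hop S x + 1 ∧ hop S x ≤ hop S y + 1
  clique : ∀ x ∈ S, ∀ y z, hexGraph.Adj x y → hexGraph.Adj x z →
    hop S y + 1 = hop S x → hop S z + 1 = hop S x → y = z ∨ hexGraph.Adj y z
  tri : ∀ x ∈ S, ∀ y ∈ S, hexGraph.Adj x y → hop S x = hop S y →
    ∃ z, hexGraph.Adj x z ∧ hexGraph.Adj y z ∧ hop S z + 1 = hop S x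

theorem LevelFn.hop_eq {S K : Set Lat} {h : Lat → ℕ} (H : LevelFn (hopDomain S) O K h) {x : Lat}
    (hx : x ∈ K) : hop S x = h x := by
  have lower : ∀ {x y : Lat} (w : (hopGraph S).Walk x y), x ∈ K → h x ≤ h y + w.length := by
    intro x y w
    induction w with
    | nil => intro _; simp
    | @cons x z y h' w ih =>
      intro hx
      have hz := H.closed x hx z h'.2.2 h'.1
      have h1 := ih hz
      have h2 := H.lip z hz x hx h'.1.symm
      simp only [SimpleGraph.Walk.length_cons]
      omega
  have upper : ∃ w : (hopGraph S).Walk x O, w.length = h x := by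
    induction hn : h x generalizing x with
    | zero =>
      by_cases hxo : x = O
      · subst hxo; exact ⟨.nil, rfl⟩
      · obtain ⟨y, _, _, h2⟩ := H.low x hx hxo
        omega
    | succ n ih =>
      have hxo : x ≠ O := fun e => by rw [e, H.zero] at hn; omega
      obtain ⟨y, hy, h1, h2⟩ := H.low x hx hxo
      obtain ⟨w, hw⟩ := ih hy (by omega)
      have hadj : (hopGraph S).Adj x y := ⟨h1, H.sub hx, H.sub hy⟩
      exact ⟨.cons hadj w, by rw [SimpleGraph.Walk.length_cons, hw]⟩
  obtain ⟨w, hw⟩ := upper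
  have hr : (hopGraph S).Reachable x O := ⟨w⟩
  obtain ⟨w', hw'⟩ := hr.exists_walk_length_eq_dist
  have h1 := lower w' hx
  have h2 := SimpleGraph.dist_le w
  rw [H.zero] at h1
  unfold hop
  rw [if_pos hr]
  omega

theorem ProperRibbonization.wellLevelled {S : Finset Lat} (hS : ProperRibbonization (S : Set Lat))
    (hcompl : (hexGraph.induce (S : Set Lat)ᶜ).Connected) : WellLevelled (S : Set Lat) := by
  classical
  obtain ⟨ha, hb, hc⟩ := hS.second_row_mem
  have hrow : ∀ x ∈ (S : Set Lat), 2 ≤ x.2 := fun x hx => hS.subset_H1 hx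
  obtain ⟨K, h, H⟩ : ∃ K h, LevelFn (hopDomain (S : Set Lat)) O K h := by
    have hco := coConnected_hopDomain hS hcompl
    have e : hopDomain (S : Set Lat) =
        ((S ∪ {O, p1, p2, p3, p4, p5, p6} : Finset Lat) : Set Lat) := by
      push_cast; rfl
    rw [e] at hco ⊢
    exact hco.exists_levelFn (by simp)
  have hO : O ∈ hopDomain (S : Set Lat) := Or.inr (by simp)
  have hexK : ∀ x ∈ ({O, p1, p2, p3, p4, p5, p6} : Set Lat), x ∈ K := by
    intro x hx
    by_cases hxO : x = O
    · rw [hxO]; exact H.base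
    · refine H.closed O H.base x (Or.inr hx) ?_
      rw [mem_hexagon_iff] at hx
      rw [adj_iff]
      simp only [O, lat_eq_iff] at *
      omega
  have inK : ∀ {x y : Lat}, (hopGraph (S : Set Lat)).Walk x y → x ∈ K → y ∈ K := by
    intro x y w
    induction w with
    | nil => exact id
    | cons h' _ ih => exact fun hx => ih (H.closed _ hx _ h'.2.2 h'.1)
  have SK : ∀ x ∈ (S : Set Lat), x ∈ K := by
    intro x hx
    have := hS.hop_pos x hx
    unfold hop at this
    split_ifs at this with hr
    · obtain ⟨w⟩ := hr
      exact inK w.reverse H.base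
    · omega
  have domK : ∀ x, x ∈ hopDomain (S : Set Lat) → x ∈ K := by
    rintro x (hx | hx)
    exacts [SK x hx, hexK x hx]
  have hopK : ∀ x ∈ K, hop S x = h x := fun x hx => H.hop_eq hx
  have notS : ∀ x : Lat, x.2 ≤ 1 → x ∉ (S : Set Lat) := fun x hx h' => by
    have := hrow x h'; omega
  have nonneg : ∀ x, 0 ≤ hop S x → x ∈ K := by
    intro x hx
    unfold hop at hx
    split_ifs at hx with hr
    · obtain ⟨w⟩ := hr
      exact inK w.reverse H.base
    · omega
  have hexone : ∀ x ∈ ({O, p1, p2, p3, p4, p5, p6} : Set Lat), x ≠ O → h x = 1 := by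
    intro x hx hxO
    have hadj : hexGraph.Adj O x := by
      rw [mem_hexagon_iff] at hx
      rw [adj_iff]
      simp only [O, lat_eq_iff, ne_eq] at *
      omega
    have h1 := H.lip O H.base x (hexK x hx) hadj
    obtain ⟨y, _, _, h2⟩ := H.low x (hexK x hx) hxO
    rw [H.zero] at h1
    omega
  have adjO : ∀ x, hexGraph.Adj x O → x = p1 ∨ x = p2 ∨ x = p3 ∨ x = p4 ∨ x = p5 ∨ x = p6 := by
    intro x hx
    rw [adj_iff] at hx
    simp only [O, p1, p2, p3, p4, p5, p6, lat_eq_iff] at *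
    omega
  have Sone : ∀ x ∈ K, h x = 1 → x = p1 ∨ x = p2 ∨ x = p3 ∨ x = p4 ∨ x = p5 ∨ x = p6 := by
    intro x hx h1
    have hxO : x ≠ O := fun e => by rw [e, H.zero] at h1; omega
    obtain ⟨y, hy, h2, h3⟩ := H.low x hx hxO
    have hyO : y = O := by
      by_contra hyO
      obtain ⟨z, _, _, h4⟩ := H.low y hy hyO
      omega
    exact adjO x (hyO ▸ h2)
  have twole : ∀ x ∈ (S : Set Lat), 2 ≤ h x := by
    intro x hx
    by_contra hlt
    rcases (by omega : h x = 0 ∨ h x = 1) with h0 | h0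
    · by_cases hxO : x = O
      · exact notS O (by simp [O]) (hxO ▸ hx)
      · obtain ⟨z, _, _, h4⟩ := H.low x (SK x hx) hxO
        omega
    · have := hrow x hx
      rcases Sone x (SK x hx) h0 with rfl | rfl | rfl | rfl | rfl | rfl <;>
        simp [p1, p2, p3, p4, p5, p6] at this
  refine ⟨hrow, ha, hb, hc, ?_, ?_, ?_, ?_, ?_, ?_, ?_, ?_, ?_, ?_⟩
  · intro x hx
    rw [hopK x (SK x hx)]
    exact_mod_cast twole x hx
  · exact fun x hx => row_lt_of_hop_two (hrow x hx)
  · intro x hx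
    have hxK := nonneg x (by omega)
    exact Sone x hxK (by have := hopK x hxK; omega)
  · rw [hopK p1 (hexK p1 (by simp)), hexone p1 (by simp) (by simp [p1, O])]; rfl
  · rw [hopK p2 (hexK p2 (by simp)), hexone p2 (by simp) (by simp [p2, O])]; rfl
  · intro x hx
    have hxK := nonneg x (by omega)
    rcases H.sub hxK with h' | h'
    · exact h'
    · have h1 := hopK x hxK
      by_cases hxO : x = O
      · rw [hxO, hopK O H.base, H.zero] at hx; omega
      · have := hexone x h' hxO
        omega
  · intro x hx
    have hxO : x ≠ O := fun e => notS O (by simp [O]) (e ▸ hx)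
    obtain ⟨y, hy, h1, h2⟩ := H.low x (SK x hx) hxO
    exact ⟨y, h1, by rw [hopK y hy, hopK x (SK x hx)]; omega⟩
  · intro x hx y hy hxy
    rw [hopK x (SK x hx), hopK y (domK y hy)]
    have h1 := H.lip x (SK x hx) y (domK y hy) hxy
    have h2 := H.lip y (domK y hy) x (SK x hx) hxy.symm
    omega
  · intro x hx y z hxy hxz h1 h2
    have h3 := hopK x (SK x hx)
    have h4 := twole x hx
    have hy := nonneg y (by omega)
    have hz := nonneg z (by omega)
    rw [h3, hopK y hy] at h1
    rw [h3, hopK z hz] at h2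
    exact H.clique x (SK x hx) y hy z hz hxy hxz (by omega) (by omega)
  · intro x hx y hy hxy h1
    rw [hopK x (SK x hx), hopK y (SK y hy)] at h1
    obtain ⟨z, hz, h2, h3, h4⟩ := H.tri x (SK x hx) y (SK y hy) hxy (by omega)
    exact ⟨z, h2, h3, by rw [hopK z hz, hopK x (SK x hx)]; omega⟩

/-! ### Boundary tracing -/

/-- Clockwise rotation of `v` by `π / 3` around `c`. -/
def rot (c v : Lat) : Lat := c + cw (v - c)

theorem rot_fst (c v : Lat) : (rot c v).1 = v.1 + v.2 - c.2 := by
  simp only [rot, cw, Prod.fst_add, Prod.fst_sub, Prod.snd_sub]; ring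

theorem rot_snd (c v : Lat) : (rot c v).2 = c.2 + c.1 - v.1 := by
  simp only [rot, cw, Prod.snd_add, Prod.fst_sub]; ring

theorem adj_rot {c v : Lat} (h : hexGraph.Adj c v) : hexGraph.Adj c (rot c v) := by
  rw [adj_iff] at *
  rw [rot_fst, rot_snd]
  omega

theorem adj_rot' {c v : Lat} (h : hexGraph.Adj c v) : hexGraph.Adj v (rot c v) := by
  rw [adj_iff] at *
  rw [rot_fst, rot_snd]
  omega

theorem rot_rot (c v : Lat) : rot v (rot c v) = c := by
  rw [lat_eq_iff]
  simp only [rot_fst, rot_snd]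
  constructor <;> ring

theorem rot_rot' (c v : Lat) : rot (rot c v) c = v := by
  rw [lat_eq_iff]
  simp only [rot_fst, rot_snd]
  constructor <;> ring

theorem rot_injective (c : Lat) : Function.Injective (rot c) := by
  intro v w h
  rw [lat_eq_iff] at *
  simp only [rot_fst, rot_snd] at h
  omega

/-- Three pairwise adjacent points are a clockwise triangle in one of the two orders. -/
theorem rot_eq_or {x y z : Lat} (hxy : hexGraph.Adj x y) (hxz : hexGraph.Adj x z)
    (hyz : hexGraph.Adj y z) : rot x y = z ∨ rot x z = y := by
  rw [adj_iff] at *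
  simp only [lat_eq_iff, rot_fst, rot_snd]
  omega

/-- The pairs of adjacent points `c ∈ C` and `v ∉ C`. -/
def boundaryEdges (C : Set Lat) : Set (Lat × Lat) :=
  {e | e.1 ∈ C ∧ e.2 ∉ C ∧ hexGraph.Adj e.1 e.2}

open Classical in
/-- One step of the clockwise tour around `C`. -/
noncomputable def traceStep (C : Set Lat) (e : Lat × Lat) : Lat × Lat :=
  if rot e.1 e.2 ∈ C then (rot e.1 e.2, e.2) else (e.1, rot e.1 e.2)

theorem traceStep_of_mem {C : Set Lat} {c v : Lat} (h : rot c v ∈ C) :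
    traceStep C (c, v) = (rot c v, v) := if_pos h

theorem traceStep_of_notMem {C : Set Lat} {c v : Lat} (h : rot c v ∉ C) :
    traceStep C (c, v) = (c, rot c v) := if_neg h

theorem mapsTo_traceStep (C : Set Lat) :
    Set.MapsTo (traceStep C) (boundaryEdges C) (boundaryEdges C) := by
  rintro ⟨c, v⟩ ⟨h1, h2, h3⟩
  by_cases h : rot c v ∈ C
  · rw [traceStep_of_mem h]
    exact ⟨h, h2, (adj_rot' h3).symm⟩
  · rw [traceStep_of_notMem h]
    exact ⟨h1, h, adj_rot h3⟩

theorem injOn_traceStep (C : Set Lat) : Set.InjOn (traceStep C) (boundaryEdges C) := by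
  rintro ⟨c, v⟩ ⟨h1, h2, h3⟩ ⟨c', v'⟩ ⟨h1', h2', h3'⟩ heq
  dsimp only at h1 h2 h3 h1' h2' h3'
  by_cases h : rot c v ∈ C <;> by_cases h' : rot c' v' ∈ C
  · rw [traceStep_of_mem h, traceStep_of_mem h', Prod.mk.injEq] at heq
    obtain ⟨h4, rfl⟩ := heq
    have := congrArg (rot v) h4
    rw [rot_rot, rot_rot] at this
    rw [this]
  · rw [traceStep_of_mem h, traceStep_of_notMem h', Prod.mk.injEq] at heq
    obtain ⟨h4, h5⟩ := heq
    have : rot (rot c v) c = v := rot_rot' c v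
    have h6 : v' = c := by
      apply rot_injective c'
      rw [← h5, ← h4, rot_rot']
    exact absurd (h6 ▸ h1) h2'
  · rw [traceStep_of_notMem h, traceStep_of_mem h', Prod.mk.injEq] at heq
    obtain ⟨h4, h5⟩ := heq
    have h6 : v = c' := by
      apply rot_injective c
      rw [h5, h4, rot_rot']
    exact absurd (h6 ▸ h1') h2
  · rw [traceStep_of_notMem h, traceStep_of_notMem h', Prod.mk.injEq] at heq
    obtain ⟨rfl, h5⟩ := heq
    rw [rot_injective c h5]

theorem finite_boundaryEdges {C : Set Lat} (hC : C.Finite) : (boundaryEdges C).Finite := by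
  have : boundaryEdges C ⊆
      ⋃ u ∈ (Set.Icc (-1) 1 ×ˢ Set.Icc (-1) 1 : Set Lat), (fun c => (c, c + u)) '' C := by
    rintro ⟨c, v⟩ ⟨h1, _, h3⟩
    dsimp only at h1 h3
    rw [adj_iff] at h3
    simp only [Set.mem_iUnion]
    refine ⟨v - c, ?_, c, h1, by simp⟩
    simp only [Set.mem_prod, Set.mem_Icc, Prod.fst_sub, Prod.snd_sub]
    omega
  exact (Set.Finite.biUnion ((Set.finite_Icc _ _).prod (Set.finite_Icc _ _))
    fun u _ => hC.image _).subset this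

theorem iterate_mem {C : Set Lat} {e : Lat × Lat} (he : e ∈ boundaryEdges C) (n : ℕ) :
    (traceStep C)^[n] e ∈ boundaryEdges C :=
  (mapsTo_traceStep C).iterate n he

theorem exists_period {C : Set Lat} (hC : C.Finite) {e : Lat × Lat} (he : e ∈ boundaryEdges C) :
    ∃ q, 0 < q ∧ (traceStep C)^[q] e = e := by
  have hfin := finite_boundaryEdges hC
  obtain ⟨m, -, n, -, hne, heq⟩ := Set.infinite_univ.exists_ne_map_eq_of_mapsTo
    (f := fun n => (traceStep C)^[n] e) (fun n _ => iterate_mem he n) hfin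
  have key : ∀ m n : ℕ, m < n → (traceStep C)^[m] e = (traceStep C)^[n] e →
      ∃ q, 0 < q ∧ (traceStep C)^[q] e = e := by
    intro m n hmn heq
    refine ⟨n - m, by omega, ?_⟩
    have h1 : n = m + (n - m) := by omega
    rw [h1, Function.iterate_add_apply] at heq
    exact ((injOn_traceStep C).iterate (mapsTo_traceStep C) m he (iterate_mem he _) heq).symm
  rcases lt_or_gt_of_ne hne with h | h
  exacts [key m n h heq, key n m h heq.symm]

/-! ### The tour around a connected set with connected complement is unique -/

theorem exists_antiderivative (a : ℤ → ℤ) : ∃ A : ℤ → ℤ, A 0 = 0 ∧ ∀ i, A (i + 1) - A i = a i := by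
  refine ⟨fun i => ∑ k ∈ Finset.range i.toNat, a k -
    ∑ k ∈ Finset.range (-i).toNat, a (-k - 1), by simp, fun i => ?_⟩
  rcases le_or_gt 0 i with hi | hi
  · lift i to ℕ using hi
    have h1 : ((i : ℤ) + 1).toNat = i + 1 := by omega
    have h2 : (-((i : ℤ) + 1)).toNat = 0 := by omega
    have h3 : (-(i : ℤ)).toNat = 0 := by omega
    simp only [h1, h2, h3, Int.toNat_natCast, Finset.sum_range_succ, Finset.range_zero,
      Finset.sum_empty]
    ring
  · obtain ⟨n, rfl⟩ : ∃ n : ℕ, i = -(n : ℤ) - 1 := ⟨(-i - 1).toNat, by omega⟩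
    have h1 : (-(n : ℤ) - 1 + 1).toNat = 0 := by omega
    have h2 : (-(-(n : ℤ) - 1 + 1)).toNat = n := by omega
    have h3 : (-(n : ℤ) - 1).toNat = 0 := by omega
    have h4 : (-(-(n : ℤ) - 1)).toNat = n + 1 := by omega
    simp only [h1, h2, h3, h4, Finset.sum_range_succ, Finset.range_zero, Finset.sum_empty]
    ring

/-- The hexagonal lattice is simply connected: closed cochains are exact. -/
theorem exists_potential (f : Lat → Lat → ℤ) (hanti : ∀ p q, f q p = -f p q)
    (htri : ∀ p q, hexGraph.Adj p q → f p q + f q (rot p q) + f (rot p q) p = 0) :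
    ∃ F : Lat → ℤ, ∀ p q, hexGraph.Adj p q → F q - F p = f p q := by
  obtain ⟨A, hA0, hA⟩ := exists_antiderivative fun i => f (i, 0) (i + 1, 0)
  choose B hB0 hB using fun i : ℤ => exists_antiderivative fun j => f (i, j) (i, j + 1)
  have t1 : ∀ i j : ℤ, f (i, j) (i, j + 1) + f (i, j + 1) (i + 1, j) + f (i + 1, j) (i, j) = 0 := by
    intro i j
    have := htri (i, j) (i, j + 1) (by rw [adj_iff]; simp)
    have e : rot (i, j) (i, j + 1) = (i + 1, j) := by
      rw [lat_eq_iff, rot_fst, rot_snd]; dsimp only; omega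
    rwa [e] at this
  have t2 : ∀ i j : ℤ, f (i, j + 1) (i + 1, j + 1) + f (i + 1, j + 1) (i + 1, j) +
      f (i + 1, j) (i, j + 1) = 0 := by
    intro i j
    have := htri (i, j + 1) (i + 1, j + 1) (by rw [adj_iff]; simp)
    have e : rot (i, j + 1) (i + 1, j + 1) = (i + 1, j) := by
      rw [lat_eq_iff, rot_fst, rot_snd]; dsimp only; omega
    rwa [e] at this
  have step : ∀ i j : ℤ, A (i + 1) + B (i + 1) (j + 1) - (A i + B i (j + 1))
      - f (i, j + 1) (i + 1, j + 1) = A (i + 1) + B (i + 1) j - (A i + B i j)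
      - f (i, j) (i + 1, j) := by
    intro i j
    have h1 := t1 i j
    have h2 := t2 i j
    have h3 := hB i j
    have h4 := hB (i + 1) j
    have h5 := hanti (i, j) (i + 1, j)
    have h6 := hanti (i, j + 1) (i + 1, j)
    have h7 := hanti (i + 1, j) (i + 1, j + 1)
    omega
  have hor : ∀ i j : ℤ, A (i + 1) + B (i + 1) j - (A i + B i j) = f (i, j) (i + 1, j) := by
    intro i j
    induction j with
    | zero =>
      have := hA i
      rw [hB0, hB0]; omega
    | succ n ih =>
      have := step i n
      omega
    | pred n ih =>
      have := step i (-n - 1)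
      rw [sub_add_cancel] at this
      omega
  have ver : ∀ i j : ℤ, A i + B i (j + 1) - (A i + B i j) = f (i, j) (i, j + 1) := by
    intro i j
    have := hB i j
    omega
  have dia : ∀ i j : ℤ, A (i + 1) + B (i + 1) j - (A i + B i (j + 1)) =
      f (i, j + 1) (i + 1, j) := by
    intro i j
    have h1 := hor i j
    have h2 := ver i j
    have h3 := t1 i j
    have h4 := hanti (i, j) (i + 1, j)
    omega
  refine ⟨fun p => A p.1 + B p.1 p.2, ?_⟩
  rintro ⟨i, j⟩ ⟨i', j'⟩ h
  rw [adj_iff] at h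
  dsimp only at h ⊢
  rcases h with ⟨rfl, rfl⟩ | ⟨rfl, rfl⟩ | ⟨h1, h2⟩ | ⟨h1, h2⟩ | ⟨h1, h2⟩ | ⟨h1, h2⟩
  · exact hor i j'
  · exact ver i' j
  · obtain rfl : i = i' + 1 := by omega
    obtain rfl : j' = j + 1 := by omega
    have := dia i' j
    have := hanti (i', j + 1) (i' + 1, j)
    omega
  · obtain rfl : i = i' + 1 := by omega
    subst h2
    have := hor i' j'
    have := hanti (i', j') (i' + 1, j')
    omega
  · obtain rfl : j = j' + 1 := by omega
    subst h1
    have := ver i' j'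
    have := hanti (i', j') (i', j' + 1)
    omega
  · obtain rfl : j = j' + 1 := by omega
    subst h1
    exact dia i j'

/-- If `C` and its complement are connected, then the tour around `C` meets every boundary edge. -/
theorem exists_iterate_eq {C : Set Lat} (hC : C.Finite)
    (hconn : ∀ x ∈ C, ∀ y ∈ C, Relation.ReflTransGen
      (fun x y => hexGraph.Adj x y ∧ x ∈ C ∧ y ∈ C) x y)
    (hco : CoConnected C) {e₀ e : Lat × Lat} (he₀ : e₀ ∈ boundaryEdges C)
    (he : e ∈ boundaryEdges C) : ∃ n, (traceStep C)^[n] e₀ = e := by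
  classical
  set Ω : Set (Lat × Lat) := {e | ∃ n, (traceStep C)^[n] e₀ = e} with hΩ
  have hΩE : Ω ⊆ boundaryEdges C := by
    rintro e ⟨n, rfl⟩
    exact iterate_mem he₀ n
  have hstep : ∀ e ∈ boundaryEdges C, (e ∈ Ω ↔ traceStep C e ∈ Ω) := by
    intro e he
    constructor
    · rintro ⟨n, rfl⟩
      exact ⟨n + 1, Function.iterate_succ_apply' _ _ _⟩
    · have key : ∀ n, (traceStep C)^[n + 1] e₀ = traceStep C e → e ∈ Ω := fun n hn =>
        ⟨n, injOn_traceStep C (iterate_mem he₀ n) he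
          (by rw [← hn, Function.iterate_succ_apply'])⟩
      rintro ⟨n, hn⟩
      cases n with
      | succ n => exact key n hn
      | zero =>
        obtain ⟨q, hq, hq'⟩ := exists_period hC he₀
        obtain ⟨m, rfl⟩ : ∃ m, q = m + 1 := ⟨q - 1, by omega⟩
        exact key m (hq'.trans hn)
  set f : Lat → Lat → ℤ := fun p q =>
    (if (p, q) ∈ Ω then 1 else 0) - (if (q, p) ∈ Ω then 1 else 0) with hf
  have h0 : ∀ p q, p ∉ C → (p, q) ∉ Ω := fun p q hp h => hp (hΩE h).1
  have h1 : ∀ p q, q ∈ C → (p, q) ∉ Ω := fun p q hp h => (hΩE h).2.1 hp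
  have piv : ∀ c v, hexGraph.Adj c v → c ∈ C → v ∉ C → rot c v ∈ C →
      ((c, v) ∈ Ω ↔ (rot c v, v) ∈ Ω) := fun c v h hc hv hr => by
    rw [hstep (c, v) ⟨hc, hv, h⟩, traceStep_of_mem hr]
  have arc : ∀ c v, hexGraph.Adj c v → c ∈ C → v ∉ C → rot c v ∉ C →
      ((c, v) ∈ Ω ↔ (c, rot c v) ∈ Ω) := fun c v h hc hv hr => by
    rw [hstep (c, v) ⟨hc, hv, h⟩, traceStep_of_notMem hr]
  have htri : ∀ p q, hexGraph.Adj p q → f p q + f q (rot p q) + f (rot p q) p = 0 := by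
    intro p q hpq
    have a1 := piv p q hpq
    have a2 := arc p q hpq
    have a3 := piv q (rot p q) (adj_rot' hpq)
    have a4 := arc q (rot p q) (adj_rot' hpq)
    have a5 := piv (rot p q) p (adj_rot hpq).symm
    have a6 := arc (rot p q) p (adj_rot hpq).symm
    rw [rot_rot] at a3 a4
    rw [rot_rot'] at a5 a6
    simp only [hf]
    by_cases hp : p ∈ C <;> by_cases hq : q ∈ C <;> by_cases hr : rot p q ∈ C <;>
      simp_all
  obtain ⟨F, hF⟩ := exists_potential f (fun p q => by simp only [hf]; ring) htri
  have FC : ∀ x ∈ C, ∀ y ∈ C, F x = F y := by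
    intro x hx y hy
    have := hconn x hx y hy
    clear hx hy
    induction this with
    | refl => rfl
    | tail _ h ih =>
      rw [ih]
      have h2 := hF _ _ h.1
      simp only [hf, if_neg (h1 _ _ h.2.1), if_neg (h1 _ _ h.2.2)] at h2
      omega
  have FC' : ∀ x ∉ C, ∀ y ∉ C, F x = F y := by
    intro x hx y hy
    have := hco x hx y hy
    clear hx hy
    induction this with
    | refl => rfl
    | tail _ h ih =>
      rw [ih]
      have h2 := hF _ _ h.1
      simp only [hf, if_neg (h0 _ _ h.2.1), if_neg (h0 _ _ h.2.2)] at h2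
      omega
  have e1 := hF _ _ he₀.2.2
  have e2 := hF _ _ he.2.2
  rw [FC _ he₀.1 _ he.1, FC' _ he₀.2.1 _ he.2.1, e2] at e1
  have hmem : e₀ ∈ Ω := ⟨0, rfl⟩
  simp only [hf, if_neg (h0 _ _ he₀.2.1), if_neg (h0 _ _ he.2.1), Prod.mk.eta, if_pos hmem] at e1
  by_contra hcon
  have : e ∉ Ω := hcon
  rw [if_neg this] at e1
  omega

/-! ### Ribbons -/

section Ribbons

variable {S : Set Lat}

theorem mem_ribbonOf_self (S : Set Lat) (x : Lat) : x ∈ ribbonOf S x :=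
  SimpleGraph.Reachable.refl x

theorem mem_of_mem_ribbonOf {x y : Lat} (hx : x ∈ S) (hy : y ∈ ribbonOf S x) :
    y ∈ S ∧ hop S y = hop S x := by
  obtain ⟨w⟩ := hy
  induction w with
  | nil => exact ⟨hx, rfl⟩
  | cons h _ ih =>
    have := ih h.2.2.1
    exact ⟨this.1, this.2.trans h.2.2.2.symm⟩

theorem ribbonOf_eq_of_mem {x y : Lat} (h : y ∈ ribbonOf S x) : ribbonOf S y = ribbonOf S x := by
  ext z
  exact ⟨fun h' => SimpleGraph.Reachable.trans h h',
    fun h' => SimpleGraph.Reachable.trans (SimpleGraph.Reachable.symm h) h'⟩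

theorem ribbonOf_eq_of_adj {x y : Lat} (hx : x ∈ S) (hy : y ∈ S) (hxy : hexGraph.Adj x y)
    (h : hop S x = hop S y) : ribbonOf S y = ribbonOf S x :=
  ribbonOf_eq_of_mem (SimpleGraph.Adj.reachable (G := levelGraph S) ⟨hxy, hx, hy, h⟩)

theorem IsRibbon.eq_ribbonOf {R : Set Lat} (hR : IsRibbon S R) {x : Lat} (hx : x ∈ R) :
    x ∈ S ∧ ribbonOf S x = R := by
  obtain ⟨z, hz, rfl⟩ := hR
  exact ⟨(mem_of_mem_ribbonOf hz hx).1, ribbonOf_eq_of_mem hx⟩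

namespace WellLevelled

theorem mem_hopDomain (W : WellLevelled S) {x : Lat} (h : 1 ≤ hop S x) : x ∈ hopDomain S := by
  rcases (by omega : hop S x = 1 ∨ 2 ≤ hop S x) with h1 | h1
  · right
    rcases W.hop_one x h1 with rfl | rfl | rfl | rfl | rfl | rfl <;> simp
  · exact Or.inl (W.mem_of_hop x h1)

theorem hop_lt_two (W : WellLevelled S) {x : Lat} (h : x ∉ S) : hop S x < 2 := by
  by_contra h'
  exact h (W.mem_of_hop x (by omega))

theorem mem_of_low (W : WellLevelled S) {x y : Lat} (h : hop S y + 1 = hop S x)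
    (h3 : hop S x ≠ 2) (hx : x ∈ S) : y ∈ S := by
  have := W.two_le x hx
  exact W.mem_of_hop y (by omega)

theorem low_root (W : WellLevelled S) {x y : Lat} (hx : x ∈ S) (hxy : hexGraph.Adj x y)
    (h1 : hop S y = 1) : y = p1 ∨ y = p2 := by
  have hr := W.row x hx
  rw [adj_iff] at hxy
  rcases W.hop_one y h1 with rfl | rfl | rfl | rfl | rfl | rfl
  · exact Or.inl rfl
  · exact Or.inr rfl
  all_goals
    simp only [p3, p4, p5, p6] at hxy
    omega

theorem ribbonOf_low_eq (W : WellLevelled S) {x y z : Lat} (hx : x ∈ S) (h3 : hop S x ≠ 2)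
    (hxy : hexGraph.Adj x y) (hxz : hexGraph.Adj x z) (hy : hop S y + 1 = hop S x)
    (hz : hop S z + 1 = hop S x) : ribbonOf S y = ribbonOf S z := by
  rcases W.clique x hx y z hxy hxz hy hz with rfl | h
  · rfl
  · exact ribbonOf_eq_of_adj (W.mem_of_low hz h3 hx) (W.mem_of_low hy h3 hx) h.symm (by omega)

theorem liesUnder_ribbonOf (W : WellLevelled S) {x y : Lat} (hx : x ∈ S) (h3 : hop S x ≠ 2)
    (hxy : hexGraph.Adj x y) (hy : hop S y + 1 = hop S x) :
    LiesUnder S (ribbonOf S y) (ribbonOf S x) := by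
  have hyS := W.mem_of_low hy h3 hx
  refine ⟨⟨hop S y, fun z hz => (mem_of_mem_ribbonOf hyS hz).2,
    fun z hz => (mem_of_mem_ribbonOf hx hz).2.trans hy.symm⟩, fun z hz => ?_⟩
  suffices h : ∀ w, hexGraph.Adj z w → hop S w + 1 = hop S z → ribbonOf S w = ribbonOf S y by
    obtain ⟨w, hw, h1⟩ := W.low z (mem_of_mem_ribbonOf hx hz).1
    exact ⟨w, h w hw h1 ▸ mem_ribbonOf_self S w, hw⟩
  obtain ⟨p⟩ := hz
  induction p generalizing y with
  | nil => exact fun w hw h1 => W.ribbonOf_low_eq hx h3 hw hxy h1 hy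
  | @cons x x' z h _ ih =>
    obtain ⟨v, h1, h2, h4⟩ := W.tri x h.2.1 x' h.2.2.1 h.1 h.2.2.2
    have h5 := h.2.2.2
    rw [W.ribbonOf_low_eq hx h3 hxy h1 hy h4]
    exact ih h.2.2.1 (by omega) h2 (by omega) (W.mem_of_low h4 h3 hx)

theorem liesUnder_rootRibbon (W : WellLevelled S) {x : Lat} (hx : x ∈ S) (h2 : hop S x = 2) :
    LiesUnder S rootRibbon (ribbonOf S x) := by
  refine ⟨⟨1, ?_, fun z hz => (mem_of_mem_ribbonOf hx hz).2.trans h2⟩, fun z hz => ?_⟩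
  · rintro z (rfl | rfl)
    exacts [W.hop_p2, W.hop_p1]
  · obtain ⟨h3, h4⟩ := mem_of_mem_ribbonOf hx hz
    obtain ⟨y, h5, h6⟩ := W.low z h3
    rcases W.low_root h3 h5 (by omega) with rfl | rfl
    exacts [⟨p1, Or.inr rfl, h5⟩, ⟨p2, Or.inl rfl, h5⟩]

theorem exists_liesUnder (W : WellLevelled S) {x y : Lat} (hx : x ∈ S)
    (hxy : hexGraph.Adj x y) (hy : hop S y + 1 = hop S x) :
    ∃ Q, (IsRibbon S Q ∨ Q = rootRibbon) ∧ LiesUnder S Q (ribbonOf S x) ∧ y ∈ Q := by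
  by_cases h2 : hop S x = 2
  · refine ⟨rootRibbon, Or.inr rfl, W.liesUnder_rootRibbon hx h2, ?_⟩
    rcases W.low_root hx hxy (by omega) with rfl | rfl
    exacts [Or.inr rfl, Or.inl rfl]
  · exact ⟨ribbonOf S y, Or.inl ⟨y, W.mem_of_low hy h2 hx, rfl⟩,
      W.liesUnder_ribbonOf hx h2 hxy hy, mem_ribbonOf_self S y⟩

theorem isParent (W : WellLevelled S) {x y : Lat} (hx : x ∈ S) (hyS : y ∈ S)
    (hxy : hexGraph.Adj x y) (hy : hop S y + 1 = hop S x) :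
    IsParent S (ribbonOf S y) (ribbonOf S x) := by
  have := W.two_le y hyS
  exact ⟨⟨y, hyS, rfl⟩, ⟨x, hx, rfl⟩, W.liesUnder_ribbonOf hx (by omega) hxy hy⟩

/-! ### Arcs -/

theorem arc_iff (W : WellLevelled S) {x x' : Lat} (hx : x ∈ S) : Arc S x x' ↔
    x' ∈ S ∧ hop S x' = hop S x ∧ ∃ y, hexGraph.Adj x y ∧ hop S y + 1 = hop S x ∧ x' = rot y x := by
  have := W.two_le x hx
  constructor
  · rintro ⟨-, h1, -, h2, y, h3, h4, h5⟩
    exact ⟨h1, h2, y, h3.symm, by omega, h5⟩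
  · rintro ⟨h1, h2, y, h3, h4, h5⟩
    exact ⟨hx, h1, by omega, h2, y, h3.symm, by omega, h5⟩

theorem arc_unique (W : WellLevelled S) {x x₁ x₂ : Lat} (h₁ : Arc S x x₁) (h₂ : Arc S x x₂) :
    x₁ = x₂ := by
  have hx : x ∈ S := h₁.1
  obtain ⟨-, h3, y, h4, h5, rfl⟩ := (W.arc_iff hx).1 h₁
  obtain ⟨-, h3', y', h4', h5', rfl⟩ := (W.arc_iff hx).1 h₂
  rcases W.clique x hx y y' h4 h4' h5 h5' with rfl | h
  · rfl
  · rcases rot_eq_or h4 h4' h with rfl | rfl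
    · rw [rot_rot'] at h3'; omega
    · rw [rot_rot'] at h3; omega

theorem arc_or_arc (W : WellLevelled S) {x z : Lat} (hx : x ∈ S) (hz : z ∈ S)
    (hxz : hexGraph.Adj x z) (h : hop S x = hop S z) : Arc S x z ∨ Arc S z x := by
  obtain ⟨y, h1, h2, h3⟩ := W.tri x hx z hz hxz h
  rcases rot_eq_or h1.symm h2.symm hxz with h4 | h4
  · exact Or.inl ((W.arc_iff hx).2 ⟨hz, h.symm, y, h1, h3, h4.symm⟩)
  · exact Or.inr ((W.arc_iff hz).2 ⟨hx, h, y, h2, by omega, h4.symm⟩)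

theorem arc_mem_ribbonOf (W : WellLevelled S) {x x' : Lat} (h : Arc S x x') :
    x' ∈ ribbonOf S x ∧ hexGraph.Adj x x' := by
  obtain ⟨h1, h2, y, h3, -, h5⟩ := (W.arc_iff h.1).1 h
  have hadj : hexGraph.Adj x x' := h5 ▸ adj_rot' h3.symm
  exact ⟨SimpleGraph.Adj.reachable (G := levelGraph S) ⟨hadj, h.1, h1, h2.symm⟩, hadj⟩

theorem isFirstVertex_iff (W : WellLevelled S) {R : Set Lat} (hR : IsRibbon S R) {x : Lat} :
    IsFirstVertex S R x ↔ x ∈ R ∧ ∀ x', ¬ Arc S x x' := by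
  refine and_congr_right fun hx => ?_
  obtain ⟨hxS, rfl⟩ := hR.eq_ribbonOf hx
  constructor
  · intro h x' hx'
    obtain ⟨h1, h2⟩ := W.arc_mem_ribbonOf hx'
    have := h x' h1 (Relation.ReflTransGen.single hx')
    exact hexGraph.loopless.irrefl _ (this ▸ h2)
  · intro h y _ hxy
    rcases Relation.ReflTransGen.cases_head hxy with h1 | ⟨z, h1, -⟩
    exacts [h1.symm, absurd h1 (h z)]

theorem isFirstVertex_unique (W : WellLevelled S) {R : Set Lat} (hR : IsRibbon S R) {x z : Lat}
    (hx : IsFirstVertex S R x) (hz : IsFirstVertex S R z) : x = z := by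
  rw [W.isFirstVertex_iff hR] at hx
  obtain ⟨hxS, rfl⟩ := hR.eq_ribbonOf hx.1
  suffices h : ∀ y ∈ ribbonOf S x, RibbonInFront S x y from hz.2 x hx.1 (h z hz.1)
  rintro y ⟨w⟩
  obtain ⟨w, rfl⟩ : ∃ w', w = SimpleGraph.Walk.reverse w' := ⟨w.reverse, by simp⟩
  clear hz hR hxS
  induction w with
  | nil => exact .refl
  | @cons y u x h _ ih =>
    have ih := ih hx
    rcases W.arc_or_arc h.2.1 h.2.2.1 h.1 h.2.2.2 with h1 | h1
    · exact .head h1 ih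
    · rcases Relation.ReflTransGen.cases_head ih with rfl | ⟨v, h2, h3⟩
      · exact absurd h1 (hx.2 y)
      · rw [W.arc_unique h1 h2]; exact h3

/-! ### Merging points -/

/-- A neighbour clockwise after a lower neighbour is lower, in front, or outside. -/
theorem low_of_no_arc (W : WellLevelled S) {x y : Lat} (hx : x ∈ S) (hno : ∀ x', ¬ Arc S x x')
    (hxy : hexGraph.Adj x y) (hy : hop S y + 1 = hop S x) (hq : rot y x ∈ hopDomain S) :
    hop S (rot y x) + 1 = hop S x := by
  have h2 := W.two_le x hx
  have hadj : hexGraph.Adj x (rot y x) := adj_rot' hxy.symm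
  have hlip := W.lip x hx _ hq hadj
  by_cases hqS : rot y x ∈ S
  · have h3 := W.lip _ hqS y (W.mem_hopDomain (by omega)) (adj_rot hxy.symm).symm
    by_contra hne
    exact hno _ ((W.arc_iff hx).2 ⟨hqS, by omega, y, hxy, hy, rfl⟩)
  · have := W.hop_lt_two hqS
    omega

theorem exists_exit (W : WellLevelled S) {x : Lat} (hx : x ∈ S) (hno : ∀ x', ¬ Arc S x x') :
    ∃ y, hexGraph.Adj x y ∧ hop S y + 1 = hop S x ∧ rot y x ∉ hopDomain S := by
  obtain ⟨y, h1, h2⟩ := W.low x hx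
  by_cases hq : rot y x ∈ hopDomain S
  · have h3 := W.low_of_no_arc hx hno h1 h2 hq
    have h4 : hexGraph.Adj x (rot y x) := adj_rot' h1.symm
    refine ⟨rot y x, h4, h3, fun hq' => ?_⟩
    have h5 := W.low_of_no_arc hx hno h4 h3 hq'
    have h6 : hexGraph.Adj x (rot (rot y x) x) := adj_rot' h4.symm
    have := W.clique x hx y _ h1 h6 h2 h5
    rw [adj_iff] at this h1
    simp only [lat_eq_iff, rot_fst, rot_snd] at this
    omega
  · exact ⟨y, h1, h2, hq⟩

theorem isMergingPoint_of_exit (W : WellLevelled S) {x y m : Lat}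
    (hx : IsFirstVertex S (ribbonOf S x) x) (hxS : x ∈ S) (hm : m ∉ S) (hxm : hexGraph.Adj x m)
    (hxy : hexGraph.Adj x y) (hym : hexGraph.Adj y m) (hy : hop S y + 1 = hop S x) :
    IsMergingPoint S (ribbonOf S x) m := by
  obtain ⟨Q, h1, h2, h3⟩ := W.exists_liesUnder hxS hxy hy
  exact ⟨hm, x, hx, hxm.symm, Q, h1, h2, y, h3, hxy.symm, hym⟩

/-- A point of the shape without a point in front which has two lower neighbours is not in the
lowest ribbon. -/
theorem low_mem_of_no_arc (W : WellLevelled S) {x y z : Lat} (hx : x ∈ S)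
    (hno : ∀ x', ¬ Arc S x x') (hxy : hexGraph.Adj x y) (hxz : hexGraph.Adj x z)
    (hy : hop S y + 1 = hop S x) (hz : hop S z + 1 = hop S x) (hne : y ≠ z) : y ∈ S := by
  refine W.mem_of_low hy (fun h2 => ?_) hx
  have hy' := W.low_root hx hxy (by omega)
  have hz' := W.low_root hx hxz (by omega)
  have hx' : x = (-1, 2) := by
    rw [adj_iff] at hxy hxz
    have := W.hop_two x hx h2
    simp only [p1, p2, lat_eq_iff, ne_eq] at *
    omega
  subst hx'
  have hadj : hexGraph.Adj (0, 2) p2 := by rw [adj_iff]; simp [p2]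
  have h3 := W.lip _ W.right_mem p2 (Or.inr (by simp)) hadj
  have h4 := W.two_le _ W.right_mem
  have h5 := W.hop_p2
  refine hno (0, 2) ((W.arc_iff hx).2 ⟨W.right_mem, by omega, p2, ?_, by omega, ?_⟩)
  · rw [adj_iff]; simp [p2]
  · rw [lat_eq_iff, rot_fst, rot_snd]; simp [p2]

theorem existsUnique_isMergingPoint (W : WellLevelled S) {R : Set Lat} (hR : IsRibbon S R)
    (hlen : 2 ≤ R.ncard) {x : Lat} (hx : IsFirstVertex S R x) :
    ∃! m, IsMergingPoint S R m := by
  have hx' := (W.isFirstVertex_iff hR).1 hx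
  obtain ⟨hxS, rfl⟩ := hR.eq_ribbonOf hx.1
  have hno := hx'.2
  obtain ⟨y, h1, h2, h3⟩ := W.exists_exit hxS hno
  refine ⟨rot y x, W.isMergingPoint_of_exit hx hxS (fun h => h3 (Or.inl h)) (adj_rot' h1.symm) h1
    (adj_rot h1.symm) h2, ?_⟩
  rintro m ⟨hm, x', hx'', hmx, Q, -, ⟨⟨k, hQk, hRk⟩, -⟩, y', hy', hyx', hym'⟩
  obtain rfl := W.isFirstVertex_unique hR hx hx''
  have hlow : hop S y' + 1 = hop S x := by rw [hQk y' hy', hRk x hx.1]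
  rcases rot_eq_or hyx' hym' hmx.symm with h4 | h4
  · rcases W.clique x hxS y y' h1 hyx'.symm h2 hlow with rfl | h5
    · exact h4.symm
    · rcases rot_eq_or h1 hyx'.symm h5 with rfl | rfl
      · rw [rot_rot'] at h4
        subst h4
        exact absurd (W.low_mem_of_no_arc hxS hno h1 hyx'.symm h2 hlow h5.ne) hm
      · have h2x := W.two_le x hxS
        rw [rot_rot'] at h3
        exact absurd (W.mem_hopDomain (by omega)) h3
  · obtain ⟨z, hz, hzx⟩ : ∃ z, z ∈ S ∧ Arc S z x := by
      obtain ⟨u, hu, hne⟩ := Set.exists_ne_of_one_lt_ncard (s := ribbonOf S x) (by omega) x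
      obtain ⟨w⟩ := hu
      cases w with
      | nil => exact absurd rfl hne
      | @cons _ z _ h _ =>
        exact ⟨z, h.2.2.1, (W.arc_or_arc h.2.1 h.2.2.1 h.1 h.2.2.2).resolve_left (hno z)⟩
    obtain ⟨-, h5, w, h6, h7, h8⟩ := (W.arc_iff hz).1 hzx
    have h9 : hexGraph.Adj x w := h8 ▸ (adj_rot h6.symm).symm
    rcases W.clique x hxS y' w hyx'.symm h9 hlow (by omega) with rfl | h10
    · have := rot_injective y' (h4.trans h8)
      exact absurd (this ▸ hz) hm
    · rcases rot_eq_or hyx'.symm h9 h10 with h11 | h11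
      · have h12 : rot y' w = x := by rw [← h11, rot_rot]
        have : w = m := rot_injective y' (h12.trans h4.symm)
        subst this
        exact absurd (W.low_mem_of_no_arc hxS hno h9 hyx'.symm (by omega) hlow h10.ne') hm
      · have h12 : rot w y' = x := by rw [← h11, rot_rot]
        have : y' = z := rot_injective w (h12.trans h8)
        subst this
        omega

end WellLevelled

/-! ### The points above a ribbon -/

/-- The points of a ribbon and of its descendants. -/
def subtree (S R : Set Lat) : Set Lat :=
  {c | c ∈ S ∧ (ribbonOf S c = R ∨ IsAncestor S R (ribbonOf S c))}

theorem subtree_subset {Q R : Set Lat} (h : IsAncestor S Q R) : subtree S R ⊆ subtree S Q := by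
  rintro c ⟨h1, rfl | h2⟩
  · exact ⟨h1, Or.inr h⟩
  · exact ⟨h1, Or.inr (Relation.TransGen.trans h h2)⟩

theorem IsRibbon.subset_subtree {R : Set Lat} (hR : IsRibbon S R) : R ⊆ subtree S R := fun _ hc =>
  ⟨(hR.eq_ribbonOf hc).1, Or.inl (hR.eq_ribbonOf hc).2⟩

/-- The positions of the robots of the shape and of the seed robots. -/
abbrev formation (S : Set Lat) : Set Lat := S ∪ seeds

theorem mem_seeds_iff (x : Lat) : x ∈ seeds ↔ x = O ∨ x = p1 ∨ x = p2 ∨ x = p4 ∨ x = p5 := Iff.rfl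

theorem formation_subset (S : Set Lat) : formation S ⊆ hopDomain S := by
  rintro x (hx | hx)
  · exact Or.inl hx
  · right
    rcases hx with rfl | rfl | rfl | rfl | rfl <;> simp

namespace WellLevelled

theorem low_of_leave (W : WellLevelled S) {R : Set Lat} {c d : Lat} (hc : c ∈ subtree S R)
    (hd : d ∈ hopDomain S) (hcd : hexGraph.Adj c d) (hdR : d ∉ subtree S R) :
    ribbonOf S c = R ∧ hop S d + 1 = hop S c := by
  obtain ⟨hcS, hcR⟩ := hc
  have hlip := W.lip c hcS d hd hcd
  have hc2 := W.two_le c hcS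
  have hlow : hop S d + 1 = hop S c := by
    by_cases hdS : d ∈ S
    · rcases (by omega : hop S c = hop S d ∨ hop S c + 1 = hop S d ∨ hop S d + 1 = hop S c)
        with h | h | h
      · refine absurd ⟨hdS, ?_⟩ hdR
        rwa [ribbonOf_eq_of_adj hcS hdS hcd h]
      · refine absurd ⟨hdS, Or.inr ?_⟩ hdR
        have hp := W.isParent hdS hcS hcd.symm h
        rcases hcR with rfl | h'
        exacts [Relation.TransGen.single hp, Relation.TransGen.tail h' hp]
      · exact h
    · have := W.hop_lt_two hdS
      omega
  refine ⟨?_, hlow⟩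
  by_contra hne
  have hanc := hcR.resolve_left hne
  obtain ⟨Q, hRQ, hQ, -, ⟨k, hQk, hk⟩, hall⟩ : ∃ Q, (Q = R ∨ IsAncestor S R Q) ∧
      IsParent S Q (ribbonOf S c) := by
    rcases Relation.TransGen.tail'_iff.1 hanc with ⟨Q, h1, h2⟩
    rcases Relation.reflTransGen_iff_eq_or_transGen.1 h1 with h3 | h3
    exacts [⟨Q, Or.inl h3, h2⟩, ⟨Q, Or.inr h3, h2⟩]
  obtain ⟨y, hy, hcy⟩ := hall c (mem_ribbonOf_self S c)
  obtain ⟨hyS, rfl⟩ := hQ.eq_ribbonOf hy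
  have hyk := hQk y hy
  have hck := hk c (mem_ribbonOf_self S c)
  have hy2 := W.two_le y hyS
  have hdS : d ∈ S := W.mem_of_hop d (by omega)
  refine hdR ⟨hdS, ?_⟩
  rwa [W.ribbonOf_low_eq hcS (by omega) hcd hcy hlow (by omega)]

/-- The tour around the formation leaves the points above a ribbon only at the merging point. -/
theorem exit_subtree (W : WellLevelled S) {R : Set Lat} {e : Lat × Lat}
    (he : e ∈ boundaryEdges (formation S)) (hc : e.1 ∈ subtree S R)
    (hleave : (traceStep (formation S) e).1 ∉ subtree S R) :
    IsFirstVertex S R e.1 ∧ IsMergingPoint S R e.2 ∧ rot e.1 e.2 ∈ formation S := by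
  obtain ⟨c, v⟩ := e
  obtain ⟨h1, h2, h3⟩ := he
  dsimp only at *
  have hcS := hc.1
  have hrow := W.row c hcS
  by_cases hd : rot c v ∈ formation S
  swap
  · rw [traceStep_of_notMem hd] at hleave
    exact absurd hc hleave
  rw [traceStep_of_mem hd] at hleave
  have hcd : hexGraph.Adj c (rot c v) := adj_rot h3
  obtain ⟨rfl, hlow⟩ := W.low_of_leave hc (formation_subset S hd) hcd hleave
  have hvS : v ∉ S := fun h => h2 (Or.inl h)
  have hno : ∀ x', ¬ Arc S c x' := by
    intro x' hx'
    obtain ⟨h4, h5, w, h6, h7, h8⟩ := (W.arc_iff hcS).1 hx'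
    rcases W.clique c hcS w _ h6 hcd h7 hlow with rfl | h9
    · rw [rot_rot'] at h8
      exact hvS (h8 ▸ h4)
    · rcases rot_eq_or h6 hcd h9 with h10 | h10
      · obtain rfl := rot_injective c h10
        have h11 := W.hop_lt_two hvS
        have h12 := W.two_le c hcS
        rcases W.low_root hcS h6 (by omega) with rfl | rfl
        · exact h2 (Or.inr (Or.inr (Or.inl rfl)))
        · exact h2 (Or.inr (Or.inr (Or.inr (Or.inl rfl))))
      · have h11 : rot w c = rot c v := by
          rw [← h10, rot_rot']
        rw [← h8.trans h11] at hlow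
        omega
  have hfirst : IsFirstVertex S (ribbonOf S c) c :=
    (W.isFirstVertex_iff ⟨c, hcS, rfl⟩).2 ⟨mem_ribbonOf_self S c, hno⟩
  exact ⟨hfirst, W.isMergingPoint_of_exit hfirst hcS hvS h3 hcd (adj_rot' h3).symm hlow, hd⟩

theorem exists_boundaryEdge (W : WellLevelled S) (hfin : S.Finite) {R : Set Lat}
    (hR : IsRibbon S R) : ∃ e ∈ boundaryEdges (formation S), e.1 ∈ subtree S R := by
  obtain ⟨x, hx, rfl⟩ := hR
  have hsub : (subtree S (ribbonOf S x)).Finite := hfin.subset fun c hc => hc.1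
  obtain ⟨c, hc, hmax⟩ := Set.exists_max_image _ (fun c : Lat => c.1 + 2 * c.2) hsub
    ⟨x, hx, Or.inl rfl⟩
  have key : ∀ d : Lat, hexGraph.Adj c d → c.1 + 2 * c.2 < d.1 + 2 * d.2 → d ∈ formation S →
      hop S d + 1 = hop S c := fun d h1 h2 h3 =>
    (W.low_of_leave hc (formation_subset S h3) h1 fun h => absurd (hmax d h) (by omega)).2
  have a1 : hexGraph.Adj c (c.1 + 1, c.2) := by rw [adj_iff]; simp
  have a2 : hexGraph.Adj c (c.1 - 1, c.2 + 1) := by rw [adj_iff]; simp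
  by_cases h1 : (c.1 + 1, c.2) ∈ formation S
  · by_cases h2 : (c.1 - 1, c.2 + 1) ∈ formation S
    · have := W.clique c hc.1 _ _ a1 a2 (key _ a1 (by dsimp only; omega) h1)
        (key _ a2 (by dsimp only; omega) h2)
      rw [adj_iff, lat_eq_iff] at this
      dsimp only at this
      omega
    · exact ⟨(c, _), ⟨Or.inl hc.1, h2, a2⟩, hc⟩
  · exact ⟨(c, _), ⟨Or.inl hc.1, h1, a1⟩, hc⟩

end WellLevelled

end Ribbons

/-! ### The formation and its boundary -/

section Formation

variable {S : Set Lat}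

theorem notMem_formation (W : WellLevelled S) {x : Lat} (hrow : x.2 ≤ 1) (h : x ∉ seeds) :
    x ∉ formation S := by
  rintro (h' | h')
  · have := W.row x h'
    omega
  · exact h h'

theorem mem_formation_of_eq (W : WellLevelled S) {x : Lat}
    (h : x = O ∨ x = p1 ∨ x = p2 ∨ x = p4 ∨ x = p5 ∨ x = (-2, 2) ∨ x = (-1, 2) ∨ x = (0, 2)) :
    x ∈ formation S := by
  rcases h with rfl | rfl | rfl | rfl | rfl | rfl | rfl | rfl
  exacts [Or.inr (by simp [seeds]), Or.inr (by simp [seeds]), Or.inr (by simp [seeds]),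
    Or.inr (by simp [seeds]), Or.inr (by simp [seeds]), Or.inl W.left_mem, Or.inl W.mid_mem,
    Or.inl W.right_mem]

theorem mem_formation_of_region (W : WellLevelled S) {x : Lat}
    (h : (x.2 = 0 ∧ x.1 = 0) ∨ (x.2 = 1 ∧ -1 ≤ x.1 ∧ x.1 ≤ 0) ∨ (x.2 = -1 ∧ 0 ≤ x.1 ∧ x.1 ≤ 1) ∨
      (x.2 = 2 ∧ -2 ≤ x.1 ∧ x.1 ≤ 0)) : x ∈ formation S := by
  apply mem_formation_of_eq W
  simp only [O, p1, p2, p4, p5, lat_eq_iff]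
  rcases h with h | h | h | h <;> omega

theorem region_of_mem_seeds {x : Lat} (h : x ∈ seeds) :
    (x.2 = 0 ∧ x.1 = 0) ∨ (x.2 = 1 ∧ -1 ≤ x.1 ∧ x.1 ≤ 0) ∨ (x.2 = -1 ∧ 0 ≤ x.1 ∧ x.1 ≤ 1) := by
  rcases h with rfl | rfl | rfl | rfl | rfl <;> simp [O, p1, p2, p4, p5]

theorem connected_formation (W : WellLevelled S) (hconn : (hexGraph.induce S).Connected) :
    ∀ x ∈ formation S, ∀ y ∈ formation S, Relation.ReflTransGen
      (fun x y => hexGraph.Adj x y ∧ x ∈ formation S ∧ y ∈ formation S) x y := by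
  set r : Lat → Lat → Prop := fun x y => hexGraph.Adj x y ∧ x ∈ formation S ∧ y ∈ formation S
  have gsymm : ∀ {x y}, Relation.ReflTransGen r x y → Relation.ReflTransGen r y x := by
    intro x y h
    induction h with
    | refl => exact .refl
    | tail _ h ih => exact .head ⟨h.1.symm, h.2.2, h.2.1⟩ ih
  have hO : O ∈ formation S := mem_formation_of_eq W (by simp)
  have h1 : p1 ∈ formation S := mem_formation_of_eq W (by simp)
  have hp1 : Relation.ReflTransGen r p1 O :=
    .single ⟨by rw [adj_iff]; simp [p1, O], h1, hO⟩
  have key : ∀ x ∈ formation S, Relation.ReflTransGen r x O := by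
    rintro x (hx | hx)
    · have h2 := reflTransGen_of_reachable_induce
        (hconn.preconnected ⟨x, hx⟩ ⟨(-2, 2), W.left_mem⟩)
      have h3 : Relation.ReflTransGen r x (-2, 2) :=
        Relation.ReflTransGen.mono (fun a b h => ⟨h.1, Or.inl h.2.1, Or.inl h.2.2⟩) _ _ h2
      refine (h3.tail ⟨?_, Or.inl W.left_mem, h1⟩).trans hp1
      rw [adj_iff]; simp [p1]
    · by_cases hxO : x = O
      · rw [hxO]
      · refine .single ⟨?_, Or.inr hx, hO⟩
        rw [mem_seeds_iff] at hx
        rw [adj_iff]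
        simp only [O, p1, p2, p4, p5, lat_eq_iff] at *
        omega
  exact fun x hx y hy => (key x hx).trans (gsymm (key y hy))

theorem coConnected_formation (W : WellLevelled S) (h : CoConnected (hopDomain S)) :
    CoConnected (formation S) := by
  set r : Lat → Lat → Prop := fun x y => hexGraph.Adj x y ∧ x ∉ formation S ∧ y ∉ formation S
  have sub : ∀ x, x ∉ hopDomain S → x ∉ formation S := fun x hx h' => hx (formation_subset S h')
  have lift : ∀ x ∉ hopDomain S, ∀ y ∉ hopDomain S, Relation.ReflTransGen r x y :=
    fun x hx y hy => Relation.ReflTransGen.mono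
      (fun a b h => ⟨h.1, sub a h.2.1, sub b h.2.2⟩) _ _ (h x hx y hy)
  have out : ∀ x : Lat, x ∉ formation S → ∃ y, y ∉ hopDomain S ∧ Relation.ReflTransGen r x y ∧
      Relation.ReflTransGen r y x := by
    intro x hx
    by_cases hx' : x ∈ hopDomain S
    · have hx3 : x = p3 ∨ x = p6 := by
        rcases hx' with h' | h'
        · exact absurd (Or.inl h') hx
        · have : x ∉ seeds := fun h => hx (Or.inr h)
          rw [mem_seeds_iff] at this
          simp only [Set.mem_insert_iff, Set.mem_singleton_iff] at h'
          tauto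
      obtain ⟨y, hxy, hy⟩ : ∃ y, hexGraph.Adj x y ∧ y ∉ hopDomain S := by
        have far : ∀ y : Lat, y = (2, 0) ∨ y = (-2, 0) → y ∉ hopDomain S := by
          rintro y hy (h' | h')
          · have := W.row y h'
            simp only [lat_eq_iff] at hy
            omega
          · rw [mem_hexagon_iff] at h'
            simp only [lat_eq_iff] at hy
            omega
        rcases hx3 with rfl | rfl
        · exact ⟨(2, 0), by rw [adj_iff]; simp [p3], far _ (Or.inl rfl)⟩
        · exact ⟨(-2, 0), by rw [adj_iff]; simp [p6], far _ (Or.inr rfl)⟩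
      exact ⟨y, hy, .single ⟨hxy, hx, sub y hy⟩, .single ⟨hxy.symm, sub y hy, hx⟩⟩
    · exact ⟨x, hx', .refl, .refl⟩
  intro x hx y hy
  obtain ⟨x', hx', h1, -⟩ := out x hx
  obtain ⟨y', hy', -, h2⟩ := out y hy
  exact (h1.trans (lift x' hx' y' hy')).trans h2

/-- Two robots of the formation opposite to each other have a robot in between. -/
theorem mem_formation_of_opposite (W : WellLevelled S)
    (hsm : ∀ x ∈ S, ∀ y ∈ S, sqLen (x - y) = 4 →
      ∀ z, hexGraph.Adj x z → hexGraph.Adj y z → z ∈ S) {v c d : Lat} (hvc : hexGraph.Adj v c)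
    (hc : c ∈ formation S) (hd : d ∈ formation S) (h1 : c.1 + d.1 = 2 * v.1)
    (h2 : c.2 + d.2 = 2 * v.2) : v ∈ formation S := by
  have hvd : hexGraph.Adj v d := by
    rw [adj_iff] at *
    omega
  have mixed : ∀ {c d : Lat}, c ∈ S → d ∈ seeds → hexGraph.Adj v c → hexGraph.Adj v d →
      c.1 + d.1 = 2 * v.1 → c.2 + d.2 = 2 * v.2 → v ∈ formation S := by
    intro c d hc hd h1 h2 h3 h4
    have hrow := W.row c hc
    apply mem_formation_of_region W
    have hd' := region_of_mem_seeds hd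
    rw [adj_iff] at h2
    clear hvc hvd h1
    rcases h2 with h | h | h | h | h | h <;> omega
  rcases hc with hc | hc <;> rcases hd with hd | hd
  · refine Or.inl (hsm c hc d hd ?_ v hvc.symm hvd.symm)
    have h4 : sqLen (v - c) = 1 := hvc
    simp only [sqLen, Prod.fst_sub, Prod.snd_sub] at h4 ⊢
    have e1 : d.1 = 2 * v.1 - c.1 := by omega
    have e2 : d.2 = 2 * v.2 - c.2 := by omega
    rw [e1, e2]
    linear_combination 4 * h4
  · exact mixed hc hd hvc hvd h1 h2
  · exact mixed hd hc hvd hvc (by omega) (by omega)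
  · apply mem_formation_of_region W
    have hc' := region_of_mem_seeds hc
    have hd' := region_of_mem_seeds hd
    rw [adj_iff] at hvc
    clear hvd
    rcases hvc with h | h | h | h | h | h <;> omega

instance (x : Lat) : Decidable (x ∈ seeds) :=
  decidable_of_iff (x ∈ ({O, p1, p2, p4, p5} : Finset Lat)) (by simp [seeds])

/-- The seed positions together with the three points above `p1` and `p2`. -/
def baseRegion : Finset Lat := {O, p1, p2, p4, p5, (-2, 2), (-1, 2), (0, 2)}

theorem baseRegion_of_clockwise {v c : Lat} (hvc : hexGraph.Adj v c) (hc : c ∈ seeds)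
    (hd : 2 ≤ (rot v (rot v c)).2 ∨ rot v (rot v c) ∈ seeds) :
    v ∈ baseRegion ∨ rot v c ∈ baseRegion := by
  obtain ⟨i, j⟩ := v
  replace hvc := hvc.symm
  rw [adj_iff] at hvc
  revert hd
  rcases hc with rfl | rfl | rfl | rfl | rfl <;>
    rcases hvc with ⟨h, h'⟩ | ⟨h, h'⟩ | ⟨h, h'⟩ | ⟨h, h'⟩ | ⟨h, h'⟩ | ⟨h, h'⟩ <;>
    dsimp only at h h' <;> subst h <;> subst h' <;> decide

theorem baseRegion_of_counterclockwise {v c : Lat} (hvc : hexGraph.Adj v c)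
    (hd : rot v (rot v c) ∈ seeds) (hc : 2 ≤ c.2 ∨ c ∈ seeds) :
    v ∈ baseRegion ∨ rot v c ∈ baseRegion := by
  obtain ⟨d, hd', hvd, h1, h2⟩ : ∃ d ∈ seeds, hexGraph.Adj d v ∧
      c = rot v (rot v (rot v (rot v d))) ∧ rot v c = rot v (rot v (rot v (rot v (rot v d)))) := by
    refine ⟨_, hd, (adj_rot (adj_rot hvc)).symm, ?_, ?_⟩ <;>
    · simp only [lat_eq_iff, rot_fst, rot_snd]
      omega
  rw [h2]
  rw [h1] at hc
  clear hd h1 h2 hvc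
  obtain ⟨i, j⟩ := v
  rw [adj_iff] at hvd
  revert hc
  rcases hd' with rfl | rfl | rfl | rfl | rfl <;>
    rcases hvd with ⟨h, h'⟩ | ⟨h, h'⟩ | ⟨h, h'⟩ | ⟨h, h'⟩ | ⟨h, h'⟩ | ⟨h, h'⟩ <;>
    dsimp only at h h' <;> subst h <;> subst h' <;> decide

theorem mem_formation_of_baseRegion (W : WellLevelled S) {x : Lat} (h : x ∈ baseRegion) :
    x ∈ formation S := by
  apply mem_formation_of_eq W
  simpa [baseRegion] using h

/-- Two robots of the formation at distance `√3` have a common neighbouring robot. -/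
theorem mem_formation_of_sqrt_three (W : WellLevelled S)
    (hsm : ∀ x ∈ S, ∀ y ∈ S, sqLen (x - y) = 3 →
      ∃ z ∈ S, hexGraph.Adj x z ∧ hexGraph.Adj y z) {v c : Lat} (hvc : hexGraph.Adj v c)
    (hc : c ∈ formation S) (hd : rot v (rot v c) ∈ formation S) (hv : v ∉ formation S) :
    rot v c ∈ formation S := by
  have e1 : (rot v (rot v c)).1 = v.1 + c.2 - v.2 := by simp only [rot_fst, rot_snd]; ring
  have e2 : (rot v (rot v c)).2 = 2 * v.2 + v.1 - c.1 - c.2 := by simp only [rot_fst, rot_snd]; ring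
  set d := rot v (rot v c) with hd'
  have seed : c ∈ seeds ∨ d ∈ seeds → rot v c ∈ formation S := by
    intro h
    suffices h' : v ∈ formation S ∨ rot v c ∈ formation S from h'.resolve_left hv
    refine Or.imp (mem_formation_of_baseRegion W) (mem_formation_of_baseRegion W) ?_
    rcases h with h | h
    · exact baseRegion_of_clockwise hvc h (hd.imp_left (W.row d))
    · exact baseRegion_of_counterclockwise hvc h (hc.imp_left (W.row c))
  rcases hc with hcS | hc
  · rcases hd with hdS | hd
    · obtain ⟨z, hz, h1, h2⟩ := hsm c hcS d hdS (by
        have h4 : sqLen (v - c) = 1 := hvc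
        simp only [sqLen, Prod.fst_sub, Prod.snd_sub] at h4 ⊢
        rw [e1, e2]
        linear_combination 3 * h4)
      have : z = v ∨ z = rot v c := by
        rw [adj_iff] at hvc h1 h2
        simp only [lat_eq_iff, rot_fst, rot_snd]
        omega
      rcases this with rfl | rfl
      exacts [absurd (Or.inl hz) hv, Or.inl hz]
    · exact seed (Or.inr hd)
  · exact seed (Or.inl hc)

/-- The local form of smoothness: the robots around a free point form one chain of consecutive
neighbours. -/
structure Smooth (C : Set Lat) : Prop where
  opposite : ∀ v ∉ C, ∀ c ∈ C, ∀ d ∈ C, hexGraph.Adj v c →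
    c.1 + d.1 = 2 * v.1 → c.2 + d.2 = 2 * v.2 → False
  sqrt_three : ∀ v ∉ C, ∀ c ∈ C, hexGraph.Adj v c → rot v (rot v c) ∈ C → rot v c ∈ C

theorem ProperRibbonization.smooth_formation (hS : ProperRibbonization S) (W : WellLevelled S) :
    Smooth (formation S) where
  opposite := fun _ hv _ hc _ hd hvc h1 h2 =>
    hv (mem_formation_of_opposite W hS.smooth_two hvc hc hd h1 h2)
  sqrt_three := fun _ hv _ hc hvc hd =>
    mem_formation_of_sqrt_three W hS.smooth_sqrt_three hvc hc hd hv

/-- The relative positions of two neighbours of a lattice point. -/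
theorem adj_cases {v c d : Lat} (hvc : hexGraph.Adj v c) (hvd : hexGraph.Adj v d) :
    c = d ∨ d = rot c v ∨ c = rot d v ∨ d = rot v (rot v c) ∨ c = rot v (rot v d) ∨
      (c.1 + d.1 = 2 * v.1 ∧ c.2 + d.2 = 2 * v.2) := by
  rw [adj_iff] at hvc hvd
  simp only [lat_eq_iff, rot_fst, rot_snd]
  rcases hvc with g | g | g | g | g | g <;> rcases hvd with f | f | f | f | f | f <;>
    first
    | exact Or.inl (by omega)
    | exact Or.inr (Or.inl (by omega))
    | exact Or.inr (Or.inr (Or.inl (by omega)))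
    | exact Or.inr (Or.inr (Or.inr (Or.inl (by omega))))
    | exact Or.inr (Or.inr (Or.inr (Or.inr (Or.inl (by omega)))))
    | exact Or.inr (Or.inr (Or.inr (Or.inr (Or.inr (by omega)))))

/-- There is only one robot around which an arc of the tour starts at a given free point. -/
theorem Smooth.center_unique {C : Set Lat} (hC : Smooth C) {v c d : Lat} (hv : v ∉ C) (hc : c ∈ C)
    (hd : d ∈ C) (hvc : hexGraph.Adj v c) (hvd : hexGraph.Adj v d) (hc' : rot c v ∉ C)
    (hd' : rot d v ∉ C) : c = d := by
  rcases adj_cases hvc hvd with h | h | h | h | h | ⟨h1, h2⟩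
  · exact h
  · exact absurd (h ▸ hd) hc'
  · exact absurd (h ▸ hc) hd'
  · have h5 := hC.sqrt_three v hv c hc hvc (h ▸ hd)
    have h6 : rot d v = rot v c := by rw [h, rot_rot']
    exact absurd (h6 ▸ h5) hd'
  · have h5 := hC.sqrt_three v hv d hd hvd (h ▸ hc)
    have h6 : rot c v = rot v d := by rw [h, rot_rot']
    exact absurd (h6 ▸ h5) hc'
  · exact (hC.opposite v hv c hc d hd hvc h1 h2).elim

end Formation

/-! ### The tour from `p6` to `p3` -/

section Tour

variable {S : Set Lat}

/-- The successive boundary edges of the clockwise tour around the formation, from `p6` on. -/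
noncomputable def tour (S : Set Lat) (n : ℕ) : Lat × Lat := (traceStep (formation S))^[n] (p1, p6)

theorem tour_succ (S : Set Lat) (n : ℕ) : tour S (n + 1) = traceStep (formation S) (tour S n) :=
  Function.iterate_succ_apply' _ _ _

theorem tour_add (S : Set Lat) (m n : ℕ) :
    tour S (m + n) = (traceStep (formation S))^[m] (tour S n) :=
  Function.iterate_add_apply _ _ _ _

theorem tour_zero_mem (W : WellLevelled S) : tour S 0 ∈ boundaryEdges (formation S) := by
  refine ⟨mem_formation_of_eq W (by simp [tour]), notMem_formation W ?_ ?_, ?_⟩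
  · simp [tour, p6]
  · rw [mem_seeds_iff]; simp [tour, p6, O, p1, p2, p4, p5]
  · rw [adj_iff]; simp [tour, p1, p6]

theorem tour_mem (W : WellLevelled S) (n : ℕ) : tour S n ∈ boundaryEdges (formation S) :=
  iterate_mem (tour_zero_mem W) n

theorem rot_eq {a b i j k l : ℤ} (h1 : k = i + j - b) (h2 : l = b + a - i) :
    rot (a, b) (i, j) = (k, l) := by
  rw [lat_eq_iff, rot_fst, rot_snd]
  exact ⟨h1.symm, h2.symm⟩

/-- The tour along the lower half of the seed robots. -/
theorem trace_lower (W : WellLevelled S) :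
    traceStep (formation S) (p2, p3) = (O, p3) ∧ traceStep (formation S) (O, p3) = (p4, p3) ∧
    traceStep (formation S) (p4, p3) = (p4, (2, -1)) ∧
    traceStep (formation S) (p4, (2, -1)) = (p4, (2, -2)) ∧
    traceStep (formation S) (p4, (2, -2)) = (p4, (1, -2)) ∧
    traceStep (formation S) (p4, (1, -2)) = (p5, (1, -2)) ∧
    traceStep (formation S) (p5, (1, -2)) = (p5, (0, -2)) ∧
    traceStep (formation S) (p5, (0, -2)) = (p5, (-1, -1)) ∧
    traceStep (formation S) (p5, (-1, -1)) = (p5, p6) ∧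
    traceStep (formation S) (p5, p6) = (O, p6) ∧ traceStep (formation S) (O, p6) = (p1, p6) := by
  have piv : ∀ {c v w : Lat}, rot c v = w → w = O ∨ w = p1 ∨ w = p4 ∨ w = p5 →
      traceStep (formation S) (c, v) = (w, v) := by
    rintro c v w rfl h
    exact traceStep_of_mem (mem_formation_of_eq W (by tauto))
  have arc : ∀ {c v w : Lat}, rot c v = w → w.2 ≤ 1 → w ∉ seeds →
      traceStep (formation S) (c, v) = (c, w) := by
    rintro c v w rfl h1 h2
    exact traceStep_of_notMem (notMem_formation W h1 h2)
  have seeds' : ∀ {x : Lat}, x = (2, -1) ∨ x = (2, -2) ∨ x = (1, -2) ∨ x = (0, -2) ∨ x = (-1, -1) ∨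
      x = p6 → x.2 ≤ 1 ∧ x ∉ seeds := by
    intro x hx
    rw [mem_seeds_iff]
    simp only [O, p1, p2, p4, p5, p6, lat_eq_iff] at *
    omega
  refine ⟨piv (rot_eq ?_ ?_) (by simp), piv (rot_eq ?_ ?_) (by simp),
    arc (rot_eq ?_ ?_) (seeds' (by simp)).1 (seeds' (by simp)).2,
    arc (rot_eq ?_ ?_) (seeds' (by simp)).1 (seeds' (by simp)).2,
    arc (rot_eq ?_ ?_) (seeds' (by simp)).1 (seeds' (by simp)).2,
    piv (rot_eq ?_ ?_) (by simp),
    arc (rot_eq ?_ ?_) (seeds' (by simp)).1 (seeds' (by simp)).2,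
    arc (rot_eq ?_ ?_) (seeds' (by simp)).1 (seeds' (by simp)).2,
    arc (rot_eq ?_ ?_) (seeds' (by simp)).1 (seeds' (by simp)).2,
    piv (rot_eq ?_ ?_) (by simp), piv (rot_eq ?_ ?_) (by simp)⟩ <;> norm_num

/-- The seed robots that do not contribute to the affiliated path. -/
def lowerSeeds : Set Lat := {O, p4, p5}

theorem iterate_lower (W : WellLevelled S) :
    (traceStep (formation S))^[11] (p2, p3) = (p1, p6) ∧
    (∀ k, 1 ≤ k → k ≤ 10 → ((traceStep (formation S))^[k] (p2, p3)).1 ∈ lowerSeeds) ∧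
    ∀ e ∈ boundaryEdges (formation S), e.1 ∈ lowerSeeds →
      ∃ k, 1 ≤ k ∧ k ≤ 10 ∧ (traceStep (formation S))^[k] (p2, p3) = e := by
  obtain ⟨h1, h2, h3, h4, h5, h6, h7, h8, h9, h10, h11⟩ := trace_lower W
  have it : ∀ k e e', (traceStep (formation S))^[k] (p2, p3) = e → traceStep (formation S) e = e' →
      (traceStep (formation S))^[k + 1] (p2, p3) = e' := by
    rintro k e e' rfl rfl
    exact Function.iterate_succ_apply' _ _ _
  have i1 := it 0 _ _ rfl h1
  have i2 := it 1 _ _ i1 h2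
  have i3 := it 2 _ _ i2 h3
  have i4 := it 3 _ _ i3 h4
  have i5 := it 4 _ _ i4 h5
  have i6 := it 5 _ _ i5 h6
  have i7 := it 6 _ _ i6 h7
  have i8 := it 7 _ _ i7 h8
  have i9 := it 8 _ _ i8 h9
  have i10 := it 9 _ _ i9 h10
  refine ⟨it 10 _ _ i10 h11, ?_, ?_⟩
  · intro k hk1 hk2
    interval_cases k
    · rw [i1]; simp [lowerSeeds]
    · rw [i2]; simp [lowerSeeds]
    · rw [i3]; simp [lowerSeeds]
    · rw [i4]; simp [lowerSeeds]
    · rw [i5]; simp [lowerSeeds]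
    · rw [i6]; simp [lowerSeeds]
    · rw [i7]; simp [lowerSeeds]
    · rw [i8]; simp [lowerSeeds]
    · rw [i9]; simp [lowerSeeds]
    · rw [i10]; simp [lowerSeeds]
  · rintro ⟨c, v⟩ ⟨-, hv, hcv⟩ hc
    dsimp only at hv hcv hc
    have hv' : v ∉ seeds := fun h => hv (Or.inr h)
    have hcases : (c = O ∧ v = p3) ∨ (c = p4 ∧ v = p3) ∨ (c = p4 ∧ v = (2, -1)) ∨
        (c = p4 ∧ v = (2, -2)) ∨ (c = p4 ∧ v = (1, -2)) ∨ (c = p5 ∧ v = (1, -2)) ∨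
        (c = p5 ∧ v = (0, -2)) ∨ (c = p5 ∧ v = (-1, -1)) ∨ (c = p5 ∧ v = p6) ∨
        (c = O ∧ v = p6) := by
      obtain ⟨i, j⟩ := v
      rw [adj_iff] at hcv
      revert hv'
      rcases hc with rfl | rfl | rfl <;>
        rcases hcv with ⟨h, h'⟩ | ⟨h, h'⟩ | ⟨h, h'⟩ | ⟨h, h'⟩ | ⟨h, h'⟩ | ⟨h, h'⟩ <;>
        dsimp only at h h' <;> subst h <;> subst h' <;>
        simp [mem_seeds_iff, O, p1, p2, p3, p4, p5, p6]
    rcases hcases with ⟨rfl, rfl⟩ | ⟨rfl, rfl⟩ | ⟨rfl, rfl⟩ | ⟨rfl, rfl⟩ | ⟨rfl, rfl⟩ |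
      ⟨rfl, rfl⟩ | ⟨rfl, rfl⟩ | ⟨rfl, rfl⟩ | ⟨rfl, rfl⟩ | ⟨rfl, rfl⟩
    exacts [⟨1, by omega, by omega, i1⟩, ⟨2, by omega, by omega, i2⟩, ⟨3, by omega, by omega, i3⟩,
      ⟨4, by omega, by omega, i4⟩, ⟨5, by omega, by omega, i5⟩, ⟨6, by omega, by omega, i6⟩,
      ⟨7, by omega, by omega, i7⟩, ⟨8, by omega, by omega, i8⟩, ⟨9, by omega, by omega, i9⟩,
      ⟨10, by omega, by omega, i10⟩]

/-- The tour reaches `p3` after `M` steps, without meeting the lower seed robots, but meeting all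
boundary edges of the shape. -/
structure TourLength (S : Set Lat) (M : ℕ) : Prop where
  last : tour S M = (p2, p3)
  next : tour S (M + 1) = (O, p3)
  next_next : tour S (M + 2) = (p4, p3)
  upper : ∀ j ≤ M, (tour S j).1 ∉ lowerSeeds
  injOn : Set.InjOn (tour S) (Set.Iic (M + 2))
  exists_eq : ∀ e ∈ boundaryEdges (formation S), e.1 ∈ S → ∃ j < M, tour S j = e
  periodic : ∀ n, tour S (n + (M + 11)) = tour S n

theorem exists_tourLength (W : WellLevelled S) (hfin : S.Finite)
    (hconn : (hexGraph.induce S).Connected) (hco : CoConnected (hopDomain S)) :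
    ∃ M, TourLength S M := by
  classical
  have hCfin : (formation S).Finite := hfin.union (by simp [seeds])
  have hsurj : ∀ e ∈ boundaryEdges (formation S), ∃ n, tour S n = e := fun e he =>
    exists_iterate_eq hCfin (connected_formation W hconn) (coConnected_formation W hco)
      (tour_zero_mem W) he
  have h23 : (p2, p3) ∈ boundaryEdges (formation S) := by
    refine ⟨mem_formation_of_eq W (by simp), notMem_formation W (by simp [p3]) ?_, ?_⟩
    · rw [mem_seeds_iff]; simp [p3, O, p1, p2, p4, p5]
    · rw [adj_iff]; simp [p2, p3]
  have hex := hsurj _ h23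
  obtain ⟨M, hM, hmin⟩ : ∃ M, tour S M = (p2, p3) ∧ ∀ n < M, tour S n ≠ (p2, p3) :=
    ⟨Nat.find hex, Nat.find_spec hex, fun n hn => Nat.find_min hex hn⟩
  obtain ⟨l1, l2, l3⟩ := iterate_lower W
  obtain ⟨t1, t2, -⟩ := trace_lower W
  have hM1 : tour S (M + 1) = (O, p3) := by rw [tour_succ, hM, t1]
  have hM2 : tour S (M + 2) = (p4, p3) := by rw [tour_succ, hM1, t2]
  have hlow : ∀ k, tour S (k + M) = (traceStep (formation S))^[k] (p2, p3) := fun k => by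
    rw [tour_add, hM]
  have hper : ∀ n, tour S (n + (M + 11)) = tour S n := by
    intro n
    have : tour S (M + 11) = (p1, p6) := by rw [add_comm, hlow, l1]
    rw [tour_add, this]; rfl
  have hp2 : p2 ∉ lowerSeeds := by simp [lowerSeeds, p2, O, p4, p5]
  have hupper : ∀ j ≤ M, (tour S j).1 ∉ lowerSeeds := by
    intro j hj hmem
    obtain ⟨k, hk1, hk2, hk⟩ := l3 _ (tour_mem W j) hmem
    have h0 : tour S ((11 - k) + j) = tour S 0 := by
      rw [tour_add, ← hk, ← Function.iterate_add_apply, Nat.sub_add_cancel (by omega), l1]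
      rfl
    rcases le_or_gt (11 - k) (M - j) with h | h
    · have h1 : tour S (M - j - (11 - k)) = tour S M := by
        have e : M = (M - j - (11 - k)) + ((11 - k) + j) := by omega
        conv_rhs => rw [e]
        rw [tour_add _ _ ((11 - k) + j), h0, ← tour_add, add_zero]
      exact hmin _ (by omega) (h1.trans hM)
    · have h1 : tour S M = (traceStep (formation S))^[M - j + k] (p2, p3) := by
        have e : M = (M - j) + j := by omega
        conv_lhs => rw [e]
        rw [tour_add, ← hk, ← Function.iterate_add_apply]
      have h2 := l2 (M - j + k) (by omega) (by omega)
      rw [← h1, hM] at h2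
      exact hp2 h2
  refine ⟨M, hM, hM1, hM2, hupper, ?_, ?_, hper⟩
  · have hlt : ∀ i j, i < j → j ≤ M + 2 → tour S i ≠ tour S j := by
      intro i j hij hj heq
      rcases (by omega : j ≤ M ∨ j = M + 1 ∨ j = M + 2) with h | rfl | rfl
      · refine hmin (M - j + i) (by omega) ?_
        rw [tour_add, heq, ← tour_add, Nat.sub_add_cancel h, hM]
      · refine hupper i (by omega) ?_
        rw [heq, hM1]
        simp [lowerSeeds]
      · rcases (by omega : i ≤ M ∨ i = M + 1) with h | rfl
        · refine hupper i h ?_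
          rw [heq, hM2]
          simp [lowerSeeds]
        · rw [hM1, hM2] at heq
          simp [O, p4] at heq
    intro i hi j hj heq
    by_contra hne
    rcases lt_or_gt_of_ne hne with h | h
    exacts [hlt i j h hj heq, hlt j i h hi heq.symm]
  · intro e he heS
    obtain ⟨n, hn⟩ := hsurj e he
    have hrow := W.row _ heS
    have hnotlow : e.1 ∉ lowerSeeds := by
      intro h
      simp only [lowerSeeds, Set.mem_insert_iff, Set.mem_singleton_iff, O, p4, p5, lat_eq_iff] at h
      omega
    induction n using Nat.strong_induction_on with
    | _ n ih =>
      rcases (by omega : n < M ∨ n = M ∨ (M < n ∧ n ≤ M + 10) ∨ M + 11 ≤ n) with h | rfl | h | h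
      · exact ⟨n, h, hn⟩
      · rw [hM] at hn
        rw [← hn] at hrow
        simp [p2] at hrow
      · have h1 := l2 (n - M) (by omega) (by omega)
        rw [← hlow, Nat.sub_add_cancel h.1.le, hn] at h1
        exact absurd h1 hnotlow
      · refine ih (n - (M + 11)) (by omega) ?_
        rw [← hper, Nat.sub_add_cancel h, hn]

/-- A boundary edge which the tour meets before `p3` is above the horizontal line through `O`. -/
theorem TourLength.row {M : ℕ} (hM : TourLength S M) (W : WellLevelled S) {j : ℕ} (hj : j ≤ M) :
    1 ≤ (tour S j).1.2 ∧ 0 ≤ (tour S j).2.2 := by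
  have h1 := hM.upper j hj
  have h2 := tour_mem W j
  have h3 := h2.2.2
  have h4 : 1 ≤ (tour S j).1.2 := by
    rcases h2.1 with h | h
    · have := W.row _ h; omega
    · rw [mem_seeds_iff] at h
      rcases h with h | h | h | h | h
      · exact absurd (by rw [h]; simp [lowerSeeds]) h1
      · rw [h]; simp [p1]
      · rw [h]; simp [p2]
      · exact absurd (by rw [h]; simp [lowerSeeds]) h1
      · exact absurd (by rw [h]; simp [lowerSeeds]) h1
  rw [adj_iff] at h3
  omega

end Tour

/-! ### Distances from the points of an arc to the lattice points -/

theorem arc_form_le {a b : ℝ} (ha : 0 ≤ a) (hb : 0 ≤ b) (h : a ^ 2 + a * b + b ^ 2 = 1) {p r : ℤ}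
    (h1 : ¬ (p = 1 ∧ r = 0)) (h2 : ¬ (p = 0 ∧ r = 1)) (h3 : ¬ (p = 1 ∧ r = 1)) :
    a * (2 * p + r) + b * (p + 2 * r) ≤ p ^ 2 + p * r + r ^ 2 ∧
      (0 < a → 0 < b → ¬ (p = 0 ∧ r = 0) →
        a * (2 * p + r) + b * (p + 2 * r) < p ^ 2 + p * r + r ^ 2) := by
  rcases le_or_gt (p ^ 2 + p * r + r ^ 2) 4 with hN | hN
  · have f1 : 2 * a + b ≤ 2 := by nlinarith
    have f2 : a + 2 * b ≤ 2 := by nlinarith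
    have f3 : 0 < b → 2 * a + b < 2 := fun hb => by nlinarith
    have f4 : 0 < a → a + 2 * b < 2 := fun ha => by nlinarith
    have hp1 : p ≤ 2 := by nlinarith [sq_nonneg (2 * r + p)]
    have hp2 : -2 ≤ p := by nlinarith [sq_nonneg (2 * r + p)]
    have hr1 : r ≤ 2 := by nlinarith [sq_nonneg (2 * p + r)]
    have hr2 : -2 ≤ r := by nlinarith [sq_nonneg (2 * p + r)]
    interval_cases p <;> interval_cases r <;> first
      | (exfalso; omega)
      | (refine ⟨by push_cast; linarith, fun ha hb h0 => ?_⟩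
         have f3 := f3 hb
         have f4 := f4 ha
         first
          | (exfalso; omega)
          | (push_cast; linarith))
  · have hN' : (4 : ℝ) < p ^ 2 + p * r + r ^ 2 := by exact_mod_cast hN
    have key : (a * (2 * p + r) + b * (p + 2 * r)) ^ 2 ≤ 4 * (p ^ 2 + p * r + r ^ 2) := by
      have : 4 * ((p : ℝ) ^ 2 + p * r + r ^ 2) * 1 - (a * (2 * p + r) + b * (p + 2 * r)) ^ 2 =
          3 * (a * r - b * p) ^ 2 := by
        rw [← h]; ring
      nlinarith [sq_nonneg (a * r - b * p)]
    have lt : a * (2 * p + r) + b * (p + 2 * r) < p ^ 2 + p * r + r ^ 2 := by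
      refine lt_of_pow_lt_pow_left₀ 2 (by linarith) (key.trans_lt ?_)
      nlinarith
    exact ⟨lt.le, fun _ _ _ => lt⟩

theorem exists_arc_coordinates {θ : ℝ} (h0 : 0 ≤ θ) (h1 : θ ≤ π / 3) : ∃ a b : ℝ, 0 ≤ a ∧ 0 ≤ b ∧
    a ^ 2 + a * b + b ^ 2 = 1 ∧ (0 < θ → 0 < b) ∧ (θ < π / 3 → 0 < a) ∧
    Complex.exp (-((θ : ℂ) * Complex.I)) = a + b * Complex.exp (-(((π / 3 : ℝ) : ℂ) * Complex.I)) := by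
  have h3 : √3 * √3 = (3 : ℝ) := Real.mul_self_sqrt (by norm_num)
  have h3' : 0 < √3 := Real.sqrt_pos.2 (by norm_num)
  have hpi := Real.pi_pos
  have hs : 0 ≤ Real.sin θ := Real.sin_nonneg_of_nonneg_of_le_pi h0 (by linarith)
  have hsub : Real.sin (π / 3 - θ) = √3 / 2 * Real.cos θ - Real.sin θ / 2 := by
    rw [Real.sin_sub, Real.sin_pi_div_three, Real.cos_pi_div_three]; ring
  have hs' : 0 ≤ Real.sin (π / 3 - θ) :=
    Real.sin_nonneg_of_nonneg_of_le_pi (by linarith) (by linarith)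
  have hsq := Real.sin_sq_add_cos_sq θ
  have ea : 2 / √3 * Real.sin (π / 3 - θ) = Real.cos θ - Real.sin θ * (√3 / 3) := by
    rw [hsub]
    field_simp
    linear_combination (Real.sin θ) * h3
  have eb : 2 / √3 * Real.sin θ = Real.sin θ * (2 * √3 / 3) := by
    field_simp
    linear_combination (-Real.sin θ) * h3
  refine ⟨2 / √3 * Real.sin (π / 3 - θ), 2 / √3 * Real.sin θ, by positivity, by positivity, ?_,
    fun h => ?_, fun h => ?_, ?_⟩
  · rw [ea, eb]
    linear_combination hsq + Real.sin θ ^ 2 / 9 * 3 * h3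
  · have := Real.sin_pos_of_pos_of_lt_pi h (by linarith)
    positivity
  · have := Real.sin_pos_of_pos_of_lt_pi (x := π / 3 - θ) (by linarith) (by linarith)
    positivity
  · rw [ea, eb]
    have e1 : ∀ t : ℝ, Complex.exp (-((t : ℂ) * Complex.I)) =
        (Real.cos t : ℂ) - (Real.sin t : ℂ) * Complex.I := by
      intro t
      rw [← neg_mul, ← Complex.ofReal_neg, Complex.exp_mul_I, ← Complex.ofReal_cos,
        ← Complex.ofReal_sin, Real.cos_neg, Real.sin_neg]
      push_cast; ring
    rw [e1, e1, Real.cos_pi_div_three, Real.sin_pi_div_three]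
    apply Complex.ext
    · simp
      ring
    · simp [Complex.sin_ofReal_re]
      linear_combination (-(Real.sin θ) / 3) * h3

theorem dist_rotPoint {d : ℝ} (hd : 0 < d) {c v : Lat} (hcv : hexGraph.Adj c v) {a b θ : ℝ}
    (hθ : Complex.exp (-((θ : ℂ) * Complex.I)) =
      a + b * Complex.exp (-(((π / 3 : ℝ) : ℂ) * Complex.I)))
    (hab : a ^ 2 + a * b + b ^ 2 = 1) {x : Lat} {p r : ℤ}
    (h1 : x.1 = c.1 + p * (v.1 - c.1) + r * (v.1 - c.1 + (v.2 - c.2)))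
    (h2 : x.2 = c.2 + p * (v.2 - c.2) - r * (v.1 - c.1)) :
    dist (rotPoint d c v θ) (pos d x) =
      d * √(1 + (p ^ 2 + p * r + r ^ 2) - (a * (2 * p + r) + b * (p + 2 * r))) := by
  have h3 : √3 * √3 = (3 : ℝ) := Real.mul_self_sqrt (by norm_num)
  set E := Complex.exp (-(((π / 3 : ℝ) : ℂ) * Complex.I)) with hE
  have hE' : E = ⟨1 / 2, -(√3 / 2)⟩ := by
    rw [hE, Complex.exp_neg, exp_pi_div_three, eq_comm]
    apply eq_inv_of_mul_eq_one_left
    apply Complex.ext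
    · simp only [Complex.mul_re, Complex.one_re]
      linear_combination h3 / 4
    · simp only [Complex.mul_im, Complex.one_im]
      ring
  have hvc : pos d v - pos d c = pos d (v - c) := by
    unfold pos
    simp only [Prod.fst_sub, Prod.snd_sub]
    push_cast; ring
  have hx : pos d x = pos d c + pos d (v - c) * (p + r * E) := by
    rw [mul_add, mul_left_comm, hE, ← pos_cw]
    unfold pos
    rw [h1, h2]
    simp only [cw, Prod.fst_sub, Prod.snd_sub]
    push_cast; ring
  have hnorm : ‖pos d (v - c)‖ = d := by
    rw [← hvc, ← Complex.dist_eq]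
    exact (hexGraph_adj_iff hd v c).1 hcv.symm
  have key : rotPoint d c v θ - pos d x = pos d (v - c) * ((a - p) + (b - r) * E) := by
    rw [rotPoint, hvc, hx, hθ]
    ring
  rw [Complex.dist_eq, key, norm_mul, hnorm, Complex.norm_def]
  congr 2
  rw [hE', Complex.normSq_apply]
  simp
  linear_combination hab + (b - r) ^ 2 / 4 * h3

theorem exists_frame {c v : Lat} (hcv : hexGraph.Adj c v) (x : Lat) : ∃ p r : ℤ,
    x.1 = c.1 + p * (v.1 - c.1) + r * (v.1 - c.1 + (v.2 - c.2)) ∧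
    x.2 = c.2 + p * (v.2 - c.2) - r * (v.1 - c.1) := by
  have h : sqLen (c - v) = 1 := hcv
  simp only [sqLen, Prod.fst_sub, Prod.snd_sub] at h
  refine ⟨(v.1 - c.1) * (x.1 - c.1) + (v.1 - c.1 + (v.2 - c.2)) * (x.2 - c.2),
    (v.2 - c.2) * (x.1 - c.1) - (v.1 - c.1) * (x.2 - c.2), ?_, ?_⟩
  · linear_combination (-(x.1 - c.1)) * h
  · linear_combination (-(x.2 - c.2)) * h

theorem dist_rotPoint_center {d : ℝ} (hd : 0 < d) {c v : Lat} (hcv : hexGraph.Adj c v) (θ : ℝ) :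
    dist (rotPoint d c v θ) (pos d c) = d := by
  rw [rotPoint, Complex.dist_eq, add_sub_cancel_left, norm_mul, ← Complex.dist_eq,
    (hexGraph_adj_iff hd v c).1 hcv.symm, ← neg_mul, ← Complex.ofReal_neg,
    Complex.norm_exp_ofReal_mul_I, mul_one]

/-- A point of an arc is at distance at least `d` from all lattice points except the ends of the
arc and the point behind them; an inner point is at distance `d` from its center only. -/
theorem le_dist_rotPoint {d : ℝ} (hd : 0 < d) {c v x : Lat} (hcv : hexGraph.Adj c v) {θ : ℝ}
    (h0 : 0 ≤ θ) (h1 : θ ≤ π / 3) (hv : x ≠ v) (hv' : x ≠ rot c v)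
    (hv'' : x ≠ rot (rot c v) v) :
    d ≤ dist (rotPoint d c v θ) (pos d x) ∧
      (0 < θ → θ < π / 3 → x ≠ c → d < dist (rotPoint d c v θ) (pos d x)) := by
  obtain ⟨p, r, hx1, hx2⟩ := exists_frame hcv x
  obtain ⟨a, b, ha, hb, hab, hb', ha', hθ⟩ := exists_arc_coordinates h0 h1
  rw [dist_rotPoint hd hcv hθ hab hx1 hx2]
  have n1 : ¬ (p = 1 ∧ r = 0) := by
    rintro ⟨rfl, rfl⟩
    refine hv ((lat_eq_iff _ _).2 ⟨by linarith, by linarith⟩)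
  have n2 : ¬ (p = 0 ∧ r = 1) := by
    rintro ⟨rfl, rfl⟩
    refine hv' ((lat_eq_iff _ _).2 ?_)
    rw [rot_fst, rot_snd]
    exact ⟨by linarith, by linarith⟩
  have n3 : ¬ (p = 1 ∧ r = 1) := by
    rintro ⟨rfl, rfl⟩
    refine hv'' ((lat_eq_iff _ _).2 ?_)
    simp only [rot_fst, rot_snd]
    exact ⟨by linarith, by linarith⟩
  obtain ⟨hle, hlt⟩ := arc_form_le ha hb hab n1 n2 n3
  constructor
  · refine le_mul_of_one_le_right hd.le (Real.one_le_sqrt.2 (by linarith))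
  · intro h2 h3 hxc
    have n0 : ¬ (p = 0 ∧ r = 0) := by
      rintro ⟨rfl, rfl⟩
      refine hxc ((lat_eq_iff _ _).2 ⟨by linarith, by linarith⟩)
    have := hlt (ha' h3) (hb' h2) n0
    refine lt_mul_of_one_lt_right hd ?_
    rw [Real.lt_sqrt zero_le_one]
    linarith

theorem dist_rotPoint_opposite_lt {d : ℝ} (hd : 0 < d) {c v : Lat} (hcv : hexGraph.Adj c v)
    {θ : ℝ} (h0 : 0 < θ) (h1 : θ < π / 3) :
    dist (rotPoint d c v θ) (pos d (rot (rot c v) v)) < d := by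
  obtain ⟨a, b, ha, hb, hab, hb', ha', hθ⟩ := exists_arc_coordinates h0.le h1.le
  have ha' := ha' h1
  have hb' := hb' h0
  rw [dist_rotPoint hd hcv hθ hab (p := 1) (r := 1) (by simp only [rot_fst, rot_snd]; ring)
    (by simp only [rot_fst, rot_snd]; ring)]
  refine mul_lt_of_lt_one_right hd ?_
  rw [Real.sqrt_lt' one_pos]
  have : 1 < a + b := by nlinarith [mul_pos ha' hb']
  push_cast
  linarith

theorem rotPoint_zero (d : ℝ) (c v : Lat) : rotPoint d c v 0 = pos d v := by
  simp [rotPoint]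

theorem rotPoint_pi_div_three (d : ℝ) (c v : Lat) : rotPoint d c v (π / 3) = pos d (rot c v) := by
  have h1 : pos d v - pos d c = pos d (v - c) := by
    unfold pos
    simp only [Prod.fst_sub, Prod.snd_sub]
    push_cast; ring
  rw [rotPoint, h1, ← pos_cw, rot]
  unfold pos
  simp only [Prod.fst_add, Prod.snd_add]
  push_cast; ring

theorem notMem_of_pos_mem_EFP {d : ℝ} (hd : 0 < d) {occ : Set Lat} {v : Lat}
    (h : pos d v ∈ EFP d occ) : v ∉ occ := by
  intro hv
  have h1 : Metric.infDist (pos d v) (pos d '' occ) = d := h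
  rw [Metric.infDist_zero_of_mem (Set.mem_image_of_mem _ hv)] at h1
  exact hd.ne h1

theorem rotPoint_mem_EFP {d : ℝ} (hd : 0 < d) {occ : Set Lat} {c v : Lat}
    (hcv : hexGraph.Adj c v) (hc : c ∈ occ) (hv : v ∉ occ) (hv' : rot c v ∉ occ)
    (hv'' : rot (rot c v) v ∉ occ) {θ : ℝ} (hθ : θ ∈ Set.Icc (0 : ℝ) (π / 3)) :
    rotPoint d c v θ ∈ EFP d occ := by
  have hmem : pos d c ∈ pos d '' occ := Set.mem_image_of_mem _ hc
  refine le_antisymm ?_ ?_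
  · exact (Metric.infDist_le_dist_of_mem hmem).trans (dist_rotPoint_center hd hcv θ).le
  · refine (Metric.le_infDist ⟨_, hmem⟩).2 ?_
    rintro _ ⟨x, hx, rfl⟩
    exact (le_dist_rotPoint hd hcv hθ.1 hθ.2 (fun h => hv (h ▸ hx)) (fun h => hv' (h ▸ hx))
      fun h => hv'' (h ▸ hx)).1

/-! ### The affiliated path -/

section Path

variable {S occ : Set Lat} {d : ℝ} {M : ℕ}

/-- The tour turns around its center from step `j` to step `j + 1`. -/
def IsArcStep (S : Set Lat) (j : ℕ) : Prop := rot (tour S j).1 (tour S j).2 ∉ formation S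

theorem tour_succ_of_arc {j : ℕ} (h : IsArcStep S j) :
    tour S (j + 1) = ((tour S j).1, rot (tour S j).1 (tour S j).2) := by
  rw [tour_succ]; exact traceStep_of_notMem h

theorem tour_succ_of_not_arc {j : ℕ} (h : ¬ IsArcStep S j) :
    tour S (j + 1) = (rot (tour S j).1 (tour S j).2, (tour S j).2) := by
  rw [tour_succ]; exact traceStep_of_mem (not_not.1 h)

theorem isArcStep_of_lower (W : WellLevelled S) {j : ℕ} (h : tour S j = (p4, p3)) :
    IsArcStep S j := by
  unfold IsArcStep
  rw [h, rot_eq (k := 2) (l := -1) (by decide) (by decide)]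
  refine notMem_formation W (by norm_num) ?_
  rw [mem_seeds_iff]
  simp [O, p1, p2, p4, p5]

theorem isArcStep_zero (W : WellLevelled S) : IsArcStep S 0 := by
  have h : tour S 0 = (p1, p6) := rfl
  unfold IsArcStep
  rw [h, rot_eq (k := -2) (l := 1) (by decide) (by decide)]
  refine notMem_formation W (by norm_num) ?_
  rw [mem_seeds_iff]
  simp [O, p1, p2, p4, p5]

theorem tour_eq_of_arc (W : WellLevelled S) (hsm : Smooth (formation S)) {i j : ℕ}
    (hi : IsArcStep S i) (hj : IsArcStep S j) (h : (tour S i).2 = (tour S j).2) :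
    tour S i = tour S j := by
  obtain ⟨h1, h2, h3⟩ := tour_mem W i
  obtain ⟨h4, -, h5⟩ := tour_mem W j
  have hj' := hj
  unfold IsArcStep at hi hj'
  rw [← h] at h5 hj'
  exact Prod.ext (hsm.center_unique h2 h1 h4 h3.symm h5.symm hi hj') h

/-- Robots outside the formation are too far down to matter for the affiliated path. -/
structure Surrounds (S occ : Set Lat) : Prop where
  sub : formation S ⊆ occ
  mem : ∀ x ∈ occ, -1 ≤ x.2 → x ∈ formation S

open Classical in
/-- The arcs of an affiliated path are the arcs of the tour. -/
theorem AffiliatedPath.vertex_count (hd : 0 < d) (W : WellLevelled S)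
    (hsm : Smooth (formation S)) (hM : TourLength S M) (hocc : Surrounds S occ)
    (A : AffiliatedPath d occ) : ∀ j ≤ M, Nat.count (IsArcStep S) j ≤ A.len ∧
      A.vertex (Nat.count (IsArcStep S) j) = (tour S j).2 := by
  intro j
  induction j with
  | zero => exact fun _ => ⟨by simp, by rw [Nat.count_zero, A.vertex_zero]; rfl⟩
  | succ j ih =>
    intro hj
    obtain ⟨h1, h2⟩ := ih (by omega)
    by_cases ha : IsArcStep S j
    swap
    · rw [Nat.count_succ, if_neg ha, tour_succ_of_not_arc ha]
      exact ⟨h1, h2⟩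
    rw [Nat.count_succ, if_pos ha, tour_succ_of_arc ha]
    set i := Nat.count (IsArcStep S) j
    have hE := tour_mem W j
    have hlt : i < A.len := by
      refine lt_of_le_of_ne h1 fun heq => hM.upper j (by omega) ?_
      have h3 : (tour S j).2 = (tour S (M + 2)).2 := by
        rw [← h2, heq, A.vertex_len, hM.next_next]
      rw [tour_eq_of_arc W hsm ha (isArcStep_of_lower W hM.next_next) h3, hM.next_next]
      simp [lowerSeeds]
    have hadj := A.adj i hlt
    rw [h2] at hadj
    have hrow := (hM.row W (j := j) (by omega)).2
    have hc : A.center i ∈ formation S := by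
      refine hocc.mem _ (A.center_mem i hlt) ?_
      rw [adj_iff] at hadj
      omega
    have hstep : A.vertex (i + 1) = rot (A.center i) (tour S j).2 := by
      rw [A.step i hlt, h2]; rfl
    have hfree : rot (A.center i) (tour S j).2 ∉ formation S := by
      intro h
      have h4 := A.arc_subset i hlt (π / 3) ⟨by positivity, le_rfl⟩
      rw [rotPoint_pi_div_three, h2] at h4
      exact notMem_of_pos_mem_EFP hd h4 (hocc.sub h)
    have heq : A.center i = (tour S j).1 :=
      hsm.center_unique hE.2.1 hc hE.1 hadj hE.2.2.symm hfree ha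
    exact ⟨hlt, by rw [hstep, heq]⟩

theorem infinite_isArcStep (W : WellLevelled S) (hM : TourLength S M) :
    (Set.ofPred (IsArcStep S)).Infinite := by
  refine Set.infinite_of_not_bddAbove fun ⟨N, hN⟩ => ?_
  have hper : ∀ k, tour S (k * (M + 11)) = tour S 0 := by
    intro k
    induction k with
    | zero => rw [Nat.zero_mul]
    | succ k ih => rw [Nat.succ_mul, hM.periodic, ih]
  have h1 : IsArcStep S ((N + 1) * (M + 11)) := by
    unfold IsArcStep
    rw [hper]
    exact isArcStep_zero W
  have h2 : (N + 1) * (M + 11) ≤ N := hN h1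
  nlinarith

open Classical in
/-- Between two arcs the tour stays at the same point. -/
theorem vertex_nth_count (hinf : (Set.ofPred (IsArcStep S)).Infinite) (j : ℕ) :
    (tour S (Nat.nth (IsArcStep S) (Nat.count (IsArcStep S) j))).2 = (tour S j).2 := by
  have hle := Nat.le_nth_count hinf j
  induction hn : Nat.nth (IsArcStep S) (Nat.count (IsArcStep S) j) - j generalizing j with
  | zero => rw [show Nat.nth (IsArcStep S) (Nat.count (IsArcStep S) j) = j by omega]
  | succ n ih =>
    by_cases ha : IsArcStep S j
    · rw [Nat.nth_count ha]
    · have hc : Nat.count (IsArcStep S) (j + 1) = Nat.count (IsArcStep S) j := by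
        rw [Nat.count_succ, if_neg ha, add_zero]
      have h1 := Nat.le_nth_count hinf (j + 1)
      have h2 := ih (j + 1) h1 (by rw [hc]; omega)
      rw [hc, tour_succ_of_not_arc ha] at h2
      exact h2

open Classical in
theorem nonempty_affiliatedPath (hd : 0 < d) (W : WellLevelled S) (hsm : Smooth (formation S))
    (hM : TourLength S M) (hocc : Surrounds S occ) : Nonempty (AffiliatedPath d occ) := by
  have hinf := infinite_isArcStep W hM
  set p := IsArcStep S with hp
  have harc : ∀ i, p (Nat.nth p i) := fun i => Nat.nth_mem_of_infinite hinf i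
  have hlast : Nat.nth p (Nat.count p M) = M + 2 := by
    have n0 : ¬ p M := by
      simp only [hp, IsArcStep, hM.last, not_not]
      rw [rot_eq (k := 0) (l := 0) (by decide) (by decide)]
      exact mem_formation_of_eq W (Or.inl rfl)
    have n1 : ¬ p (M + 1) := by
      simp only [hp, IsArcStep, hM.next, not_not]
      rw [rot_eq (k := 1) (l := -1) (by decide) (by decide)]
      exact mem_formation_of_eq W (by simp [p4])
    have h1 : Nat.count p (M + 2) = Nat.count p M := by
      rw [Nat.count_succ, if_neg n1, Nat.count_succ, if_neg n0, add_zero, add_zero]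
    rw [← h1]
    exact Nat.nth_count (isArcStep_of_lower W hM.next_next)
  have hltM : ∀ i < Nat.count p M, Nat.nth p i < M := fun i hi => Nat.nth_lt_of_lt_count hi
  have hle : ∀ i ≤ Nat.count p M, Nat.nth p i ≤ M + 2 := fun i hi => by
    rcases hi.lt_or_eq with h | h
    · have := hltM i h; omega
    · rw [h, hlast]
  have notocc : ∀ x : Lat, -1 ≤ x.2 → x ∉ formation S → x ∉ occ := fun x h1 h2 h3 =>
    h2 (hocc.mem x h3 h1)
  refine ⟨⟨Nat.count p M, fun i => (tour S (Nat.nth p i)).2, fun i => (tour S (Nat.nth p i)).1,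
    ?_, ?_, ?_, ?_, ?_, ?_, ?_⟩⟩
  · have := vertex_nth_count hinf 0
    rw [Nat.count_zero] at this
    exact this
  · rw [hlast, hM.next_next]
  · exact fun i _ => hocc.sub (tour_mem W _).1
  · exact fun i _ => (tour_mem W _).2.2.symm
  · intro i _
    have h1 := vertex_nth_count hinf (Nat.nth p i + 1)
    have h2 : Nat.count p (Nat.nth p i + 1) = i + 1 := by
      rw [Nat.count_succ, if_pos (harc i), Nat.count_nth_of_infinite hinf]
    rw [← hp, h2, tour_succ_of_arc (harc i)] at h1
    exact h1
  · intro i hi θ hθ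
    have hj := hltM i hi
    obtain ⟨h1, h2, h3⟩ := tour_mem W (Nat.nth p i)
    have hr := hM.row W hj.le
    have ha : rot (tour S (Nat.nth p i)).1 (tour S (Nat.nth p i)).2 ∉ formation S := harc i
    generalize tour S (Nat.nth p i) = e at *
    obtain ⟨c, v⟩ := e
    replace h1 : c ∈ formation S := h1
    replace h2 : v ∉ formation S := h2
    replace h3 : hexGraph.Adj c v := h3
    replace ha : rot c v ∉ formation S := ha
    replace hr : 1 ≤ c.2 ∧ 0 ≤ v.2 := hr
    have hadj := h3
    rw [adj_iff] at hadj
    have hfar : rot (rot c v) v ∉ formation S := by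
      intro h
      have h4 : hexGraph.Adj v (rot (rot c v) v) := adj_rot' (adj_rot' h3).symm
      have h5 : rot v (rot (rot c v) v) = rot c v := rot_rot _ _
      have h6 : rot v (rot v (rot (rot c v) v)) = c := by rw [h5, rot_rot]
      have h7 := hsm.sqrt_three v h2 _ h h4 (by rw [h6]; exact h1)
      rw [h5] at h7
      exact ha h7
    refine rotPoint_mem_EFP hd h3 (hocc.sub h1) (notocc _ (by omega) h2)
      (notocc _ ?_ ha) (notocc _ ?_ hfar) hθ
    · rw [rot_snd]; omega
    · simp only [rot_fst, rot_snd]; omega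
  · intro i hi j hj heq
    have h1 := hM.injOn (hle i hi) (hle j hj) (tour_eq_of_arc W hsm (harc i) (harc j) heq)
    exact Nat.nth_injective hinf h1

theorem AffiliatedPath.point_natCast (A : AffiliatedPath d occ) (n : ℕ) :
    A.point n = pos d (A.vertex n) := by
  unfold AffiliatedPath.point
  rw [Nat.floor_natCast, Int.fract_natCast, zero_mul, rotPoint_zero]

/-- The tour leaves the points above a ribbon, and then it is at the merging point. -/
theorem exists_exit_step (W : WellLevelled S) (hM : TourLength S M) {R : Set Lat} {j : ℕ}
    (hj : j ≤ M) (hjR : (tour S j).1 ∈ subtree S R) : ∃ k, j ≤ k ∧ k < M ∧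
      IsFirstVertex S R (tour S k).1 ∧ IsMergingPoint S R (tour S k).2 ∧ ¬ IsArcStep S k := by
  have hend : (tour S M).1 ∉ subtree S R := by
    intro h
    have := W.row _ h.1
    rw [hM.last] at this
    simp [p2] at this
  obtain ⟨k, hk1, hk2, hk3, hk4⟩ : ∃ k, j ≤ k ∧ k < M ∧ (tour S k).1 ∈ subtree S R ∧
      (tour S (k + 1)).1 ∉ subtree S R := by
    by_contra hcon
    push Not at hcon
    have : ∀ n, j + n ≤ M → (tour S (j + n)).1 ∈ subtree S R := by
      intro n
      induction n with
      | zero => exact fun _ => hjR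
      | succ n ih => exact fun h => hcon (j + n) (by omega) (by omega) (ih (by omega))
    refine hend ?_
    have h := this (M - j) (by omega)
    rwa [Nat.add_sub_cancel' hj] at h
  rw [tour_succ] at hk4
  obtain ⟨h1, h2, h3⟩ := W.exit_subtree (tour_mem W k) hk3 hk4
  exact ⟨k, hk1, hk2, h1, h2, not_not.2 h3⟩

theorem exists_isFirstVertex (W : WellLevelled S) (hfin : S.Finite) (hM : TourLength S M)
    {R : Set Lat} (hR : IsRibbon S R) : ∃ x, IsFirstVertex S R x := by
  obtain ⟨e, he, heR⟩ := W.exists_boundaryEdge hfin hR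
  obtain ⟨j, hj, rfl⟩ := hM.exists_eq e he heR.1
  obtain ⟨k, -, -, h, -⟩ := exists_exit_step W hM hj.le heR
  exact ⟨_, h⟩

/-- The tour meets the merging point of a ribbon at a point of the ribbon. -/
theorem exists_tour_merging (W : WellLevelled S) (hM : TourLength S M) {R : Set Lat} {m : Lat}
    (hR : IsRibbon S R) (hlen : 2 ≤ R.ncard) (hm : IsMergingPoint S R m) :
    ∃ j < M, (tour S j).1 ∈ R ∧ (tour S j).2 = m := by
  obtain ⟨-, x, hx, -⟩ := id hm
  have hx' := (W.isFirstVertex_iff hR).1 hx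
  obtain ⟨hxS, rfl⟩ := hR.eq_ribbonOf hx.1
  obtain ⟨y, h1, h2, h3⟩ := W.exists_exit hxS hx'.2
  have hq : IsMergingPoint S (ribbonOf S x) (rot y x) :=
    W.isMergingPoint_of_exit hx hxS (fun h => h3 (Or.inl h)) (adj_rot' h1.symm) h1
      (adj_rot h1.symm) h2
  have hqm := (W.existsUnique_isMergingPoint hR hlen hx).unique hq hm
  obtain ⟨j, hj, he⟩ := hM.exists_eq (x, rot y x)
    ⟨Or.inl hxS, fun h => h3 (formation_subset S h), adj_rot' h1.symm⟩ hxS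
  exact ⟨j, hj, by rw [he]; exact hx.1, by rw [he]; exact hqm⟩

open Classical in
theorem AffiliatedPath.inFront_of_tour (hd : 0 < d) (W : WellLevelled S)
    (hsm : Smooth (formation S)) (hM : TourLength S M) (hocc : Surrounds S occ)
    (A : AffiliatedPath d occ) {j k : ℕ} (hjk : j ≤ k) (hk : k ≤ M) :
    A.InFront (pos d (tour S k).2) (pos d (tour S j).2) := by
  obtain ⟨-, h2⟩ := A.vertex_count hd W hsm hM hocc j (hjk.trans hk)
  obtain ⟨h3, h4⟩ := A.vertex_count hd W hsm hM hocc k hk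
  refine ⟨(Nat.count (IsArcStep S) j : ℕ), (Nat.count (IsArcStep S) k : ℕ), Nat.cast_nonneg _,
    Nat.cast_le.2 (Nat.count_monotone _ hjk), Nat.cast_le.2 h3, ?_, ?_⟩
  · rw [A.point_natCast, h2]
  · rw [A.point_natCast, h4]

open Classical in
/-- A point contributed by a ribbon is not passed after the merging point. -/
theorem AffiliatedPath.inFront_of_contributed (hd : 0 < d) (W : WellLevelled S)
    (hsm : Smooth (formation S)) (hM : TourLength S M) (hocc : Surrounds S occ)
    (A : AffiliatedPath d occ) {R : Set Lat} {m : Lat} (hR : IsRibbon S R) (hlen : 2 ≤ R.ncard)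
    (hm : IsMergingPoint S R m) {z : ℂ} (hz : A.Mem z) (hzR : ContributedBy d occ R z) :
    A.InFront (pos d m) z := by
  have hv := A.vertex_count hd W hsm hM hocc
  obtain ⟨a, ⟨ha0, ha1⟩, hza⟩ := hz
  obtain ⟨c, hc, hcR, hdist⟩ := hzR
  have hcS := (hR.eq_ribbonOf hcR).1
  have hcT := hR.subset_subtree hcR
  -- a step of the tour at the vertex before `z`, with a center in `R`
  obtain ⟨j, hj, hjR, hji, hja⟩ : ∃ j ≤ M, (tour S j).1 ∈ subtree S R ∧
      Nat.count (IsArcStep S) j = ⌊a⌋₊ ∧ (Int.fract a = 0 ∨ IsArcStep S j) := by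
    have free : ∀ i < A.len, A.vertex i ∉ occ := fun i hi => by
      have := A.arc_subset i hi 0 ⟨le_rfl, by positivity⟩
      rw [rotPoint_zero] at this
      exact notMem_of_pos_mem_EFP hd this
    have free' : ∀ i ≤ A.len, A.vertex i ∉ formation S := fun i hi => by
      rcases hi.lt_or_eq with h | h
      · exact fun h' => free i h (hocc.sub h')
      · rw [h, A.vertex_len]
        have := (tour_mem W M).2.1
        rwa [hM.last] at this
    have hfl : ⌊a⌋₊ ≤ A.len := Nat.floor_le_of_le ha1
    have pos_of_fract : Int.fract a = 0 → z = pos d (A.vertex ⌊a⌋₊) := fun h => by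
      rw [← hza, AffiliatedPath.point, h, zero_mul, rotPoint_zero]
    -- an edge from a point of `R` to a vertex belongs to the tour
    have found : ∀ i ≤ A.len, hexGraph.Adj c (A.vertex i) → ∃ j ≤ M, tour S j = (c, A.vertex i) ∧
        Nat.count (IsArcStep S) j = i := by
      intro i hi hadj
      obtain ⟨j, hj, hej⟩ := hM.exists_eq (c, A.vertex i) ⟨Or.inl hcS, free' i hi, hadj⟩ hcS
      obtain ⟨h1, h2⟩ := hv j hj.le
      refine ⟨j, hj.le, hej, A.simple h1 hi ?_⟩
      rw [h2, hej]
    by_cases hfr : Int.fract a = 0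
    · have hadj : hexGraph.Adj c (A.vertex ⌊a⌋₊) := by
        rw [hexGraph_adj_iff hd, dist_comm, ← pos_of_fract hfr]
        exact hdist
      obtain ⟨j, hj, hej, hcount⟩ := found _ hfl hadj
      exact ⟨j, hj, by rw [hej]; exact hcT, hcount, Or.inl hfr⟩
    · have hfpos : 0 < Int.fract a := lt_of_le_of_ne (Int.fract_nonneg a) (Ne.symm hfr)
      have hlt : ⌊a⌋₊ < A.len := by
        refine lt_of_le_of_ne hfl fun h => hfr ?_
        have h1 : (⌊a⌋₊ : ℝ) ≤ a := Nat.floor_le ha0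
        rw [h] at h1
        rw [le_antisymm ha1 h1, Int.fract_natCast]
      set i := ⌊a⌋₊ with hi
      have hadj := (A.adj i hlt).symm
      have hdist' : dist (rotPoint d (A.center i) (A.vertex i) (Int.fract a * (π / 3)))
          (pos d c) = d := by
        rw [← hza] at hdist
        exact hdist
      have hcen : c = A.center i := by
        by_contra hne
        have hv1 : c ≠ A.vertex i := fun h => free i hlt (h ▸ hc)
        have hv2 : c ≠ rot (A.center i) (A.vertex i) := fun h =>
          free' (i + 1) hlt (by
            rw [A.step i hlt]
            change rot (A.center i) (A.vertex i) ∈ _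
            rw [← h]; exact Or.inl hcS)
        have hθ1 : Int.fract a * (π / 3) < π / 3 := by
          have := Int.fract_lt_one a
          have := Real.pi_pos
          nlinarith
        have hθ0 : 0 < Int.fract a * (π / 3) := by positivity
        by_cases hv3 : c = rot (rot (A.center i) (A.vertex i)) (A.vertex i)
        · have := dist_rotPoint_opposite_lt hd hadj hθ0 hθ1
          rw [← hv3] at this
          exact this.ne hdist'
        · exact ((le_dist_rotPoint hd hadj hθ0.le hθ1.le hv1 hv2 hv3).2 hθ0 hθ1 hne).ne' hdist'
      obtain ⟨j, hj, hej, hcount⟩ := found i hfl (hcen ▸ hadj)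
      refine ⟨j, hj, by rw [hej]; exact hcT, hcount, Or.inr ?_⟩
      have := free' (i + 1) hlt
      rw [A.step i hlt] at this
      unfold IsArcStep
      rw [hej, hcen]
      exact this
  obtain ⟨k, hjk, hkM, hfirst, hmk, hka⟩ := exists_exit_step W hM hj hjR
  obtain rfl := (W.existsUnique_isMergingPoint hR hlen hfirst).unique hmk hm
  obtain ⟨h3, h4⟩ := hv k hkM.le
  refine ⟨a, (Nat.count (IsArcStep S) k : ℕ), ha0, ?_, Nat.cast_le.2 h3, hza, ?_⟩
  · rcases hja with h | h
    · have h5 : a = (⌊a⌋₊ : ℝ) := by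
        rw [natCast_floor_eq_intCast_floor ha0]
        linarith [Int.floor_add_fract a]
      rw [h5, ← hji]
      exact Nat.cast_le.2 (Nat.count_monotone _ hjk)
    · have hne : j ≠ k := fun h' => hka (h' ▸ h)
      have h6 : Nat.count (IsArcStep S) (j + 1) ≤ Nat.count (IsArcStep S) k :=
        Nat.count_monotone _ (by omega)
      rw [Nat.count_succ, if_pos h, hji] at h6
      have h7 : ((⌊a⌋₊ + 1 : ℕ) : ℝ) ≤ (Nat.count (IsArcStep S) k : ℕ) := Nat.cast_le.2 h6
      have h8 := Nat.lt_floor_add_one a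
      push_cast at h7 ⊢
      linarith
  · rw [A.point_natCast, h4]

end Path

/-! ### The occupied points after the last epoch -/

theorem surrounds_occupied {S I : Finset Lat} (hI : (I : Set Lat) ⊆ H2) {s t : ℕ → Lat}
    {lt : Set Lat → Set Lat → Prop} (ht : IsAssemblySequence (S : Set Lat) lt S.card t) :
    Surrounds (S : Set Lat) (occupied I s t S.card) := by
  have himage : t '' Set.Icc 1 S.card = (S : Set Lat) := by
    have hinj : Set.InjOn t (Finset.Icc 1 S.card : Finset ℕ) := by
      intro i hi j hj heq
      rw [Finset.coe_Icc] at hi hj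
      by_contra hne
      rcases lt_or_gt_of_ne hne with h | h
      · exact (ht j hj).2.1 i ⟨hi.1, h⟩ heq
      · exact (ht i hi).2.1 j ⟨hj.1, h⟩ heq.symm
    have hsub : (Finset.Icc 1 S.card).image t ⊆ S := by
      intro x hx
      obtain ⟨i, hi, rfl⟩ := Finset.mem_image.1 hx
      exact (ht i (Finset.mem_Icc.1 hi)).1
    have hcard : ((Finset.Icc 1 S.card).image t).card = S.card := by
      rw [Finset.card_image_of_injOn hinj, Nat.card_Icc, Nat.add_sub_cancel]
    have := Finset.eq_of_subset_of_card_le hsub hcard.ge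
    rw [← Finset.coe_Icc, ← Finset.coe_image, this]
  unfold occupied
  rw [himage]
  constructor
  · rintro x (hx | hx)
    exacts [Or.inr hx, Or.inl (Or.inl hx)]
  · rintro x ((hx | hx) | hx) hrow
    · exact Or.inr hx
    · have h : x.2 ≤ -2 := hI hx.1
      omega
    · exact Or.inl hx

end RibbonFormation

theorem mainTheorem9 (d : ℝ) (hd : 0 < d)
    (S : Finset RibbonFormation.Lat)
    (hdisk : RibbonFormation.IsDisk (S : Set RibbonFormation.Lat))
    (hS : RibbonFormation.ProperRibbonization (S : Set RibbonFormation.Lat))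
    (I : Finset RibbonFormation.Lat) (hI : RibbonFormation.IsIdlePlacement I)
    (hcard : S.card ≤ I.card)
    (lt : Set RibbonFormation.Lat → Set RibbonFormation.Lat → Prop)
    (hlt : RibbonFormation.IsCompleteTreeOrder (S : Set RibbonFormation.Lat) lt)
    (s t : ℕ → RibbonFormation.Lat)
    (hs : RibbonFormation.IsActivationSequence I S.card s)
    (ht : RibbonFormation.IsAssemblySequence (S : Set RibbonFormation.Lat) lt S.card t) :
    (∀ R : Set RibbonFormation.Lat, RibbonFormation.IsRibbon S R →
      ∃! m, RibbonFormation.IsMergingPoint S R m) ∧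
    Nonempty (RibbonFormation.AffiliatedPath d (RibbonFormation.occupied I s t S.card)) ∧
    ∀ A : RibbonFormation.AffiliatedPath d (RibbonFormation.occupied I s t S.card),
      (∀ (R : Set RibbonFormation.Lat) (m : RibbonFormation.Lat),
        RibbonFormation.IsRibbon S R → RibbonFormation.IsMergingPoint S R m →
          A.Mem (RibbonFormation.pos d m) ∧
          ∀ z : ℂ, A.Mem z →
            RibbonFormation.ContributedBy d (RibbonFormation.occupied I s t S.card) R z →
              A.InFront (RibbonFormation.pos d m) z) ∧
      (∀ (Q R : Set RibbonFormation.Lat) (m n : RibbonFormation.Lat),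
        RibbonFormation.IsAncestor S Q R →
        RibbonFormation.IsMergingPoint S Q m → RibbonFormation.IsMergingPoint S R n →
          A.InFront (RibbonFormation.pos d m) (RibbonFormation.pos d n)) := by
  open RibbonFormation in
  have W := hS.wellLevelled hdisk.2
  have hsm := hS.smooth_formation W
  obtain ⟨M, hM⟩ := exists_tourLength W S.finite_toSet hdisk.1
    (coConnected_hopDomain hS hdisk.2)
  have hocc : Surrounds (S : Set RibbonFormation.Lat) (occupied I s t S.card) :=
    surrounds_occupied hI.subset_H2 ht
  refine ⟨fun R hR => ?_, nonempty_affiliatedPath hd W hsm hM hocc, fun A => ⟨?_, ?_⟩⟩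
  · obtain ⟨x, hx⟩ := exists_isFirstVertex W S.finite_toSet hM hR
    exact W.existsUnique_isMergingPoint hR (hS.two_le_length R hR) hx
  · intro R m hR hm
    refine ⟨?_, fun z hz hzR => A.inFront_of_contributed hd W hsm hM hocc hR
      (hS.two_le_length R hR) hm hz hzR⟩
    obtain ⟨j, hj, -, rfl⟩ := exists_tour_merging W hM hR (hS.two_le_length R hR) hm
    obtain ⟨a, b, h1, h2, h3, -, h4⟩ := A.inFront_of_tour hd W hsm hM hocc le_rfl hj.le
    exact ⟨b, ⟨h1.trans h2, h3⟩, h4⟩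
  · intro Q R m n hQR hm hn
    have hR : IsRibbon (S : Set RibbonFormation.Lat) R := by
      obtain ⟨T, -, h⟩ := Relation.TransGen.tail'_iff.1 hQR
      exact h.2.1
    have hQ : IsRibbon (S : Set RibbonFormation.Lat) Q := by
      obtain ⟨T, h, -⟩ := Relation.TransGen.head'_iff.1 hQR
      exact h.1
    obtain ⟨j, hj, hjR, rfl⟩ := exists_tour_merging W hM hR (hS.two_le_length R hR) hn
    obtain ⟨k, hjk, hkM, hfirst, hmk, -⟩ := exists_exit_step W hM hj.le
      (subtree_subset hQR (hR.subset_subtree hjR))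
    obtain rfl := (W.existsUnique_isMergingPoint hQ (hS.two_le_length Q hQ) hfirst).unique hmk hm
    exact A.inFront_of_tour hd W hsm hM hocc hjk hkM.le
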